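/- Let $\mathbf{Fib}$ be the (strict) 2-category whose objects are fibrations $P\colon\mathcal A\to\mathcal X$, whose 1-cells $P\to Q$ are fibred 1-cells, i.e. pairs $(H,F)$ of functors with $QH=FP$ such that $H$ preserves cartesian morphisms, and whose 2-cells $(H,F)\Rightarrow(K,G)$ are pairs $(\beta,\alpha)$ of natural transformations $\beta\colon H\Rightarrow K$, $\alpha\colon F\Rightarrow G$ with $\beta$ above $\alpha$. Let $\mathbf{ICat}$ be the (strict) 2-category whose objects are indexed categories, i.e. pairs of a category $\mathcal X$ and a pseudofunctor $\mathcal M\colon\mathcal X^{\mathrm{op}}\to\mathbf{Cat}$, whose 1-cells $(\mathcal X,\mathcal M)\to(\mathcal Y,\mathcal N)$ are pairs of a functor $F\colon\mathcal X\to\mathcal Y$ and a pseudonatural transformation $\tau\colon\mathcal M\Rightarrow\mathcal N\circ F^{\mathrm{op}}$, and whose 2-cells $(F,\tau)\Rightarrow(G,\sigma)$ are pairs of a natural transformation $\alpha\colon F\Rightarrow G$ and a modification with components $m_x\colon\tau_x\Rightarrow\mathcal N(\alpha_x)\circ\sigma_x$. Both have finite 2-products and are regarded as cartesian (symmetric)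 monoidal 2-categories: the product of fibrations $P\colon\mathcal A\to\mathcal X$ and $Q\colon\mathcal B\to\mathcal Y$ is $P\times Q\colon\mathcal A\times\mathcal B\to\mathcal X\times\mathcal Y$ with unit $\mathbf 1\to\mathbf 1$; the product of $\mathcal M$ and $\mathcal N$ is the indexed category $(x,y)\mapsto\mathcal M x\times\mathcal N y$ over $\mathcal X\times\mathcal Y$, with unit the constant indexed category $\mathbf 1$ over $\mathbf 1$. Choose a cleavage of every fibration. Let $\mathcal M_{(-)}\colon\mathbf{Fib}\to\mathbf{ICat}$ be the 2-functor that sends a fibration $P$ to the indexed category $x\mapsto\mathcal A_x$ of its fibres, with reindexing along the chosen cartesian liftings, that sends a fibred 1-cell $(H,F)$ to $F$ together with the restrictions of $H$ to the fibres, and a fibred 2-cell $(\beta,\alpha)$ to $\alpha$ together with the factorizations of the components of $\beta$ through the chosen cartesian liftings of the components of $\alpha$. Let $\int\colon\mathbf{ICat}\to\mathbf{Fib}$ be the 2-functor given by the Grothendieck construction: $\int\mathcal M$ has objects $(x,a)$ with $a\in\mathcal M x$ and morphisms $(x,a)\to(y,b)$ the pairs $f\colon x\to y$, $k\colon a\to(\mathcal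 M f)b$; it is fibred over $\mathcal X$ by projection; $(F,\tau)$ is sent to $(x,a)\mapsto(Fx,\tau_x a)$ over $F$; and $(\alpha,m)$ is sent to the transformation with components $(\alpha_x,(m_x)_a)$ over $\alpha$. Then, for every choice of cleavages, the 2-equivalence $\mathcal M_{(-)}\colon\mathbf{Fib}\simeq\mathbf{ICat}\colon\int$ is a symmetric monoidal 2-equivalence. That is, the canonical fibred 1-cells $P\to\int\mathcal M_P$, $a\mapsto(Pa,a)$, over the identity of $\mathcal X$, are the components of a 2-natural isomorphism $1\cong\int\circ\,\mathcal M_{(-)}$; the canonical indexed 1-cells $\mathcal M\to\mathcal M_{\int\mathcal M}$, over the identity of $\mathcal X$, given by the functors $\mathcal M x\to(\int\mathcal M)_x$, $a\mapsto(x,a)$, are the components of the inverse of a 2-natural isomorphism $\mathcal M_{(-)}\circ\int\cong1$; and there are lax symmetric monoidal structures on both 2-functors (with 2-natural laxators) with respect to which these two 2-natural isomorphisms are monoidal. -/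

import Mathlib

open CategoryTheory MonoidalCategory CartesianMonoidalCategory Opposite

set_option linter.checkUnivs false
set_option linter.unusedVariables false

universe v u

section TwoMonoidal
universe w₁ v₁ u₁ w₂ v₂ u₂

/-- A symmetric monoidal structure, in the strict `Cat`-enriched sense, on a strict 2-category: a
symmetric monoidal structure on the underlying category, together with an action of the tensor
product on 2-cells which makes it a 2-functor and for which the structure isomorphisms are
2-natural. The `eqToHom`s identify the two sides of equations of 1-cells. -/
class SymmetricMonoidalTwoCategory (K : Type u₁) [Bicategory.{w₁, v₁} K] [Bicategory.Strict K]
    [MonoidalCategory K] [SymmetricCategory K] where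
  tensorHom₂ {A A' B B' : K} {f f' : A ⟶ A'} {g g' : B ⟶ B'} (η : f ⟶ f') (θ : g ⟶ g') :
    (f ⊗ₘ g) ⟶ (f' ⊗ₘ g')
  tensorHom₂_id {A A' B B' : K} (f : A ⟶ A') (g : B ⟶ B') :
    tensorHom₂ (𝟙 f) (𝟙 g) = 𝟙 (f ⊗ₘ g)
  tensorHom₂_comp {A A' B B' : K} {f f' f'' : A ⟶ A'} {g g' g'' : B ⟶ B'}
    (η : f ⟶ f') (η' : f' ⟶ f'') (θ : g ⟶ g') (θ' : g' ⟶ g'') :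
    tensorHom₂ (η ≫ η') (θ ≫ θ') = tensorHom₂ η θ ≫ tensorHom₂ η' θ'
  tensorHom₂_whiskerLeft {A A' A'' B B' B'' : K} (f : A ⟶ A') {h h' : A' ⟶ A''} (η : h ⟶ h')
    (g : B ⟶ B') {k k' : B' ⟶ B''} (θ : k ⟶ k') :
    tensorHom₂ (Bicategory.whiskerLeft f η) (Bicategory.whiskerLeft g θ) =
      eqToHom (tensorHom_comp_tensorHom f g h k).symm ≫
        Bicategory.whiskerLeft (f ⊗ₘ g) (tensorHom₂ η θ) ≫
        eqToHom (tensorHom_comp_tensorHom f g h' k')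
  tensorHom₂_whiskerRight {A A' A'' B B' B'' : K} {f f' : A ⟶ A'} (η : f ⟶ f') (h : A' ⟶ A'')
    {g g' : B ⟶ B'} (θ : g ⟶ g') (k : B' ⟶ B'') :
    tensorHom₂ (Bicategory.whiskerRight η h) (Bicategory.whiskerRight θ k) =
      eqToHom (tensorHom_comp_tensorHom f g h k).symm ≫
        Bicategory.whiskerRight (tensorHom₂ η θ) (h ⊗ₘ k) ≫
        eqToHom (tensorHom_comp_tensorHom f' g' h k)
  associator_naturality₂ {A A' B B' C C' : K} {f f' : A ⟶ A'} {g g' : B ⟶ B'} {h h' : C ⟶ C'}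
    (η : f ⟶ f') (θ : g ⟶ g') (ζ : h ⟶ h') :
    Bicategory.whiskerRight (tensorHom₂ (tensorHom₂ η θ) ζ) (α_ A' B' C').hom =
      eqToHom (associator_naturality f g h) ≫
        Bicategory.whiskerLeft (α_ A B C).hom (tensorHom₂ η (tensorHom₂ θ ζ)) ≫
        eqToHom (associator_naturality f' g' h').symm
  leftUnitor_naturality₂ {A A' : K} {f f' : A ⟶ A'} (η : f ⟶ f') :
    Bicategory.whiskerRight (tensorHom₂ (𝟙 (𝟙 (𝟙_ K))) η) (λ_ A').hom =
      eqToHom (by simp) ≫ Bicategory.whiskerLeft (λ_ A).hom η ≫ eqToHom (by simp)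
  rightUnitor_naturality₂ {A A' : K} {f f' : A ⟶ A'} (η : f ⟶ f') :
    Bicategory.whiskerRight (tensorHom₂ η (𝟙 (𝟙 (𝟙_ K)))) (ρ_ A').hom =
      eqToHom (by simp) ≫ Bicategory.whiskerLeft (ρ_ A).hom η ≫ eqToHom (by simp)
  braiding_naturality₂ {A A' B B' : K} {f f' : A ⟶ A'} {g g' : B ⟶ B'}
    (η : f ⟶ f') (θ : g ⟶ g') :
    Bicategory.whiskerRight (tensorHom₂ η θ) (β_ A' B').hom =
      eqToHom (BraidedCategory.braiding_naturality f g) ≫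
        Bicategory.whiskerLeft (β_ A B).hom (tensorHom₂ θ η) ≫
        eqToHom (BraidedCategory.braiding_naturality f' g').symm

open SymmetricMonoidalTwoCategory

variable {K : Type u₁} [Bicategory.{w₁, v₁} K] [Bicategory.Strict K]
    [MonoidalCategory K] [SymmetricCategory K] [SymmetricMonoidalTwoCategory K]
  {L : Type u₂} [Bicategory.{w₂, v₂} L] [Bicategory.Strict L]
    [MonoidalCategory L] [SymmetricCategory L] [SymmetricMonoidalTwoCategory L]

/-- A lax symmetric monoidal structure on a strict 2-functor: a lax symmetric monoidal structure
on the underlying functor whose laxator `F A ⊗ F B ⟶ F (A ⊗ B)` is 2-natural. -/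
class LaxSymmetricMonoidalTwoFunctor (F : StrictPseudofunctor K L) extends
    F.toFunctor.LaxBraided where
  μ_naturality₂ {A A' B B' : K} {f f' : A ⟶ A'} {g g' : B ⟶ B'} (η : f ⟶ f') (θ : g ⟶ g') :
    Bicategory.whiskerRight (tensorHom₂ (F.map₂ η) (F.map₂ θ)) (μ A' B') =
      eqToHom (Functor.LaxMonoidal.μ_natural F.toFunctor f g) ≫
        Bicategory.whiskerLeft (μ A B) (F.map₂ (tensorHom₂ η θ)) ≫
        eqToHom (Functor.LaxMonoidal.μ_natural F.toFunctor f' g').symm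

/-- A 2-natural isomorphism between strict 2-functors: an isomorphism of the underlying functors
which is moreover natural with respect to 2-cells. -/
structure TwoNatIso (F G : StrictPseudofunctor K L) where
  iso : F.toFunctor ≅ G.toFunctor
  naturality₂ {A B : K} {f g : A ⟶ B} (η : f ⟶ g) :
    Bicategory.whiskerRight (F.map₂ η) (iso.hom.app B) =
      eqToHom (iso.hom.naturality f) ≫ Bicategory.whiskerLeft (iso.hom.app A) (G.map₂ η) ≫
        eqToHom (iso.hom.naturality g).symm

/-- The structure of a symmetric monoidal 2-equivalence on a pair of 2-functors `F : K → L` and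
`G : L → K`: lax symmetric monoidal structures on both of them, and monoidal 2-natural isomorphisms
from the identity of `K` to `G ∘ F`, and from `F ∘ G` to the identity of `L`. -/
structure SymmetricMonoidalTwoEquivalence (F : StrictPseudofunctor K L)
    (G : StrictPseudofunctor L K) where
  [laxF : LaxSymmetricMonoidalTwoFunctor F]
  [laxG : LaxSymmetricMonoidalTwoFunctor G]
  unit : TwoNatIso (StrictPseudofunctor.id K) (F.comp G)
  counit : TwoNatIso (G.comp F) (StrictPseudofunctor.id L)
  unit_isMonoidal : NatTrans.IsMonoidal (F₁ := 𝟭 K) (F₂ := F.toFunctor ⋙ G.toFunctor) unit.iso.hom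
  counit_isMonoidal :
    NatTrans.IsMonoidal (F₁ := G.toFunctor ⋙ F.toFunctor) (F₂ := 𝟭 L) counit.iso.hom

end TwoMonoidal
section TwoCartesian
universe w₁ v₁ u₁

/-- A strict 2-category with finite 2-products: the chosen finite products of the underlying
category also have the universal property of products for 2-cells. -/
class CartesianTwoCategory (K : Type u₁) [Bicategory.{w₁, v₁} K] [Bicategory.Strict K]
    [CartesianMonoidalCategory K] where
  lift₂ {T A B : K} {f g : T ⟶ A ⊗ B} (η : f ≫ fst A B ⟶ g ≫ fst A B)
    (θ : f ≫ snd A B ⟶ g ≫ snd A B) : f ⟶ g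
  lift₂_fst {T A B : K} {f g : T ⟶ A ⊗ B} (η : f ≫ fst A B ⟶ g ≫ fst A B)
    (θ : f ≫ snd A B ⟶ g ≫ snd A B) : Bicategory.whiskerRight (lift₂ η θ) (fst A B) = η
  lift₂_snd {T A B : K} {f g : T ⟶ A ⊗ B} (η : f ≫ fst A B ⟶ g ≫ fst A B)
    (θ : f ≫ snd A B ⟶ g ≫ snd A B) : Bicategory.whiskerRight (lift₂ η θ) (snd A B) = θ
  hom_ext₂ {T A B : K} {f g : T ⟶ A ⊗ B} (η θ : f ⟶ g)
    (h₁ : Bicategory.whiskerRight η (fst A B) = Bicategory.whiskerRight θ (fst A B))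
    (h₂ : Bicategory.whiskerRight η (snd A B) = Bicategory.whiskerRight θ (snd A B)) : η = θ
  unit_ext₂ {T : K} {f g : T ⟶ 𝟙_ K} (η θ : f ⟶ g) : η = θ

namespace CartesianTwoCategory

section Strict
variable {K : Type u₁} [Bicategory.{w₁, v₁} K]

theorem whiskerRight_heq {a b c : K} {f f' g g' : a ⟶ b} (hf : f = f') (hg : g = g')
    {η : f ⟶ g} {η' : f' ⟶ g'} (h : η ≍ η') (k : b ⟶ c) :
    Bicategory.whiskerRight η k ≍ Bicategory.whiskerRight η' k := by
  subst hf hg; cases h; rfl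

theorem whiskerRight_heq' {a b c : K} {f g : a ⟶ b}
    (η : f ⟶ g) {k k' : b ⟶ c} (h : k = k') :
    Bicategory.whiskerRight η k ≍ Bicategory.whiskerRight η k' := by
  subst h; rfl

theorem whiskerLeft_heq {a b c : K} {f f' g g' : b ⟶ c} (hf : f = f') (hg : g = g')
    {η : f ⟶ g} {η' : f' ⟶ g'} (h : η ≍ η') (k : a ⟶ b) :
    Bicategory.whiskerLeft k η ≍ Bicategory.whiskerLeft k η' := by
  subst hf hg; cases h; rfl

theorem whiskerLeft_heq' {a b c : K} {f g : b ⟶ c}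
    (η : f ⟶ g) {k k' : a ⟶ b} (h : k = k') :
    Bicategory.whiskerLeft k η ≍ Bicategory.whiskerLeft k' η := by
  subst h; rfl

theorem comp_heq {a b : K} {f f' g g' h h' : a ⟶ b} (hf : f = f') (hg : g = g') (hh : h = h')
    {η : f ⟶ g} {η' : f' ⟶ g'} {θ : g ⟶ h} {θ' : g' ⟶ h'} (h₁ : η ≍ η') (h₂ : θ ≍ θ') :
    η ≫ θ ≍ η' ≫ θ' := by
  subst hf hg hh; cases h₁; cases h₂; rfl

theorem conj_heq {a b : K} {f f' g g' : a ⟶ b} (hf : f' = f) (hg : g = g') (η : f ⟶ g) :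
    eqToHom hf ≫ η ≫ eqToHom hg ≍ η := by
  subst hf hg; simp

theorem eq_conj {a b : K} {f f' g g' : a ⟶ b} (hf : f' = f) (hg : g = g') {η : f ⟶ g}
   {θ : f' ⟶ g'} (h : θ ≍ η) : θ = eqToHom hf ≫ η ≫ eqToHom hg := by
  subst hf hg; simpa using h

variable [Bicategory.Strict K]

theorem whisker_assoc_heq {a b c d : K} (f : a ⟶ b) {g g' : b ⟶ c} (η : g ⟶ g') (h : c ⟶ d) :
    Bicategory.whiskerRight (Bicategory.whiskerLeft f η) h ≍
      Bicategory.whiskerLeft f (Bicategory.whiskerRight η h) := by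
  rw [Bicategory.whisker_assoc, Bicategory.Strict.associator_eqToIso,
    Bicategory.Strict.associator_eqToIso]
  exact conj_heq (Bicategory.Strict.assoc _ _ _) (Bicategory.Strict.assoc _ _ _).symm _

theorem whiskerRight_comp_heq {a b c d : K} {f f' : a ⟶ b} (η : f ⟶ f') (g : b ⟶ c) (h : c ⟶ d) :
    Bicategory.whiskerRight η (g ≫ h) ≍
      Bicategory.whiskerRight (Bicategory.whiskerRight η g) h := by
  rw [Bicategory.whiskerRight_comp, Bicategory.Strict.associator_eqToIso,
    Bicategory.Strict.associator_eqToIso]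
  exact conj_heq (Bicategory.Strict.assoc _ _ _).symm (Bicategory.Strict.assoc _ _ _) _

theorem comp_whiskerLeft_heq {a b c d : K} (f : a ⟶ b) (g : b ⟶ c) {h h' : c ⟶ d} (η : h ⟶ h') :
    Bicategory.whiskerLeft (f ≫ g) η ≍
      Bicategory.whiskerLeft f (Bicategory.whiskerLeft g η) := by
  rw [Bicategory.comp_whiskerLeft, Bicategory.Strict.associator_eqToIso,
    Bicategory.Strict.associator_eqToIso]
  exact conj_heq (Bicategory.Strict.assoc _ _ _) (Bicategory.Strict.assoc _ _ _).symm _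

end Strict

variable {K : Type u₁} [Bicategory.{w₁, v₁} K] [Bicategory.Strict K]
    [CartesianMonoidalCategory K] [CartesianTwoCategory K]

theorem hext₂ {T A B : K} {f g f' g' : T ⟶ A ⊗ B} (hf : f = f') (hg : g = g') {η : f ⟶ g}
    {θ : f' ⟶ g'}
    (h₁ : Bicategory.whiskerRight η (fst A B) ≍ Bicategory.whiskerRight θ (fst A B))
    (h₂ : Bicategory.whiskerRight η (snd A B) ≍ Bicategory.whiskerRight θ (snd A B)) : η ≍ θ := by
  subst hf hg
  exact heq_of_eq (hom_ext₂ _ _ (eq_of_heq h₁) (eq_of_heq h₂))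

/-- The action of the product on 2-cells. -/
def tensorHom₂ {A A' B B' : K} {f f' : A ⟶ A'} {g g' : B ⟶ B'} (η : f ⟶ f') (θ : g ⟶ g') :
    (f ⊗ₘ g) ⟶ (f' ⊗ₘ g') :=
  lift₂
    (eqToHom (tensorHom_fst f g) ≫ Bicategory.whiskerLeft (fst A B) η ≫
      eqToHom (tensorHom_fst f' g').symm)
    (eqToHom (tensorHom_snd f g) ≫ Bicategory.whiskerLeft (snd A B) θ ≫
      eqToHom (tensorHom_snd f' g').symm)

theorem tensorHom₂_fst {A A' B B' : K} {f f' : A ⟶ A'} {g g' : B ⟶ B'} (η : f ⟶ f')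
    (θ : g ⟶ g') : Bicategory.whiskerRight (tensorHom₂ η θ) (fst A' B') ≍
      Bicategory.whiskerLeft (fst A B) η := by
  rw [tensorHom₂, lift₂_fst]; exact conj_heq _ _ _

theorem tensorHom₂_snd {A A' B B' : K} {f f' : A ⟶ A'} {g g' : B ⟶ B'} (η : f ⟶ f')
    (θ : g ⟶ g') : Bicategory.whiskerRight (tensorHom₂ η θ) (snd A' B') ≍
      Bicategory.whiskerLeft (snd A B) θ := by
  rw [tensorHom₂, lift₂_snd]; exact conj_heq _ _ _

theorem tensorHom₂_wR_fst {A A' A'' B B' : K} {f f' : A ⟶ A'} {g g' : B ⟶ B'} (η : f ⟶ f')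
    (θ : g ⟶ g') (q : A' ⟶ A'') {r : A' ⊗ B' ⟶ A''} (h : r = fst A' B' ≫ q) :
    Bicategory.whiskerRight (tensorHom₂ η θ) r ≍
      Bicategory.whiskerLeft (fst A B) (Bicategory.whiskerRight η q) := by
  subst h
  refine (whiskerRight_comp_heq _ _ _).trans ?_
  refine (whiskerRight_heq (tensorHom_fst f g) (tensorHom_fst f' g')
    (tensorHom₂_fst η θ) q).trans ?_
  exact whisker_assoc_heq _ _ _

theorem tensorHom₂_wR_snd {A A' B'' B B' : K} {f f' : A ⟶ A'} {g g' : B ⟶ B'} (η : f ⟶ f')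
    (θ : g ⟶ g') (q : B' ⟶ B'') {r : A' ⊗ B' ⟶ B''} (h : r = snd A' B' ≫ q) :
    Bicategory.whiskerRight (tensorHom₂ η θ) r ≍
      Bicategory.whiskerLeft (snd A B) (Bicategory.whiskerRight θ q) := by
  subst h
  refine (whiskerRight_comp_heq _ _ _).trans ?_
  refine (whiskerRight_heq (tensorHom_snd f g) (tensorHom_snd f' g')
    (tensorHom₂_snd η θ) q).trans ?_
  exact whisker_assoc_heq _ _ _

/-- `(p ◁ tensorHom₂ η θ) ▷ fst ≍ r ◁ η` when `p ≫ fst = r` -/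
theorem wL_tensorHom₂_fst {T A A' B B' : K} {f f' : A ⟶ A'} {g g' : B ⟶ B'} (η : f ⟶ f')
    (θ : g ⟶ g') (p : T ⟶ A ⊗ B) {r : T ⟶ A} (h : p ≫ fst A B = r) :
    Bicategory.whiskerRight (Bicategory.whiskerLeft p (tensorHom₂ η θ)) (fst A' B') ≍
      Bicategory.whiskerLeft r η := by
  subst h
  refine (whisker_assoc_heq _ _ _).trans ?_
  refine (whiskerLeft_heq (tensorHom_fst f g) (tensorHom_fst f' g')
    (tensorHom₂_fst η θ) p).trans ?_
  exact (comp_whiskerLeft_heq _ _ _).symm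

theorem wL_tensorHom₂_snd {T A A' B B' : K} {f f' : A ⟶ A'} {g g' : B ⟶ B'} (η : f ⟶ f')
    (θ : g ⟶ g') (p : T ⟶ A ⊗ B) {r : T ⟶ B} (h : p ≫ snd A B = r) :
    Bicategory.whiskerRight (Bicategory.whiskerLeft p (tensorHom₂ η θ)) (snd A' B') ≍
      Bicategory.whiskerLeft r θ := by
  subst h
  refine (whisker_assoc_heq _ _ _).trans ?_
  refine (whiskerLeft_heq (tensorHom_snd f g) (tensorHom_snd f' g')
    (tensorHom₂_snd η θ) p).trans ?_
  exact (comp_whiskerLeft_heq _ _ _).symm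

/-- The cartesian symmetric monoidal structure of a 2-category with finite 2-products. -/
instance [BraidedCategory K] : SymmetricMonoidalTwoCategory K where
  tensorHom₂ := tensorHom₂
  tensorHom₂_id f g := by
    apply hom_ext₂
    · apply eq_of_heq
      refine (tensorHom₂_fst _ _).trans ?_
      simp only [Bicategory.whiskerLeft_id, Bicategory.id_whiskerRight]
      rw [tensorHom_fst]
    · apply eq_of_heq
      refine (tensorHom₂_snd _ _).trans ?_
      simp only [Bicategory.whiskerLeft_id, Bicategory.id_whiskerRight]
      rw [tensorHom_snd]
  tensorHom₂_comp {A A' B B' f f' f'' g g' g''} η η' θ θ' := by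
    apply hom_ext₂
    · apply eq_of_heq
      refine (tensorHom₂_fst _ _).trans ?_
      rw [Bicategory.comp_whiskerRight, Bicategory.whiskerLeft_comp]
      exact (comp_heq (tensorHom_fst _ _) (tensorHom_fst _ _) (tensorHom_fst _ _)
        (tensorHom₂_fst _ _) (tensorHom₂_fst _ _)).symm
    · apply eq_of_heq
      refine (tensorHom₂_snd _ _).trans ?_
      rw [Bicategory.comp_whiskerRight, Bicategory.whiskerLeft_comp]
      exact (comp_heq (tensorHom_snd _ _) (tensorHom_snd _ _) (tensorHom_snd _ _)
        (tensorHom₂_snd _ _) (tensorHom₂_snd _ _)).symm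
  tensorHom₂_whiskerLeft f _ _ η g _ _ θ := by
    apply eq_conj
    apply hext₂ (tensorHom_comp_tensorHom _ _ _ _).symm (tensorHom_comp_tensorHom _ _ _ _).symm
    · refine (tensorHom₂_fst _ _).trans ((comp_whiskerLeft_heq _ _ _).symm.trans ?_)
      exact (wL_tensorHom₂_fst η θ (f ⊗ₘ g) (tensorHom_fst f g)).symm
    · refine (tensorHom₂_snd _ _).trans ((comp_whiskerLeft_heq _ _ _).symm.trans ?_)
      exact (wL_tensorHom₂_snd η θ (f ⊗ₘ g) (tensorHom_snd f g)).symm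
  tensorHom₂_whiskerRight η h _ _ θ k := by
    apply eq_conj
    apply hext₂ (tensorHom_comp_tensorHom _ _ _ _).symm (tensorHom_comp_tensorHom _ _ _ _).symm
    · refine (tensorHom₂_fst _ _).trans ?_
      refine HEq.trans ?_ (whiskerRight_comp_heq _ _ _)
      exact (tensorHom₂_wR_fst η θ h (tensorHom_fst _ _)).symm
    · refine (tensorHom₂_snd _ _).trans ?_
      refine HEq.trans ?_ (whiskerRight_comp_heq _ _ _)
      exact (tensorHom₂_wR_snd η θ k (tensorHom_snd _ _)).symm
  associator_naturality₂ {A A' B B' C C' f f' g g' h h'} η θ ζ := by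
    apply eq_conj
    apply hext₂ (associator_naturality _ _ _) (associator_naturality _ _ _)
    · refine (whiskerRight_comp_heq _ _ _).symm.trans ?_
      refine (tensorHom₂_wR_fst _ ζ (fst A' B') (associator_hom_fst A' B' C')).trans ?_
      refine (whiskerLeft_heq (tensorHom_fst _ _) (tensorHom_fst _ _) (tensorHom₂_fst η θ) _).trans ?_
      refine (comp_whiskerLeft_heq _ _ _).symm.trans ?_
      exact (wL_tensorHom₂_fst η _ _ (associator_hom_fst A B C)).symm
    · apply hext₂ (by simp) (by simp)
      · refine (whiskerRight_heq (by simp) (by simp) (whiskerRight_comp_heq _ _ _).symm _).trans ?_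
        refine (whiskerRight_comp_heq _ _ _).symm.trans ?_
        refine (tensorHom₂_wR_fst _ ζ (snd A' B') (by simp)).trans ?_
        refine (whiskerLeft_heq (tensorHom_snd _ _) (tensorHom_snd _ _) (tensorHom₂_snd η θ) _).trans ?_
        refine (comp_whiskerLeft_heq _ _ _).symm.trans ?_
        refine HEq.symm ?_
        refine (whiskerRight_heq (by simp) (by simp)
          (wL_tensorHom₂_snd η (tensorHom₂ θ ζ) _ rfl) _).trans ?_
        exact wL_tensorHom₂_fst θ ζ _ (by simp)
      · refine (whiskerRight_heq (by simp) (by simp) (whiskerRight_comp_heq _ _ _).symm _).trans ?_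
        refine (whiskerRight_comp_heq _ _ _).symm.trans ?_
        refine (whiskerRight_heq' (k' := snd (A' ⊗ B') C') _ (by simp)).trans ?_
        refine (tensorHom₂_snd _ ζ).trans ?_
        refine HEq.symm ?_
        refine (whiskerRight_heq (by simp) (by simp)
          (wL_tensorHom₂_snd η (tensorHom₂ θ ζ) _ rfl) _).trans ?_
        exact wL_tensorHom₂_snd θ ζ _ (by simp)
  leftUnitor_naturality₂ η := by
    apply eq_conj
    refine (whiskerRight_heq' _ (leftUnitor_hom _)).trans ((tensorHom₂_snd _ _).trans ?_)
    exact whiskerLeft_heq' _ (leftUnitor_hom _).symm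
  rightUnitor_naturality₂ η := by
    apply eq_conj
    refine (whiskerRight_heq' _ (rightUnitor_hom _)).trans ((tensorHom₂_fst _ _).trans ?_)
    exact whiskerLeft_heq' _ (rightUnitor_hom _).symm
  braiding_naturality₂ {A A' B B' f f' g g'} η θ := by
    apply eq_conj
    apply hext₂ (BraidedCategory.braiding_naturality _ _) (BraidedCategory.braiding_naturality _ _)
    · refine (whiskerRight_comp_heq _ _ _).symm.trans ?_
      refine (whiskerRight_heq' _ (braiding_hom_fst _ _)).trans ((tensorHom₂_snd _ _).trans ?_)
      exact (wL_tensorHom₂_fst _ _ _ (braiding_hom_fst _ _)).symm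
    · refine (whiskerRight_comp_heq _ _ _).symm.trans ?_
      refine (whiskerRight_heq' _ (braiding_hom_snd _ _)).trans ((tensorHom₂_fst _ _).trans ?_)
      exact (wL_tensorHom₂_snd _ _ _ (braiding_hom_snd _ _)).symm

end CartesianTwoCategory
end TwoCartesian

/-- A fibration: a functor `proj : total ⥤ base` in which every morphism of the base with a lift of
its codomain has a cartesian lifting. -/
structure Fib where
  base : Type u
  [catBase : Category.{v} base]
  total : Type u
  [catTotal : Category.{v} total]
  proj : total ⥤ base
  [isFibered : proj.IsFibered]

namespace Fib

attribute [instance] catBase catTotal isFibered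

/-- A morphism `φ` of the total category is cartesian (over its image). -/
abbrev IsCart (P : Fib.{v, u}) {a b : P.total} (φ : a ⟶ b) : Prop :=
  P.proj.IsStronglyCartesian (P.proj.map φ) φ

/-- A fibred 1-cell: a strictly commuting square whose top functor preserves cartesian
morphisms. -/
structure Hom (P Q : Fib.{v, u}) where
  base : P.base ⥤ Q.base
  total : P.total ⥤ Q.total
  w : total ⋙ Q.proj = P.proj ⋙ base
  cart : ∀ {a b : P.total} (φ : a ⟶ b), P.IsCart φ → Q.IsCart (total.map φ)

/-- A fibred 2-cell: a pair of natural transformations, the top one lying above the bottom one. -/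
@[ext]
structure Hom₂ {P Q : Fib.{v, u}} (f g : Hom P Q) where
  base : f.base ⟶ g.base
  total : f.total ⟶ g.total
  w : ∀ a : P.total, Q.proj.IsHomLift (base.app (P.proj.obj a)) (total.app a)

/-- Fibrations and fibred 1-cells. -/
instance : CategoryStruct Fib.{v, u} where
  Hom := Hom
  id P := ⟨𝟭 _, 𝟭 _, rfl, fun _ h => h⟩
  comp f g := ⟨f.base ⋙ g.base, f.total ⋙ g.total,
    by rw [Functor.assoc, g.w, ← Functor.assoc, f.w, Functor.assoc],
    fun φ h => g.cart _ (f.cart φ h)⟩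

/-- The category of fibred 1-cells and fibred 2-cells between two fibrations. -/
@[simps]
instance homCat (P Q : Fib.{v, u}) : Category (P ⟶ Q) where
  Hom f g := Hom₂ f g
  id f := ⟨𝟙 f.base, 𝟙 f.total, fun a => IsHomLift.id (Functor.congr_obj f.w a)⟩
  comp η θ := ⟨η.base ≫ θ.base, η.total ≫ θ.total, fun a =>
    have := η.w a; have := θ.w a; IsHomLift.comp Q.proj _ _ _ _⟩

@[ext]
theorem hom₂_ext {P Q : Fib.{v, u}} {f g : P ⟶ Q} {η θ : f ⟶ g}
    (hb : η.base = θ.base) (ht : η.total = θ.total) : η = θ :=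
  Hom₂.ext hb ht

theorem hom₂_ext' {P Q : Fib.{v, u}} {f g : P ⟶ Q} {η θ : f ⟶ g}
    (hb : ∀ x, η.base.app x = θ.base.app x) (ht : ∀ a, η.total.app a = θ.total.app a) : η = θ :=
  hom₂_ext (NatTrans.ext (funext hb)) (NatTrans.ext (funext ht))

theorem conj_id {C : Type*} [Category C] {x y : C} (f : x ⟶ y) : f = 𝟙 x ≫ f ≫ 𝟙 y := by simp

/-- An invertible fibred 2-cell from a pair of natural isomorphisms. -/
def isoOf {P Q : Fib.{v, u}} {f g : P ⟶ Q} (b : f.base ≅ g.base) (t : f.total ≅ g.total)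
   (w : ∀ a, Q.proj.IsHomLift (b.hom.app (P.proj.obj a)) (t.hom.app a)) : f ≅ g where
  hom := ⟨b.hom, t.hom, w⟩
  inv := ⟨b.inv, t.inv, fun a => by
    have : Q.proj.IsHomLift (b.app (P.proj.obj a)).hom (t.app a).hom := w a
    exact IsHomLift.inv_lift_inv Q.proj (b.app _) (t.app a)⟩
  hom_inv_id := hom₂_ext b.hom_inv_id t.hom_inv_id
  inv_hom_id := hom₂_ext b.inv_hom_id t.inv_hom_id

theorem idLift {P Q : Fib.{v, u}} (f : P ⟶ Q) (a : P.total) :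
  Q.proj.IsHomLift (𝟙 (f.base.obj (P.proj.obj a))) (𝟙 (f.total.obj a)) :=
  IsHomLift.id (Functor.congr_obj f.w a)

theorem lift_map {P Q : Fib.{v, u}} (f : P ⟶ Q) {x y : P.base} {a b : P.total} (k : x ⟶ y) (φ : a ⟶ b)
   (h : P.proj.IsHomLift k φ) : Q.proj.IsHomLift (f.base.map k) (f.total.map φ) := by
  obtain ⟨⟩ := h
  refine IsHomLift.of_fac' Q.proj _ _ (Functor.congr_obj f.w _) (Functor.congr_obj f.w _) ?_
  exact Functor.congr_hom f.w φ

/-- The 2-category of fibrations. -/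
instance : Bicategory Fib.{v, u} where
  homCategory := homCat
  whiskerLeft {_ Q _} f _ _ η := ⟨Functor.whiskerLeft f.base η.base, Functor.whiskerLeft f.total η.total,
    fun a => by
      have := η.w (f.total.obj a)
      rw [show Q.proj.obj (f.total.obj a) = f.base.obj (_) from Functor.congr_obj f.w a] at this
      exact this⟩
  whiskerRight η h := ⟨Functor.whiskerRight η.base h.base, Functor.whiskerRight η.total h.total,
    fun a => lift_map h _ _ (η.w a)⟩
  associator f g h := isoOf (Functor.associator _ _ _) (Functor.associator _ _ _)
    (fun a => idLift (f ≫ g ≫ h) a)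
  leftUnitor f := isoOf (Functor.leftUnitor _) (Functor.leftUnitor _) (fun a => idLift f a)
  rightUnitor f := isoOf (Functor.rightUnitor _) (Functor.rightUnitor _) (fun a => idLift f a)
  whiskerLeft_id _ _ := rfl
  whiskerLeft_comp _ _ _ _ _ _ := rfl
  id_whiskerLeft _ := hom₂_ext' (fun _ => conj_id _) (fun _ => conj_id _)
  comp_whiskerLeft _ _ _ _ _ := hom₂_ext' (fun _ => conj_id _) (fun _ => conj_id _)
  id_whiskerRight _ h := hom₂_ext' (fun _ => h.base.map_id _) (fun _ => h.total.map_id _)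
  comp_whiskerRight _ _ h :=
    hom₂_ext' (fun _ => h.base.map_comp _ _) (fun _ => h.total.map_comp _ _)
  whiskerRight_id _ := hom₂_ext' (fun _ => conj_id _) (fun _ => conj_id _)
  whiskerRight_comp _ _ _ := hom₂_ext' (fun _ => conj_id _) (fun _ => conj_id _)
  whisker_assoc _ _ _ _ _ := hom₂_ext' (fun _ => conj_id _) (fun _ => conj_id _)
  whisker_exchange η θ := hom₂_ext' (fun _ => (θ.base.naturality _).symm)
    (fun _ => (θ.total.naturality _).symm)
  pentagon _ _ _ i := hom₂_ext' (fun _ => (congrArg (· ≫ _) (i.base.map_id _)).trans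
      (Category.id_comp _))
    (fun _ => (congrArg (· ≫ _) (i.total.map_id _)).trans
      (Category.id_comp _))
  triangle _ g := hom₂_ext' (fun _ => (Category.id_comp _).trans (g.base.map_id _).symm)
    (fun _ => (Category.id_comp _).trans (g.total.map_id _).symm)

instance : Bicategory.Strict Fib.{v, u} where
  id_comp _ := rfl
  comp_id _ := rfl
  assoc _ _ _ := rfl
  leftUnitor_eqToIso _ := Iso.ext rfl
  rightUnitor_eqToIso _ := Iso.ext rfl
  associator_eqToIso f g h := Iso.ext (hom₂_ext' (η := (Bicategory.associator f g h).hom) (θ := 𝟙 ((f ≫ g) ≫ h)) (fun _ => rfl) (fun _ => rfl))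

theorem isHomLift_iff {C D : Type*} [Category C] [Category D] (p : C ⥤ D) {a b : C}
    (f : p.obj a ⟶ p.obj b) (φ : a ⟶ b) : p.IsHomLift f φ ↔ p.map φ = f :=
  ⟨fun _ => (IsHomLift.eq_of_isHomLift p f φ).symm, fun h => h ▸ IsHomLift.map p φ⟩

theorem isStronglyCartesian_iff {C D : Type*} [Category C] [Category D] (p : C ⥤ D) {a b : C}
    (φ : a ⟶ b) : p.IsStronglyCartesian (p.map φ) φ ↔
      ∀ (c : C) (g : p.obj c ⟶ p.obj a) (θ : c ⟶ b), p.map θ = g ≫ p.map φ →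
        ∃! χ : c ⟶ a, p.map χ = g ∧ χ ≫ φ = θ := by
  constructor
  · intro h c g θ w
    have := (isHomLift_iff p (g ≫ p.map φ) θ).2 w
    simpa only [isHomLift_iff] using
      Functor.IsStronglyCartesian.universal_property' (p := p) (f := p.map φ) (φ := φ) g θ
  · intro h
    refine { universal_property' := fun {c} g θ _ => ?_ }
    simpa only [isHomLift_iff] using h c g θ ((isHomLift_iff p _ θ).1 inferInstance)

theorem isHomLift_prod {C D C' D' : Type*} [Category C] [Category D] [Category C']
    [Category D'] {p : C ⥤ D} {q : C' ⥤ D'} {x y : D} {x' y' : D'} {a b : C} {a' b' : C'}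
    {f : x ⟶ y} {f' : x' ⟶ y'} {φ : a ⟶ b} {φ' : a' ⟶ b'} (h : p.IsHomLift f φ)
    (h' : q.IsHomLift f' φ') :
    (p.prod q).IsHomLift (R := (x, x')) (S := (y, y')) (a := (a, a')) (b := (b, b'))
      (f, f') (φ, φ') := by
  obtain ⟨⟩ := h
  obtain ⟨⟩ := h'
  exact IsHomLift.map (p.prod q) (a := (_, _)) (b := (_, _)) (φ, φ')

theorem isStronglyCartesian_prod_iff {C D C' D' : Type*} [Category C] [Category D] [Category C']
    [Category D'] (p : C ⥤ D) (q : C' ⥤ D') {a b : C × C'} (φ : a ⟶ b) :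
    (p.prod q).IsStronglyCartesian ((p.prod q).map φ) φ ↔
      p.IsStronglyCartesian (p.map φ.1) φ.1 ∧ q.IsStronglyCartesian (q.map φ.2) φ.2 := by
  simp only [isStronglyCartesian_iff]
  constructor
  · intro h
    constructor
    · intro c g θ w
      obtain ⟨χ, ⟨h₁, h₂⟩, h₃⟩ := h (c, a.2) (g, 𝟙 _) (θ, φ.2)
        (Prod.ext w (Category.id_comp _).symm)
      refine ⟨χ.1, ⟨congrArg Prod.fst h₁, congrArg Prod.fst h₂⟩, fun ξ hξ => ?_⟩
      exact congrArg Prod.fst (h₃ (ξ, 𝟙 _) ⟨Prod.ext hξ.1 (q.map_id _),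
        Prod.ext hξ.2 (Category.id_comp _)⟩)
    · intro c g θ w
      obtain ⟨χ, ⟨h₁, h₂⟩, h₃⟩ := h (a.1, c) (𝟙 _, g) (φ.1, θ)
        (Prod.ext (Category.id_comp _).symm w)
      refine ⟨χ.2, ⟨congrArg Prod.snd h₁, congrArg Prod.snd h₂⟩, fun ξ hξ => ?_⟩
      exact congrArg Prod.snd (h₃ (𝟙 _, ξ) ⟨Prod.ext (p.map_id _) hξ.1,
        Prod.ext (Category.id_comp _) hξ.2⟩)
  · rintro ⟨h, h'⟩ c g θ w
    obtain ⟨χ, ⟨h₁, h₂⟩, h₃⟩ := h c.1 g.1 θ.1 (congrArg Prod.fst w)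
    obtain ⟨χ', ⟨h₁', h₂'⟩, h₃'⟩ := h' c.2 g.2 θ.2 (congrArg Prod.snd w)
    refine ⟨(χ, χ'), ⟨Prod.ext h₁ h₁', Prod.ext h₂ h₂'⟩, fun ξ hξ => ?_⟩
    exact Prod.ext (h₃ _ ⟨congrArg Prod.fst hξ.1, congrArg Prod.fst hξ.2⟩)
      (h₃' _ ⟨congrArg Prod.snd hξ.1, congrArg Prod.snd hξ.2⟩)

theorem exists_isStronglyCartesian {C D : Type*} [Category C] [Category D] (p : C ⥤ D)
    [p.IsFibered] (b : C) {x : D} (f : x ⟶ p.obj b) :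
    ∃ (a : C) (φ : a ⟶ b), p.IsStronglyCartesian f φ :=
  ⟨_, Functor.IsPreFibered.pullbackMap rfl f, inferInstance⟩

instance prod_isFibered (P Q : Fib.{v, u}) : (P.proj.prod Q.proj).IsFibered := by
  refine Functor.IsFibered.of_exists_isStronglyCartesian fun b x f => ?_
  obtain ⟨x₁, x₂⟩ := x
  obtain ⟨a₁, φ₁, h₁⟩ := exists_isStronglyCartesian P.proj b.1 f.1
  obtain ⟨a₂, φ₂, h₂⟩ := exists_isStronglyCartesian Q.proj b.2 f.2
  obtain rfl : P.proj.obj a₁ = x₁ := IsHomLift.domain_eq P.proj f.1 φ₁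
  obtain rfl : Q.proj.obj a₂ = x₂ := IsHomLift.domain_eq Q.proj f.2 φ₂
  have e₁ := IsHomLift.eq_of_isHomLift P.proj f.1 φ₁
  have e₂ := IsHomLift.eq_of_isHomLift Q.proj f.2 φ₂
  refine ⟨(a₁, a₂), (φ₁, φ₂), ?_⟩
  have e : f = (P.proj.prod Q.proj).map (X := (a₁, a₂)) (Y := b) (φ₁, φ₂) := Prod.ext e₁ e₂
  rw [e]
  exact (isStronglyCartesian_prod_iff P.proj Q.proj _).2 ⟨by rwa [e₁] at h₁, by rwa [e₂] at h₂⟩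

instance id_isFibered (C : Type*) [Category C] : (𝟭 C).IsFibered := by
  refine Functor.IsFibered.of_exists_isStronglyCartesian fun b x f => ⟨x, f, ?_⟩
  refine (isStronglyCartesian_iff (𝟭 C) f).2 fun _ g _ w => ⟨g, ⟨rfl, w.symm⟩, fun _ hξ => hξ.1⟩

theorem chosenTerminal_ext {x y : Cat.chosenTerminal.{v, u}} (f g : x ⟶ y) : f = g :=
  ULift.ext _ _ (Subsingleton.elim _ _)

/-- The trivial fibration `1 → 1`. -/
def one : Fib.{v, u} where
  base := Cat.chosenTerminal.{v, u}
  total := Cat.chosenTerminal.{v, u}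
  proj := 𝟭 _

/-- The product of two fibrations. -/
def prod (P Q : Fib.{v, u}) : Fib.{v, u} where
  base := P.base × Q.base
  total := P.total × Q.total
  proj := P.proj.prod Q.proj

/-- The first projection. -/
def prodFst (P Q : Fib.{v, u}) : prod P Q ⟶ P where
  base := CategoryTheory.Prod.fst _ _
  total := CategoryTheory.Prod.fst _ _
  w := rfl
  cart φ h := ((isStronglyCartesian_prod_iff P.proj Q.proj φ).1 h).1

/-- The second projection. -/
def prodSnd (P Q : Fib.{v, u}) : prod P Q ⟶ Q where
  base := CategoryTheory.Prod.snd _ _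
  total := CategoryTheory.Prod.snd _ _
  w := rfl
  cart φ h := ((isStronglyCartesian_prod_iff P.proj Q.proj φ).1 h).2

/-- The pairing of two fibred 1-cells. -/
def prodLift {T P Q : Fib.{v, u}} (f : T ⟶ P) (g : T ⟶ Q) : T ⟶ prod P Q where
  base := Functor.prod' f.base g.base
  total := Functor.prod' f.total g.total
  w := by
    change Functor.prod' (f.total ⋙ P.proj) (g.total ⋙ Q.proj) =
      Functor.prod' (T.proj ⋙ f.base) (T.proj ⋙ g.base)
    rw [f.w, g.w]
  cart φ h := (isStronglyCartesian_prod_iff P.proj Q.proj _).2 ⟨f.cart φ h, g.cart φ h⟩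

/-- The fibred 1-cell to the trivial fibration. -/
def toOne (P : Fib.{v, u}) : P ⟶ one where
  base := (Functor.const _).obj ⟨⟨⟨⟩⟩⟩
  total := (Functor.const _).obj ⟨⟨⟨⟩⟩⟩
  w := rfl
  cart _ _ := (isStronglyCartesian_iff (𝟭 Cat.chosenTerminal.{v, u}) _).2
    fun _ g _ w => ⟨g, ⟨rfl, w.symm⟩, fun _ hξ => hξ.1⟩

/-- The cartesian monoidal structure of the category of fibrations. -/
noncomputable instance : CartesianMonoidalCategory Fib.{v, u} :=
  .ofChosenFiniteProducts ⟨_, Limits.IsTerminal.ofUniqueHom toOne fun _ _ => rfl⟩ fun P Q =>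
    { cone := Limits.BinaryFan.mk (prodFst P Q) (prodSnd P Q)
      isLimit := Limits.BinaryFan.isLimitMk (fun s => prodLift s.fst s.snd) (fun _ => rfl)
        (fun _ => rfl) (fun s m h₁ h₂ => by rw [← h₁, ← h₂]; rfl) }

noncomputable instance : BraidedCategory Fib.{v, u} := .ofCartesianMonoidalCategory

noncomputable instance : CartesianTwoCategory Fib.{v, u} where
  lift₂ {T A B f g} η θ :=
    { base := NatTrans.prod' η.base θ.base
      total := NatTrans.prod' η.total θ.total
      w := fun a => isHomLift_prod (η.w a) (θ.w a) }
  lift₂_fst η θ := rfl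
  lift₂_snd η θ := rfl
  hom_ext₂ η θ h₁ h₂ := hom₂_ext'
    (fun x => Prod.ext (congrArg (fun t => t.base.app x) h₁) (congrArg (fun t => t.base.app x) h₂))
    (fun x => Prod.ext (congrArg (fun t => t.total.app x) h₁)
      (congrArg (fun t => t.total.app x) h₂))
  unit_ext₂ _ _ := hom₂_ext' (fun _ => chosenTerminal_ext _ _) (fun _ => chosenTerminal_ext _ _)

end Fib

/-- An indexed category: a category `base` together with a pseudofunctor `baseᵒᵖ → Cat`. -/
structure ICat where
  base : Type u
  [catBase : Category.{v} base]
  fam : Pseudofunctor (LocallyDiscrete baseᵒᵖ) Cat.{v, u}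

namespace ICat

attribute [instance] catBase

section
variable {X Y Z : Type u} [Category.{v} X] [Category.{v} Y] [Category.{v} Z]

/-- The composite pseudofunctor `N ∘ Fᵒᵖ`. -/
abbrev reindex (F : X ⥤ Y) (N : Pseudofunctor (LocallyDiscrete Yᵒᵖ) Cat.{v, u}) :
    Pseudofunctor (LocallyDiscrete Xᵒᵖ) Cat.{v, u} :=
  F.op.toPseudofunctor.comp N

theorem map₂_app {N : Pseudofunctor (LocallyDiscrete Yᵒᵖ) Cat.{v, u}} {p q : LocallyDiscrete Yᵒᵖ}
    {f g : p ⟶ q} (η : f ⟶ g) (a : N.obj p) : (N.map₂ η).toNatTrans.app a =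
      eqToHom (by rw [LocallyDiscrete.eq_of_hom η]) := by
  obtain rfl := LocallyDiscrete.eq_of_hom η
  obtain rfl : η = 𝟙 _ := Subsingleton.elim _ _
  rw [PrelaxFunctor.map₂_id]; rfl

theorem map_id_loc (F : X ⥤ Y) (x : X) : (F.map (𝟙 x)).op.toLoc = 𝟙 (⟨op (F.obj x)⟩ : LocallyDiscrete Yᵒᵖ) := by
  rw [F.map_id]; rfl

theorem map_comp_loc (F : X ⥤ Y) {x y z : X} (f : x ⟶ y) (g : y ⟶ z) :
    (F.map (f ≫ g)).op.toLoc = (F.map g).op.toLoc ≫ (F.map f).op.toLoc := by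
  rw [F.map_comp]; rfl

theorem obj_congr (N : Pseudofunctor (LocallyDiscrete Yᵒᵖ) Cat.{v, u}) {p q : LocallyDiscrete Yᵒᵖ}
    {f g : p ⟶ q} (h : f = g) (a : N.obj p) : (N.map f).toFunctor.obj a = (N.map g).toFunctor.obj a := by
  rw [h]

theorem reindex_mapId_hom_app (F : X ⥤ Y) (N : Pseudofunctor (LocallyDiscrete Yᵒᵖ) Cat.{v, u})
    (x : X) (a : N.obj ⟨op (F.obj x)⟩) :
    ((reindex F N).mapId ⟨op x⟩).hom.toNatTrans.app a =
      eqToHom (obj_congr N (map_id_loc F x) a) ≫ (N.mapId ⟨op (F.obj x)⟩).hom.toNatTrans.app a :=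
  congrArg (· ≫ _) (map₂_app _ a)

theorem reindex_mapComp_hom_app (F : X ⥤ Y) (N : Pseudofunctor (LocallyDiscrete Yᵒᵖ) Cat.{v, u})
    {x y z : X} (f : x ⟶ y) (g : y ⟶ z) (a : N.obj ⟨op (F.obj z)⟩) :
    ((reindex F N).mapComp g.op.toLoc f.op.toLoc).hom.toNatTrans.app a =
      eqToHom (obj_congr N (map_comp_loc F f g) a) ≫
      (N.mapComp (F.map g).op.toLoc (F.map f).op.toLoc).hom.toNatTrans.app a :=
  congrArg (· ≫ _) (map₂_app _ a)

theorem conj₄ {C : Type u} [Category.{v} C] {a b c : C} (f : a ⟶ b) (g : b ⟶ c) :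
    f ≫ g = 𝟙 a ≫ f ≫ 𝟙 b ≫ g ≫ 𝟙 c := by
  simp

theorem map_id_comp {C D : Type u} [Category.{v} C] [Category.{v} D] (F : C ⥤ D) {a : C} {b : D}
    (g : F.obj a ⟶ b) : F.map (𝟙 a) ≫ g = g ≫ 𝟙 b := by
  simp

/-- A pseudonatural transformation `M ⇒ N ∘ Fᵒᵖ` from its components. -/
def mkTrans {F : X ⥤ Y} {M : Pseudofunctor (LocallyDiscrete Xᵒᵖ) Cat.{v, u}}
    {N : Pseudofunctor (LocallyDiscrete Yᵒᵖ) Cat.{v, u}}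
    (app : ∀ x : X, M.obj ⟨op x⟩ ⥤ N.obj ⟨op (F.obj x)⟩)
    (nat : ∀ {x y : X} (f : x ⟶ y), (M.map f.op.toLoc).toFunctor ⋙ app x ≅
      app y ⋙ (N.map (F.map f).op.toLoc).toFunctor)
    (nat_id : ∀ x a, (nat (𝟙 x)).hom.app a ≫ eqToHom (obj_congr N (map_id_loc F x) _) ≫
      (N.mapId ⟨op (F.obj x)⟩).hom.toNatTrans.app ((app x).obj a) =
        (app x).map ((M.mapId ⟨op x⟩).hom.toNatTrans.app a))
    (nat_comp : ∀ {x y z : X} (f : x ⟶ y) (g : y ⟶ z) a, (nat (f ≫ g)).hom.app a ≫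
      eqToHom (obj_congr N (map_comp_loc F f g) _) ≫
      (N.mapComp (F.map g).op.toLoc (F.map f).op.toLoc).hom.toNatTrans.app ((app z).obj a) =
        (app x).map ((M.mapComp g.op.toLoc f.op.toLoc).hom.toNatTrans.app a) ≫
        (nat f).hom.app ((M.map g.op.toLoc).toFunctor.obj a) ≫
        (N.map (F.map f).op.toLoc).toFunctor.map ((nat g).hom.app a)) :
    Pseudofunctor.StrongTrans M (reindex F N) where
  app p := (app p.as.unop).toCatHom
  naturality {p q} f := Cat.Hom.isoMk (nat f.as.unop)
  naturality_naturality {p q f g} η := by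
    obtain rfl := LocallyDiscrete.eq_of_hom η
    obtain rfl : η = 𝟙 _ := Subsingleton.elim _ _
    refine Cat.Hom₂.ext (NatTrans.ext (funext fun a => ?_))
    refine (congrArg (fun t => (app q.as.unop).map t ≫ (nat f.as.unop).hom.app a)
      (map₂_app (𝟙 f) a)).trans ?_
    refine (map_id_comp _ _).trans ?_
    exact congrArg ((nat f.as.unop).hom.app a ≫ ·)
      (map₂_app (N := reindex F N) (𝟙 f) ((app p.as.unop).obj a)).symm
  naturality_id p := by
    refine Cat.Hom₂.ext (NatTrans.ext (funext fun a => ?_))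
    refine (congrArg (_ ≫ ·) (reindex_mapId_hom_app F N _ _)).trans ((nat_id p.as.unop a).trans ?_)
    exact ((congrArg (_ ≫ ·) (Category.id_comp (𝟙 _))).trans (Category.comp_id _)).symm
  naturality_comp {p q r} f g := by
    refine Cat.Hom₂.ext (NatTrans.ext (funext fun a => ?_))
    refine (congrArg (_ ≫ ·) (reindex_mapComp_hom_app F N _ _ _)).trans
      ((nat_comp g.as.unop f.as.unop a).trans ?_)
    refine congrArg (_ ≫ ·) ?_
    exact conj₄ _ _

end

open Pseudofunctor (CoGrothendieck)

/-- The fibre of an indexed category over `x`. -/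
abbrev fibre (M : ICat.{v, u}) (x : M.base) : Type u := M.fam.obj ⟨op x⟩

/-- The reindexing functor along `f`. -/
def pull (M : ICat.{v, u}) {x y : M.base} (f : x ⟶ y) : M.fibre y ⥤ M.fibre x :=
  (M.fam.map f.op.toLoc).toFunctor

/-- The coherence isomorphism `(𝟙 x)^* a ≅ a`. -/
def pullId (M : ICat.{v, u}) (x : M.base) (a : M.fibre x) : (M.pull (𝟙 x)).obj a ≅ a :=
  (Cat.Hom.toNatIso (M.fam.mapId ⟨op x⟩)).app a

/-- The coherence isomorphism `(f ≫ g)^* a ≅ f^* (g^* a)`. -/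
def pullComp (M : ICat.{v, u}) {x y z : M.base} (f : x ⟶ y) (g : y ⟶ z) (a : M.fibre z) :
    (M.pull (f ≫ g)).obj a ≅ (M.pull f).obj ((M.pull g).obj a) :=
  (Cat.Hom.toNatIso (M.fam.mapComp g.op.toLoc f.op.toLoc)).app a

/-- The identification of the reindexings along equal morphisms. -/
def pullCongr (M : ICat.{v, u}) {x y : M.base} {f g : x ⟶ y} (h : f = g) (a : M.fibre y) :
    (M.pull f).obj a ≅ (M.pull g).obj a :=
  eqToIso (by rw [h])

theorem pullId_natural (M : ICat.{v, u}) {x : M.base} {a b : M.fibre x} (k : a ⟶ b) :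
    (M.pull (𝟙 x)).map k ≫ (M.pullId x b).hom = (M.pullId x a).hom ≫ k :=
  (M.fam.mapId ⟨op x⟩).hom.toNatTrans.naturality k

theorem pullComp_natural (M : ICat.{v, u}) {x y z : M.base} (f : x ⟶ y) (g : y ⟶ z)
    {a b : M.fibre z} (k : a ⟶ b) : (M.pull (f ≫ g)).map k ≫ (M.pullComp f g b).hom =
      (M.pullComp f g a).hom ≫ (M.pull f).map ((M.pull g).map k) :=
  (M.fam.mapComp g.op.toLoc f.op.toLoc).hom.toNatTrans.naturality k

theorem pullCongr_natural (M : ICat.{v, u}) {x y : M.base} {f g : x ⟶ y} (h : f = g)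
    {a b : M.fibre y} (k : a ⟶ b) :
    (M.pull f).map k ≫ (M.pullCongr h b).hom = (M.pullCongr h a).hom ≫ (M.pull g).map k := by
  subst h; simp [pullCongr]

theorem pullCongr_trans (M : ICat.{v, u}) {x y : M.base} {f g h : x ⟶ y} (p : f = g) (q : g = h)
    (a : M.fibre y) :
    (M.pullCongr (p.trans q) a).hom = (M.pullCongr p a).hom ≫ (M.pullCongr q a).hom := by
  subst p q; simp [pullCongr]

/-- An indexed 1-cell `(F, τ)`: a functor `F` between the base categories and a pseudonatural
transformation `τ : M ⇒ N ∘ Fᵒᵖ`. -/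
structure Hom (M N : ICat.{v, u}) where
  base : M.base ⥤ N.base
  trans : Pseudofunctor.StrongTrans M.fam (reindex base N.fam)

namespace Hom

variable {M N L : ICat.{v, u}}

/-- The component `τ_x : M x ⥤ N (F x)`. -/
def app (f : Hom M N) (x : M.base) : M.fibre x ⥤ N.fibre (f.base.obj x) :=
  (f.trans.app ⟨op x⟩).toFunctor

/-- The structure isomorphism `τ_x (k^* a) ≅ (F k)^* (τ_y a)`. -/
def nat (f : Hom M N) {x y : M.base} (k : x ⟶ y) (a : M.fibre y) :
    (f.app x).obj ((M.pull k).obj a) ≅ (N.pull (f.base.map k)).obj ((f.app y).obj a) :=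
  (Cat.Hom.toNatIso (f.trans.naturality k.op.toLoc)).app a

theorem nat_natural (f : Hom M N) {x y : M.base} (k : x ⟶ y) {a b : M.fibre y} (m : a ⟶ b) :
    (f.app x).map ((M.pull k).map m) ≫ (f.nat k b).hom =
      (f.nat k a).hom ≫ (N.pull (f.base.map k)).map ((f.app y).map m) :=
  (f.trans.naturality k.op.toLoc).hom.toNatTrans.naturality m

theorem nat_id (f : Hom M N) (x : M.base) (a : M.fibre x) :
    (f.nat (𝟙 x) a).hom ≫ (N.pullCongr (f.base.map_id x) _).hom ≫ (N.pullId _ _).hom =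
      (f.app x).map (M.pullId x a).hom := by
  have h := congrArg (fun t => t.toNatTrans.app a) (f.trans.naturality_id ⟨op x⟩)
  refine ((congrArg ((f.nat (𝟙 x) a).hom ≫ ·)
    (reindex_mapId_hom_app f.base N.fam x ((f.app x).obj a)).symm).trans h).trans ?_
  exact (congrArg (_ ≫ ·) (Category.id_comp (𝟙 _))).trans (Category.comp_id _)

theorem nat_comp (f : Hom M N) {x y z : M.base} (k : x ⟶ y) (l : y ⟶ z) (a : M.fibre z) :
    (f.nat (k ≫ l) a).hom ≫ (N.pullCongr (f.base.map_comp k l) _).hom ≫ (N.pullComp _ _ _).hom =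
      (f.app x).map (M.pullComp k l a).hom ≫ (f.nat k ((M.pull l).obj a)).hom ≫
        (N.pull (f.base.map k)).map (f.nat l a).hom := by
  have h := congrArg (fun t => t.toNatTrans.app a)
    (f.trans.naturality_comp l.op.toLoc k.op.toLoc)
  refine ((congrArg ((f.nat (k ≫ l) a).hom ≫ ·)
    (reindex_mapComp_hom_app f.base N.fam k l ((f.app z).obj a)).symm).trans h).trans ?_
  exact congrArg (_ ≫ ·) (conj₄ _ _).symm

theorem nat_congr (f : Hom M N) {x y : M.base} {k l : x ⟶ y} (h : k = l) (a : M.fibre y) :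
    (f.nat k a).hom ≫ (N.pullCongr (congrArg f.base.map h) _).hom =
      (f.app x).map (M.pullCongr h a).hom ≫ (f.nat l a).hom := by
  subst h; simp [pullCongr]

/-- An indexed 1-cell from its components. -/
def mk' (F : M.base ⥤ N.base) (app : ∀ x, M.fibre x ⥤ N.fibre (F.obj x))
    (nat : ∀ {x y : M.base} (k : x ⟶ y) (a : M.fibre y),
      (app x).obj ((M.pull k).obj a) ≅ (N.pull (F.map k)).obj ((app y).obj a))
    (nat_natural : ∀ {x y : M.base} (k : x ⟶ y) {a b : M.fibre y} (m : a ⟶ b),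
      (app x).map ((M.pull k).map m) ≫ (nat k b).hom =
        (nat k a).hom ≫ (N.pull (F.map k)).map ((app y).map m))
    (nat_id : ∀ (x : M.base) (a : M.fibre x),
      (nat (𝟙 x) a).hom ≫ (N.pullCongr (F.map_id x) _).hom ≫ (N.pullId _ _).hom =
        (app x).map (M.pullId x a).hom)
    (nat_comp : ∀ {x y z : M.base} (k : x ⟶ y) (l : y ⟶ z) (a : M.fibre z),
      (nat (k ≫ l) a).hom ≫ (N.pullCongr (F.map_comp k l) _).hom ≫ (N.pullComp _ _ _).hom =
        (app x).map (M.pullComp k l a).hom ≫ (nat k ((M.pull l).obj a)).hom ≫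
          (N.pull (F.map k)).map (nat l a).hom) : Hom M N where
  base := F
  trans := mkTrans app
    (fun k => NatIso.ofComponents (nat k) (fun m => nat_natural k m)) nat_id nat_comp

theorem ext' {f g : Hom M N} (hb : f.base = g.base) (ha : f.trans.app ≍ g.trans.app)
    (hn : ∀ {x y : M.base} (k : x ⟶ y) (a : M.fibre y), (f.nat k a).hom ≍ (g.nat k a).hom) :
    f = g := by
  obtain ⟨F, ⟨a, n, _, _, _⟩⟩ := f
  obtain ⟨G, ⟨b, m, _, _, _⟩⟩ := g
  obtain rfl : F = G := hb
  obtain rfl : a = b := eq_of_heq ha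
  have : @n = @m := by
    funext p q k
    exact Iso.ext (Cat.Hom₂.ext (NatTrans.ext (funext fun a => eq_of_heq (hn k.as.unop a))))
  subst this
  rfl

end Hom

/-- Indexed categories and indexed 1-cells; the composite of `(F, τ)` and `(G, σ)` is
`(G ∘ F, σF ∘ τ)`. -/
instance : CategoryStruct ICat.{v, u} where
  Hom := Hom
  id M := Hom.mk' (𝟭 _) (fun _ => 𝟭 _) (fun _ _ => Iso.refl _)
    (fun _ _ _ _ => (Category.comp_id _).trans (Category.id_comp _).symm)
    (fun _ _ => (Category.id_comp _).trans (Category.id_comp _))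
    (fun _ _ _ => ((Category.id_comp _).trans (Category.id_comp _)).trans
      ((congrArg (_ ≫ ·) ((Category.id_comp _).trans (CategoryTheory.Functor.map_id _ _))).trans
        (Category.comp_id _)).symm)
  comp {M N L} f g := Hom.mk' (f.base ⋙ g.base) (fun x => f.app x ⋙ g.app _)
    (fun k a => (g.app _).mapIso (f.nat k a) ≪≫ g.nat _ _)
    (fun k a b m => by
      have h₁ := congrArg (g.app _).map (f.nat_natural k m)
      have h₂ := g.nat_natural (f.base.map k) ((f.app _).map m)
      simp only [Functor.map_comp] at h₁
      simp only [Iso.trans_hom, Functor.mapIso_hom, Category.assoc, Functor.comp_map,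
        reassoc_of% h₁, h₂])
    (fun x a => by
      have h₂ := g.nat_congr (f.base.map_id x) ((f.app x).obj a)
      have h₃ := g.nat_id (f.base.obj x) ((f.app x).obj a)
      have h₄ := L.pullCongr_trans (congrArg g.base.map (f.base.map_id x)) (g.base.map_id _)
        ((g.app _).obj ((f.app x).obj a))
      refine (congrArg (fun t => _ ≫ t ≫ _) h₄).trans ?_
      simp only [Iso.trans_hom, Functor.mapIso_hom, Category.assoc, reassoc_of% h₂,
        Functor.comp_map, ← f.nat_id x a, Functor.map_comp]
      exact congrArg (fun t => _ ≫ _ ≫ t) h₃)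
    (fun {x y z} k l a => by
      have h₂ := g.nat_congr (f.base.map_comp k l) ((f.app z).obj a)
      have h₃ := g.nat_comp (f.base.map k) (f.base.map l) ((f.app z).obj a)
      have h₄ := L.pullCongr_trans (congrArg g.base.map (f.base.map_comp k l))
        (g.base.map_comp _ _) ((g.app _).obj ((f.app z).obj a))
      have h₅ := congrArg (g.app _).map (f.nat_comp k l a)
      have h₆ := g.nat_natural (f.base.map k) (f.nat l a).hom
      simp only [Functor.map_comp] at h₅
      refine (congrArg (fun t => _ ≫ t ≫ _) h₄).trans ?_
      simp only [Iso.trans_hom, Functor.mapIso_hom, Category.assoc, reassoc_of% h₂, h₃,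
        Functor.comp_map, Functor.map_comp, reassoc_of% h₅, reassoc_of% h₆, Functor.comp_obj])

/-! ### The total category -/

section
variable {M N L : ICat.{v, u}}

/-- The total category of an indexed category (its Grothendieck construction). -/
abbrev Total (M : ICat.{v, u}) : Type u := CoGrothendieck M.fam

/-- The fibre component of a morphism of the total category. -/
def fib {p q : M.Total} (φ : p ⟶ q) : p.fiber ⟶ (M.pull φ.base).obj q.fiber := φ.fiber

/-- A morphism of the total category from its components. -/
def homMk {x y : M.base} {a : M.fibre x} {b : M.fibre y} (k : x ⟶ y) (m : a ⟶ (M.pull k).obj b) :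
    (⟨x, a⟩ : M.Total) ⟶ ⟨y, b⟩ := ⟨k, m⟩

theorem homMk_comp {x y z : M.base} {a : M.fibre x} {b : M.fibre y} {c : M.fibre z}
    (k : x ⟶ y) (m : a ⟶ (M.pull k).obj b) (l : y ⟶ z) (n : b ⟶ (M.pull l).obj c) :
    homMk k m ≫ homMk l n = homMk (k ≫ l) (m ≫ (M.pull k).map n ≫ (M.pullComp k l c).inv) :=
  rfl

theorem homMk_id {x : M.base} (a : M.fibre x) :
    𝟙 (⟨x, a⟩ : M.Total) = homMk (𝟙 x) (M.pullId x a).inv :=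
  rfl

theorem homMk_eq_iff {x y : M.base} {a : M.fibre x} {b : M.fibre y} {k : x ⟶ y}
    {m : a ⟶ (M.pull k).obj b} {l : x ⟶ y} {n : a ⟶ (M.pull l).obj b} (h : k = l) :
    homMk k m = homMk l n ↔ m ≫ (M.pullCongr h b).hom = n := by
  subst h
  have e : m ≫ (M.pullCongr rfl b).hom = m := Category.comp_id _
  rw [e]
  exact ⟨fun h => (CoGrothendieck.Hom.congr h).trans (Category.comp_id _), fun h => by rw [h]⟩

/-- The functor between total categories induced by an indexed 1-cell. -/
def Hom.total (f : M ⟶ N) : M.Total ⥤ N.Total where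
  obj p := ⟨f.base.obj p.base, (f.app p.base).obj p.fiber⟩
  map {p q} φ := homMk (f.base.map φ.base) ((f.app p.base).map (fib φ) ≫ (f.nat φ.base q.fiber).hom)
  map_id p := by
    obtain ⟨x, a⟩ := p
    refine (homMk_eq_iff (f.base.map_id x)).2 ?_
    have h := f.nat_id x a
    change ((f.app x).map (M.pullId x a).inv ≫ (f.nat _ _).hom) ≫ (N.pullCongr _ _).hom =
      (N.pullId _ _).inv
    rw [← cancel_mono (N.pullId _ _).hom, Category.assoc, Category.assoc, h, ← Functor.map_comp,
      Iso.inv_hom_id, Iso.inv_hom_id, CategoryTheory.Functor.map_id]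
  map_comp {p q r} φ ψ := by
    obtain ⟨x, a⟩ := p
    obtain ⟨y, b⟩ := q
    obtain ⟨z, c⟩ := r
    obtain ⟨k, (m : a ⟶ (M.pull k).obj b)⟩ := φ
    obtain ⟨l, (n : b ⟶ (M.pull l).obj c)⟩ := ψ
    refine (homMk_eq_iff (f.base.map_comp k l)).2 ?_
    have h := f.nat_comp k l c
    have h' := f.nat_natural k n
    change ((f.app x).map (m ≫ (M.pull k).map n ≫ (M.pullComp k l c).inv) ≫
      (f.nat (k ≫ l) c).hom) ≫ (N.pullCongr _ _).hom = ((f.app x).map m ≫ (f.nat k b).hom) ≫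
        (N.pull _).map ((f.app y).map n ≫ (f.nat l c).hom) ≫ (N.pullComp _ _ _).inv
    rw [← cancel_mono (N.pullComp _ _ _).hom]
    simp only [Category.assoc, h, Functor.map_comp, Iso.inv_hom_id, Category.comp_id]
    simp only [← (f.app x).map_comp_assoc, Iso.inv_hom_id, Category.comp_id]
    simp only [Functor.map_comp, Category.assoc, reassoc_of% h']

theorem total_map_homMk (f : M ⟶ N) {x y : M.base} {a : M.fibre x} {b : M.fibre y} (k : x ⟶ y)
    (m : a ⟶ (M.pull k).obj b) : f.total.map (homMk k m) =
      homMk (f.base.map k) ((f.app x).map m ≫ (f.nat k b).hom) :=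
  rfl

theorem comp_total_map (f : M ⟶ N) (g : N ⟶ L) {p q : M.Total} (φ : p ⟶ q) :
    (f ≫ g).total.map φ = g.total.map (f.total.map φ) := by
  refine (homMk_eq_iff rfl).2 ?_
  refine (Category.comp_id _).trans ?_
  change (g.app _).map ((f.app _).map (fib φ)) ≫ (g.app _).map (f.nat _ _).hom ≫
      (g.nat _ _).hom = (g.app _).map ((f.app _).map (fib φ) ≫ (f.nat _ _).hom) ≫ (g.nat _ _).hom
  rw [Functor.map_comp, Category.assoc]

theorem id_total_map {p q : M.Total} (φ : p ⟶ q) : (𝟙 M : M ⟶ M).total.map φ = φ :=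
  congrArg (homMk φ.base) (Category.comp_id _)

/-- The vertical morphism given by a morphism of the fibre. -/
def vert {x : M.base} {a b : M.fibre x} (k : a ⟶ b) : (⟨x, a⟩ : M.Total) ⟶ ⟨x, b⟩ :=
  homMk (𝟙 x) (k ≫ (M.pullId x b).inv)

theorem total_map_vert (f : M ⟶ N) {x : M.base} {a b : M.fibre x} (k : a ⟶ b) :
    f.total.map (vert k) = vert ((f.app x).map k) := by
  refine (homMk_eq_iff (f.base.map_id x)).2 ?_
  have h := f.nat_id x b
  change ((f.app x).map (k ≫ (M.pullId x b).inv) ≫ (f.nat _ _).hom) ≫ (N.pullCongr _ _).hom =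
    (f.app x).map k ≫ (N.pullId _ _).inv
  rw [← cancel_mono (N.pullId _ _).hom, Category.assoc, Category.assoc, h, ← Functor.map_comp]
  simp

theorem vert_comp_homMk {x y : M.base} {a b : M.fibre x} (k : a ⟶ b) (l : x ⟶ y)
    {c : M.fibre y} (m : b ⟶ (M.pull l).obj c) : vert k ≫ homMk l m = homMk l (k ≫ m) := by
  have h := (homMk_eq_iff (Category.id_comp l)).1 (Category.id_comp (homMk l m))
  refine (homMk_eq_iff (Category.id_comp l)).2 ?_
  refine Eq.trans ?_ (congrArg (k ≫ ·) h)
  change ((k ≫ (M.pullId x b).inv) ≫ (M.pull (𝟙 x)).map m ≫ (M.pullComp _ _ _).inv) ≫ _ =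
    k ≫ ((M.pullId x b).inv ≫ (M.pull (𝟙 x)).map m ≫ (M.pullComp _ _ _).inv) ≫ _
  simp only [Category.assoc]

theorem homMk_comp_vert {x y : M.base} {a : M.fibre x} {b c : M.fibre y} (l : x ⟶ y)
    (m : a ⟶ (M.pull l).obj b) (k : b ⟶ c) :
    homMk l m ≫ vert k = homMk l (m ≫ (M.pull l).map k) := by
  have h := (homMk_eq_iff (Category.comp_id l)).1
    (Category.comp_id (homMk l (m ≫ (M.pull l).map k)))
  refine (homMk_eq_iff (Category.comp_id l)).2 ?_
  refine Eq.trans ?_ h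
  change (m ≫ (M.pull l).map (k ≫ (M.pullId y c).inv) ≫ (M.pullComp _ _ _).inv) ≫ _ =
    ((m ≫ (M.pull l).map k) ≫ (M.pull l).map (M.pullId y c).inv ≫ (M.pullComp _ _ _).inv) ≫ _
  simp only [Category.assoc, Functor.map_comp]

/-- An indexed 2-cell `(α, m) : (F, τ) ⇒ (G, σ)`: a natural transformation `α : F ⇒ G` and a
modification with components `m_x : τ_x ⇒ (α_x)^* ∘ σ_x`. -/
structure Hom₂ (f g : M ⟶ N) where
  base : f.base ⟶ g.base
  app (x : M.base) : f.app x ⟶ g.app x ⋙ N.pull (base.app x)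
  w {x y : M.base} (k : x ⟶ y) (a : M.fibre y) :
    (f.nat k a).hom ≫ (N.pull (f.base.map k)).map ((app y).app a) ≫
        (N.pullComp (f.base.map k) (base.app y) _).inv ≫
        (N.pullCongr (base.naturality k) _).hom =
    (app x).app ((M.pull k).obj a) ≫ (N.pull (base.app x)).map (g.nat k a).hom ≫
        (N.pullComp (base.app x) (g.base.map k) _).inv

namespace Hom₂

variable {f g h : M ⟶ N}

/-- The component at `p = (x, a)` of the induced transformation of total categories, namely
`(α_x, m_x a)`. -/
def totalApp (η : Hom₂ f g) (p : M.Total) : f.total.obj p ⟶ g.total.obj p :=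
  homMk (η.base.app p.base) ((η.app p.base).app p.fiber)

theorem total_natural (η : Hom₂ f g) {p q : M.Total} (φ : p ⟶ q) :
    f.total.map φ ≫ η.totalApp q = η.totalApp p ≫ g.total.map φ := by
  obtain ⟨x, a⟩ := p
  obtain ⟨y, b⟩ := q
  obtain ⟨k, (m : a ⟶ (M.pull k).obj b)⟩ := φ
  refine (homMk_eq_iff (η.base.naturality k)).2 ?_
  have h := η.w k b
  have h' := (η.app x).naturality m
  change (((f.app x).map m ≫ (f.nat k b).hom) ≫ (N.pull _).map ((η.app y).app b) ≫
    (N.pullComp _ _ _).inv) ≫ (N.pullCongr _ _).hom =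
    (η.app x).app a ≫ (N.pull _).map ((g.app x).map m ≫ (g.nat k b).hom) ≫ (N.pullComp _ _ _).inv
  simp only [Category.assoc, h, Functor.map_comp]
  rw [reassoc_of% h']

/-- The natural transformation between the functors of total categories induced by an indexed
2-cell. -/
def total (η : Hom₂ f g) : f.total ⟶ g.total where
  app := η.totalApp
  naturality _ _ φ := η.total_natural φ

theorem ext' {η θ : Hom₂ f g} (hb : ∀ x, η.base.app x = θ.base.app x)
    (ht : ∀ p, η.totalApp p = θ.totalApp p) : η = θ := by
  obtain ⟨b, m, _⟩ := η
  obtain ⟨b', m', _⟩ := θ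
  obtain rfl : b = b' := NatTrans.ext (funext hb)
  have : m = m' := by
    funext x
    refine NatTrans.ext (funext fun a => ?_)
    exact (Category.comp_id _).symm.trans ((homMk_eq_iff rfl).1 (ht ⟨x, a⟩))
  subst this
  rfl

/-- An indexed 2-cell from components that are natural in the total category. -/
def mk' (base : f.base ⟶ g.base)
    (app : ∀ (x : M.base) (a : M.fibre x),
      (f.app x).obj a ⟶ (N.pull (base.app x)).obj ((g.app x).obj a))
    (w : ∀ {p q : M.Total} (φ : p ⟶ q), f.total.map φ ≫ homMk (base.app q.base) (app q.base q.fiber) =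
      homMk (base.app p.base) (app p.base p.fiber) ≫ g.total.map φ) :
    Hom₂ f g where
  base := base
  app x :=
    { app := app x
      naturality := fun a b k => by
        have := w (vert k)
        rw [total_map_vert, total_map_vert] at this
        have := (vert_comp_homMk ((f.app x).map k) (base.app x) (app x b)).symm.trans
          (this.trans (homMk_comp_vert (base.app x) (app x a) ((g.app x).map k)))
        exact (Category.comp_id _).symm.trans ((homMk_eq_iff rfl).1 this) }
  w {x y} k a := by
    have := (homMk_eq_iff (base.naturality k)).1 (w (homMk k (𝟙 ((M.pull k).obj a))))
    change (((f.app x).map (𝟙 _) ≫ (f.nat k a).hom) ≫ (N.pull _).map (app y a) ≫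
      (N.pullComp _ _ _).inv) ≫ (N.pullCongr _ _).hom = app x _ ≫
      (N.pull _).map ((g.app x).map (𝟙 _) ≫ (g.nat k a).hom) ≫ (N.pullComp _ _ _).inv at this
    simpa only [CategoryTheory.Functor.map_id, Category.id_comp, Category.assoc] using this

end Hom₂

/-- The category of indexed 1-cells and indexed 2-cells between two indexed categories. -/
instance homCat (M N : ICat.{v, u}) : Category (M ⟶ N) where
  Hom f g := Hom₂ f g
  id f := Hom₂.mk' (𝟙 f.base) (fun _ _ => (N.pullId _ _).inv)
    (fun _ => (Category.comp_id _).trans (Category.id_comp _).symm)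
  comp η θ := Hom₂.mk' (η.base ≫ θ.base)
    (fun x a => (η.app x).app a ≫ (N.pull (η.base.app x)).map ((θ.app x).app a) ≫
      (N.pullComp _ _ _).inv)
    (fun φ => (η.total ≫ θ.total).naturality φ)
  id_comp η := Hom₂.ext' (fun _ => Category.id_comp _) (fun p => Category.id_comp (η.totalApp p))
  comp_id η := Hom₂.ext' (fun _ => Category.comp_id _) (fun p => Category.comp_id (η.totalApp p))
  assoc η θ ζ := Hom₂.ext' (fun _ => Category.assoc _ _ _)
    (fun p => Category.assoc (η.totalApp p) (θ.totalApp p) (ζ.totalApp p))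

@[ext]
theorem hom₂_ext {f g : M ⟶ N} {η θ : f ⟶ g} (hb : ∀ x, η.base.app x = θ.base.app x)
    (ht : ∀ p, η.totalApp p = θ.totalApp p) : η = θ :=
  Hom₂.ext' hb ht

theorem conj_id {C : Type*} [Category C] {x y : C} (f : x ⟶ y) : f = 𝟙 x ≫ f ≫ 𝟙 y := by simp

/-- The isomorphism between two indexed 1-cells which agree on objects and differ only by the
presentation of their structure. -/
def isoOf {f g : M ⟶ N} (b : f.base ≅ g.base)
    (m : ∀ x a, (f.app x).obj a ⟶ (N.pull (b.hom.app x)).obj ((g.app x).obj a))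
    (m' : ∀ x a, (g.app x).obj a ⟶ (N.pull (b.inv.app x)).obj ((f.app x).obj a))
    (w : ∀ {p q : M.Total} (φ : p ⟶ q),
      f.total.map φ ≫ homMk (b.hom.app q.base) (m q.base q.fiber) =
        homMk (b.hom.app p.base) (m p.base p.fiber) ≫ g.total.map φ)
    (w' : ∀ {p q : M.Total} (φ : p ⟶ q),
      g.total.map φ ≫ homMk (b.inv.app q.base) (m' q.base q.fiber) =
        homMk (b.inv.app p.base) (m' p.base p.fiber) ≫ f.total.map φ)
    (h : ∀ x a, homMk (b.hom.app x) (m x a) ≫ homMk (b.inv.app x) (m' x a) = 𝟙 _)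
    (h' : ∀ x a, homMk (b.inv.app x) (m' x a) ≫ homMk (b.hom.app x) (m x a) = 𝟙 _) : f ≅ g where
  hom := Hom₂.mk' b.hom m w
  inv := Hom₂.mk' b.inv m' w'
  hom_inv_id := hom₂_ext (fun _ => b.hom_inv_id_app _) (fun _ => h _ _)
  inv_hom_id := hom₂_ext (fun _ => b.inv_hom_id_app _) (fun _ => h' _ _)

theorem comp_id_eq {C : Type*} [Category C] {x y : C} {f g : x ⟶ y} (h : f = g) :
    f ≫ 𝟙 y = 𝟙 x ≫ g := by simp [h]

/-- Whiskering of an indexed 2-cell by an indexed 1-cell on the left. -/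
def wL (f : M ⟶ N) {g h : N ⟶ L} (η : g ⟶ h) : f ≫ g ⟶ f ≫ h :=
  Hom₂.mk' (Functor.whiskerLeft f.base η.base)
    (fun x a => (η.app (f.base.obj x)).app ((f.app x).obj a))
    (fun φ => by
      rw [comp_total_map, comp_total_map]
      exact η.total_natural (f.total.map φ))

/-- Whiskering of an indexed 2-cell by an indexed 1-cell on the right. -/
def wR {f g : M ⟶ N} (η : f ⟶ g) (h : N ⟶ L) : f ≫ h ⟶ g ≫ h :=
  Hom₂.mk' (Functor.whiskerRight η.base h.base)
    (fun x a => (h.app _).map ((η.app x).app a) ≫ (h.nat _ _).hom)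
    (fun {p q} φ => by
      rw [comp_total_map, comp_total_map]
      exact ((h.total.map_comp _ _).symm.trans (congrArg h.total.map (η.total_natural φ))).trans
        (h.total.map_comp _ _))

/-- The associator, whose components are identities. -/
def assocIso {K : ICat.{v, u}} (f : M ⟶ N) (g : N ⟶ L) (h : L ⟶ K) :
    (f ≫ g) ≫ h ≅ f ≫ g ≫ h :=
  isoOf (Functor.associator f.base g.base h.base)
    (fun _ _ => (K.pullId _ _).inv) (fun _ _ => (K.pullId _ _).inv)
    (fun φ => comp_id_eq (by simp only [comp_total_map]; rfl))
    (fun φ => comp_id_eq (by simp only [comp_total_map]; rfl))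
    (fun _ _ => Category.id_comp _) (fun _ _ => Category.id_comp _)

theorem totalApp_comp {f g h : M ⟶ N} (η : f ⟶ g) (θ : g ⟶ h) (p : M.Total) :
    (η ≫ θ).totalApp p = η.totalApp p ≫ θ.totalApp p := rfl

theorem totalApp_wL (f : M ⟶ N) {g h : N ⟶ L} (η : g ⟶ h) (p : M.Total) :
    (wL f η).totalApp p = η.totalApp (f.total.obj p) := rfl

theorem totalApp_wR {f g : M ⟶ N} (η : f ⟶ g) (h : N ⟶ L) (p : M.Total) :
    (wR η h).totalApp p = h.total.map (η.totalApp p) := rfl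

theorem totalApp_assoc {K : ICat.{v, u}} (f : M ⟶ N) (g : N ⟶ L) (h : L ⟶ K) (p : M.Total) :
    (assocIso f g h).hom.totalApp p = 𝟙 (h.total.obj (g.total.obj (f.total.obj p))) := rfl

theorem pentagon_aux {K J : ICat.{v, u}} (f : M ⟶ N) (g : N ⟶ L) (h : L ⟶ K) (i : K ⟶ J) :
    wR (assocIso f g h).hom i ≫ (assocIso f (g ≫ h) i).hom ≫ wL f (assocIso g h i).hom =
      (assocIso (f ≫ g) h i).hom ≫ (assocIso f g (h ≫ i)).hom :=
  hom₂_ext (fun _ => (congrArg (· ≫ _) (i.base.map_id _)).trans (Category.id_comp _)) (fun p => by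
    rw [totalApp_comp, totalApp_comp, totalApp_comp, totalApp_wR, totalApp_wL, totalApp_assoc,
      totalApp_assoc, totalApp_assoc, totalApp_assoc, totalApp_assoc]
    exact (congrArg (fun t => t ≫ 𝟙 _ ≫ 𝟙 _)
      (i.total.map_id (h.total.obj (g.total.obj (f.total.obj p))))).trans (Category.id_comp _))

/-- The left unitor, whose components are identities. -/
def lUnit (f : M ⟶ N) : 𝟙 M ≫ f ≅ f :=
  isoOf (Functor.leftUnitor f.base)
    (fun _ _ => (N.pullId _ _).inv) (fun _ _ => (N.pullId _ _).inv)
    (fun φ => comp_id_eq (by rw [comp_total_map, id_total_map]; rfl))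
    (fun φ => comp_id_eq (by rw [comp_total_map, id_total_map]; rfl))
    (fun _ _ => Category.id_comp _) (fun _ _ => Category.id_comp _)

/-- The right unitor, whose components are identities. -/
def rUnit (f : M ⟶ N) : f ≫ 𝟙 N ≅ f :=
  isoOf (Functor.rightUnitor f.base)
    (fun _ _ => (N.pullId _ _).inv) (fun _ _ => (N.pullId _ _).inv)
    (fun φ => comp_id_eq (by rw [comp_total_map, id_total_map]))
    (fun φ => comp_id_eq (by rw [comp_total_map, id_total_map]))
    (fun _ _ => Category.id_comp _) (fun _ _ => Category.id_comp _)

theorem totalApp_assoc_inv {K : ICat.{v, u}} (f : M ⟶ N) (g : N ⟶ L) (h : L ⟶ K) (p : M.Total) :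
    (assocIso f g h).inv.totalApp p = 𝟙 (h.total.obj (g.total.obj (f.total.obj p))) := rfl

theorem id_wL {f g : M ⟶ N} (η : f ⟶ g) :
    wL (𝟙 M) η = (lUnit f).hom ≫ η ≫ (lUnit g).inv :=
  hom₂_ext (fun _ => conj_id _) (fun p => by
    rw [totalApp_comp, totalApp_comp]
    exact conj_id (η.totalApp p))

theorem wR_id {f g : M ⟶ N} (η : f ⟶ g) :
    wR η (𝟙 N) = (rUnit f).hom ≫ η ≫ (rUnit g).inv :=
  hom₂_ext (fun _ => conj_id _) (fun p => by
    rw [totalApp_comp, totalApp_comp, totalApp_wR]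
    exact (id_total_map (η.totalApp p)).trans (conj_id (η.totalApp p)))

theorem comp_wL {K : ICat.{v, u}} (f : M ⟶ N) (g : N ⟶ L) {h h' : L ⟶ K} (η : h ⟶ h') :
    wL (f ≫ g) η = (assocIso f g h).hom ≫ wL f (wL g η) ≫ (assocIso f g h').inv :=
  hom₂_ext (fun _ => conj_id _) (fun p => by
    rw [totalApp_comp, totalApp_comp, totalApp_wL, totalApp_wL, totalApp_wL, totalApp_assoc,
      totalApp_assoc_inv]
    exact conj_id (η.totalApp _))

theorem wR_comp {K : ICat.{v, u}} {f f' : M ⟶ N} (η : f ⟶ f') (g : N ⟶ L) (h : L ⟶ K) :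
    wR η (g ≫ h) = (assocIso f g h).inv ≫ wR (wR η g) h ≫ (assocIso f' g h).hom :=
  hom₂_ext (fun _ => conj_id _) (fun p => by
    rw [totalApp_comp, totalApp_comp, totalApp_wR, totalApp_wR, totalApp_wR, totalApp_assoc,
      totalApp_assoc_inv]
    exact (comp_total_map g h (η.totalApp p)).trans (conj_id _))

theorem w_assoc {K : ICat.{v, u}} (f : M ⟶ N) {g g' : N ⟶ L} (η : g ⟶ g') (h : L ⟶ K) :
    wR (wL f η) h = (assocIso f g h).hom ≫ wL f (wR η h) ≫ (assocIso f g' h).inv :=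
  hom₂_ext (fun _ => conj_id _) (fun p => by
    rw [totalApp_comp, totalApp_comp, totalApp_wR, totalApp_wL, totalApp_wL, totalApp_wR,
      totalApp_assoc, totalApp_assoc_inv]
    exact conj_id _)

theorem w_exchange {f g : M ⟶ N} {h i : N ⟶ L} (η : f ⟶ g) (θ : h ⟶ i) :
    wL f θ ≫ wR η i = wR η h ≫ wL g θ :=
  hom₂_ext (fun _ => (θ.base.naturality _).symm) (fun p => by
    rw [totalApp_comp, totalApp_comp, totalApp_wR, totalApp_wL, totalApp_wL, totalApp_wR]
    exact (θ.total_natural (η.totalApp p)).symm)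

theorem id_wR (f : M ⟶ N) (h : N ⟶ L) : wR (𝟙 f) h = 𝟙 (f ≫ h) :=
  hom₂_ext (fun _ => h.base.map_id _) (fun p => by
    rw [totalApp_wR]
    exact h.total.map_id (f.total.obj p))

theorem comp_wR {f g h : M ⟶ N} (η : f ⟶ g) (θ : g ⟶ h) (k : N ⟶ L) :
    wR (η ≫ θ) k = wR η k ≫ wR θ k :=
  hom₂_ext (fun _ => k.base.map_comp _ _) (fun p => by
    rw [totalApp_wR, totalApp_comp, totalApp_comp, totalApp_wR, totalApp_wR]
    exact k.total.map_comp (η.totalApp p) (θ.totalApp p))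

theorem triangle_aux (f : M ⟶ N) (g : N ⟶ L) :
    (assocIso f (𝟙 N) g).hom ≫ wL f (lUnit g).hom = wR (rUnit f).hom g :=
  hom₂_ext (fun _ => (Category.id_comp _).trans (g.base.map_id _).symm) (fun p => by
    rw [totalApp_comp, totalApp_wR, totalApp_wL, totalApp_assoc]
    exact (Category.id_comp (𝟙 (g.total.obj (f.total.obj p)))).trans
      (g.total.map_id (f.total.obj p)).symm)

/-- The 2-category of indexed categories. -/
instance : Bicategory ICat.{v, u} where
  homCategory := homCat
  whiskerLeft f _ _ η := wL f η
  whiskerRight η h := wR η h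
  associator f g h := assocIso f g h
  leftUnitor f := lUnit f
  rightUnitor f := rUnit f
  whiskerLeft_id _ _ := rfl
  whiskerLeft_comp _ _ _ _ _ _ := rfl
  id_whiskerLeft η := id_wL η
  comp_whiskerLeft f g _ _ η := comp_wL f g η
  id_whiskerRight f h := id_wR f h
  comp_whiskerRight η θ h := comp_wR η θ h
  whiskerRight_id η := wR_id η
  whiskerRight_comp η g h := wR_comp η g h
  whisker_assoc f _ _ η h := w_assoc f η h
  whisker_exchange η θ := w_exchange η θ
  pentagon f g h i := pentagon_aux f g h i
  triangle f g := triangle_aux f g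

theorem id_comp_eq (f : M ⟶ N) : 𝟙 M ≫ f = f :=
  Hom.ext' rfl HEq.rfl fun _ _ => heq_of_eq
    ((congrArg (· ≫ _) ((f.app _).map_id _)).trans (Category.id_comp _))

theorem comp_id_eq' (f : M ⟶ N) : f ≫ 𝟙 N = f :=
  Hom.ext' rfl HEq.rfl fun _ _ => heq_of_eq (Category.comp_id _)

theorem comp_nat (f : M ⟶ N) (g : N ⟶ L) {x y : M.base} (k : x ⟶ y) (a : M.fibre y) :
    (Hom.nat (f ≫ g) k a).hom = (g.app _).map (f.nat k a).hom ≫ (g.nat _ _).hom :=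
  rfl

theorem comp_trans_app (f : M ⟶ N) (g : N ⟶ L) :
    (Hom.trans (f ≫ g)).app = fun p : LocallyDiscrete M.baseᵒᵖ => (f.app p.as.unop ⋙ g.app _).toCatHom :=
  rfl

theorem assoc_eq {K : ICat.{v, u}} (f : M ⟶ N) (g : N ⟶ L) (h : L ⟶ K) :
    (f ≫ g) ≫ h = f ≫ g ≫ h :=
  Hom.ext' rfl
    ((heq_of_eq (comp_trans_app (f ≫ g) h)).trans (heq_of_eq (comp_trans_app f (g ≫ h))).symm)
    fun k a => by
      refine (heq_of_eq (comp_nat (f ≫ g) h k a)).trans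
        (HEq.trans ?_ (heq_of_eq (comp_nat f (g ≫ h) k a)).symm)
      refine heq_of_eq ?_
      rw [comp_nat f g]
      refine (congrArg (· ≫ _) ((h.app _).map_comp _ _)).trans ?_
      exact Category.assoc _ _ _

theorem eq_eqToHom {f g : M ⟶ N} (e : f = g) (η : f ⟶ g) (ob : M.base → N.base)
    (hb : ∀ x, f.base.obj x = ob x) (hb' : ∀ x, η.base.app x ≍ 𝟙 (ob x)) (ob' : M.Total → N.Total)
    (ht : ∀ p, f.total.obj p = ob' p) (ht' : ∀ p, η.totalApp p ≍ 𝟙 (ob' p)) :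
    η = eqToHom e := by
  subst e
  obtain rfl : f.base.obj = ob := funext hb
  obtain rfl : f.total.obj = ob' := funext ht
  exact hom₂_ext (fun x => eq_of_heq (hb' x)) (fun p => eq_of_heq (ht' p))

instance : Bicategory.Strict ICat.{v, u} where
  id_comp := id_comp_eq
  comp_id := comp_id_eq'
  assoc := assoc_eq
  leftUnitor_eqToIso f := Iso.ext (eq_eqToHom (id_comp_eq f) _ (fun x => f.base.obj x)
    (fun _ => rfl) (fun _ => HEq.rfl) (fun p => f.total.obj p) (fun _ => rfl) (fun _ => HEq.rfl))
  rightUnitor_eqToIso f := Iso.ext (eq_eqToHom (comp_id_eq' f) _ (fun x => f.base.obj x)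
    (fun _ => rfl) (fun _ => HEq.rfl) (fun p => f.total.obj p) (fun _ => rfl) (fun _ => HEq.rfl))
  associator_eqToIso f g h := Iso.ext (eq_eqToHom (assoc_eq f g h) _
    (fun x => h.base.obj (g.base.obj (f.base.obj x))) (fun _ => rfl) (fun _ => HEq.rfl)
    (fun p => h.total.obj (g.total.obj (f.total.obj p))) (fun _ => rfl)
    (fun p => heq_of_eq (totalApp_assoc f g h p)))

end

end ICat

namespace ICat

section
variable {M N L : ICat.{v, u}}

theorem iso_aux {C : Type u} [Category.{v} C] {a b c : C} (i : b ≅ a) (j : c ≅ b) (e : c ≅ a)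
    {f : b ⟶ b} (h : (i.inv ≫ f ≫ j.inv) ≫ e.hom = 𝟙 a) (hf : f = 𝟙 b) :
    j.hom ≫ i.hom = e.hom := by
  subst hf
  rw [Category.id_comp, Category.assoc, Iso.inv_comp_eq, Iso.inv_comp_eq, Category.comp_id] at h
  exact h.symm

theorem pull_id_left (M : ICat.{v, u}) {x y : M.base} (k : x ⟶ y) (a : M.fibre y) :
    (M.pullComp (𝟙 x) k a).hom ≫ (M.pullId x ((M.pull k).obj a)).hom =
      (M.pullCongr (Category.id_comp k) a).hom := by
  have h := (homMk_eq_iff (Category.id_comp k)).1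
    (Category.id_comp (homMk k (𝟙 ((M.pull k).obj a))))
  change ((M.pullId x _).inv ≫ (M.pull (𝟙 x)).map (𝟙 _) ≫ (M.pullComp _ _ _).inv) ≫
    (M.pullCongr _ _).hom = 𝟙 _ at h
  exact iso_aux _ _ _ h (CategoryTheory.Functor.map_id _ _)

theorem pull_id_right (M : ICat.{v, u}) {x y : M.base} (k : x ⟶ y) (a : M.fibre y) :
    (M.pullComp k (𝟙 y) a).hom ≫ (M.pull k).map (M.pullId y a).hom =
      (M.pullCongr (Category.comp_id k) a).hom := by
  have h := (homMk_eq_iff (Category.comp_id k)).1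
    (Category.comp_id (homMk k (𝟙 ((M.pull k).obj a))))
  change (𝟙 _ ≫ (M.pull k).map (M.pullId y _).inv ≫ (M.pullComp _ _ _).inv) ≫
    (M.pullCongr _ _).hom = 𝟙 _ at h
  refine iso_aux ((M.pull k).mapIso (M.pullId y a)) (M.pullComp k (𝟙 y) a)
    (M.pullCongr (Category.comp_id k) a) (f := 𝟙 _) ?_ rfl
  refine Eq.trans ?_ h
  simp only [Functor.mapIso_inv, Category.id_comp, Category.assoc]

theorem pull_assoc (M : ICat.{v, u}) {x y z w : M.base} (k : x ⟶ y) (l : y ⟶ z) (m : z ⟶ w)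
    (a : M.fibre w) :
    (M.pullComp k (l ≫ m) a).hom ≫ (M.pull k).map (M.pullComp l m a).hom =
      (M.pullCongr (Category.assoc k l m).symm a).hom ≫ (M.pullComp (k ≫ l) m a).hom ≫
        (M.pullComp k l ((M.pull m).obj a)).hom := by
  have h := (homMk_eq_iff (Category.assoc k l m).symm).1
    (Category.assoc (homMk k (𝟙 ((M.pull k).obj ((M.pull l).obj ((M.pull m).obj a)))))
      (homMk l (𝟙 _)) (homMk m (𝟙 ((M.pull m).obj a)))).symm
  change (𝟙 _ ≫ (M.pull k).map (𝟙 _ ≫ (M.pull l).map (𝟙 _) ≫ (M.pullComp l m a).inv) ≫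
    (M.pullComp k (l ≫ m) a).inv) ≫ (M.pullCongr _ _).hom =
    (𝟙 _ ≫ (M.pull k).map (𝟙 _) ≫ (M.pullComp k l _).inv) ≫ (M.pull _).map (𝟙 _) ≫
    (M.pullComp (k ≫ l) m a).inv at h
  simp only [CategoryTheory.Functor.map_id, Category.id_comp, Category.assoc] at h
  rw [← Functor.mapIso_inv, Iso.inv_comp_eq, Iso.inv_comp_eq] at h
  rw [h]
  simp

/-- An indexed category from fibres, reindexing functors and coherence isomorphisms. -/
def ofData (X : Type u) [Category.{v} X] (F : X → Cat.{v, u}) (pull : ∀ {x y : X}, (x ⟶ y) → F y ⥤ F x)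
    (pullId : ∀ (x : X) (a : F x), (pull (𝟙 x)).obj a ≅ a)
    (pullComp : ∀ {x y z : X} (k : x ⟶ y) (l : y ⟶ z) (a : F z),
      (pull (k ≫ l)).obj a ≅ (pull k).obj ((pull l).obj a))
    (pullId_natural : ∀ {x : X} {a b : F x} (m : a ⟶ b),
      (pull (𝟙 x)).map m ≫ (pullId x b).hom = (pullId x a).hom ≫ m)
    (pullComp_natural : ∀ {x y z : X} (k : x ⟶ y) (l : y ⟶ z) {a b : F z} (m : a ⟶ b),
      (pull (k ≫ l)).map m ≫ (pullComp k l b).hom =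
        (pullComp k l a).hom ≫ (pull k).map ((pull l).map m))
    (id_left : ∀ {x y : X} (k : x ⟶ y) (a : F y),
      (pullComp (𝟙 x) k a).hom ≫ (pullId x ((pull k).obj a)).hom =
        eqToHom (by rw [Category.id_comp]))
    (id_right : ∀ {x y : X} (k : x ⟶ y) (a : F y),
      (pullComp k (𝟙 y) a).hom ≫ (pull k).map (pullId y a).hom =
        eqToHom (by rw [Category.comp_id]))
    (assoc : ∀ {x y z w : X} (k : x ⟶ y) (l : y ⟶ z) (m : z ⟶ w) (a : F w),
      (pullComp k (l ≫ m) a).hom ≫ (pull k).map (pullComp l m a).hom =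
        eqToHom (by rw [Category.assoc]) ≫ (pullComp (k ≫ l) m a).hom ≫
          (pullComp k l ((pull m).obj a)).hom) : ICat.{v, u} where
  base := X
  fam := LocallyDiscrete.mkPseudofunctor (fun p => F p.unop) (fun k => (pull k.unop).toCatHom)
    (fun p => Cat.Hom.isoMk (NatIso.ofComponents (pullId p.unop) (fun m => pullId_natural m)))
    (fun k l => Cat.Hom.isoMk (NatIso.ofComponents (pullComp l.unop k.unop)
      (fun m => pullComp_natural _ _ m)))
    (fun f g h => by
      refine Cat.Hom₂.ext (NatTrans.ext (funext fun a => ?_))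
      refine Eq.trans ?_ (Cat.eqToHom_app _ _ _ a).symm
      have := assoc h.unop g.unop f.unop a
      change (pullComp h.unop (g.unop ≫ f.unop) a).hom ≫ (pull h.unop).map
        (pullComp g.unop f.unop a).hom ≫ 𝟙 _ ≫ (pullComp h.unop g.unop _).inv ≫
        (pullComp (h.unop ≫ g.unop) f.unop a).inv = _
      rw [reassoc_of% this]
      simp
      rfl)
    (fun f => by
      refine Cat.Hom₂.ext (NatTrans.ext (funext fun a => ?_))
      refine Eq.trans ?_ (Cat.eqToHom_app _ _ _ a).symm
      have := id_right f.unop a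
      change (pullComp f.unop (𝟙 _) a).hom ≫ (pull f.unop).map (pullId _ a).hom ≫ 𝟙 _ = _
      exact (congrArg (_ ≫ ·) (Category.comp_id _)).trans this)
    (fun f => by
      refine Cat.Hom₂.ext (NatTrans.ext (funext fun a => ?_))
      refine Eq.trans ?_ (Cat.eqToHom_app _ _ _ a).symm
      have := id_left f.unop a
      change (pullComp (𝟙 _) f.unop a).hom ≫ (pullId _ _).hom ≫ 𝟙 _ = _
      exact (congrArg (_ ≫ ·) (Category.comp_id _)).trans this)

theorem pullCongr_fst {p q : M.base × N.base} {k l : p ⟶ q} (h : k = l)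
    (a : M.fibre q.1 × N.fibre q.2) :
    (M.pullCongr (congrArg Prod.fst h) a.1).hom =
      (eqToHom (congrArg (fun t : p ⟶ q => ((M.pull t.1).prod (N.pull t.2)).obj a) h)).1 := by
  subst h; rfl

theorem pullCongr_snd {p q : M.base × N.base} {k l : p ⟶ q} (h : k = l)
    (a : M.fibre q.1 × N.fibre q.2) :
    (N.pullCongr (congrArg Prod.snd h) a.2).hom =
      (eqToHom (congrArg (fun t : p ⟶ q => ((M.pull t.1).prod (N.pull t.2)).obj a) h)).2 := by
  subst h; rfl

/-- The product `(x, y) ↦ M x × N y` of two indexed categories. -/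
def prod (M N : ICat.{v, u}) : ICat.{v, u} :=
  ofData (M.base × N.base) (fun p => Cat.of (M.fibre p.1 × N.fibre p.2))
    (fun {p q : M.base × N.base} (k : p ⟶ q) => (M.pull k.1).prod (N.pull k.2))
    (fun p a => Iso.prod (M.pullId p.1 a.1) (N.pullId p.2 a.2))
    (fun {p q r : M.base × N.base} (k : p ⟶ q) (l : q ⟶ r) a =>
      Iso.prod (M.pullComp k.1 l.1 a.1) (N.pullComp k.2 l.2 a.2))
    (fun m => Prod.ext (M.pullId_natural m.1) (N.pullId_natural m.2))
    (fun {p q r : M.base × N.base} (k : p ⟶ q) (l : q ⟶ r) _ _ m =>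
      Prod.ext (M.pullComp_natural k.1 l.1 m.1) (N.pullComp_natural k.2 l.2 m.2))
    (fun {p q : M.base × N.base} (k : p ⟶ q) a =>
      Prod.ext ((M.pull_id_left k.1 a.1).trans (pullCongr_fst (Category.id_comp k) a))
        ((N.pull_id_left k.2 a.2).trans (pullCongr_snd (Category.id_comp k) a)))
    (fun {p q : M.base × N.base} (k : p ⟶ q) a =>
      Prod.ext ((M.pull_id_right k.1 a.1).trans (pullCongr_fst (Category.comp_id k) a))
        ((N.pull_id_right k.2 a.2).trans (pullCongr_snd (Category.comp_id k) a)))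
    (fun {p q r s : M.base × N.base} (k : p ⟶ q) (l : q ⟶ r) (m : r ⟶ s) a => Prod.ext
      ((M.pull_assoc k.1 l.1 m.1 a.1).trans (congrArg (· ≫ _) (pullCongr_fst (Category.assoc k l m).symm a)))
      ((N.pull_assoc k.2 l.2 m.2 a.2).trans (congrArg (· ≫ _) (pullCongr_snd (Category.assoc k l m).symm a))))

/-- The terminal indexed category `1ᵒᵖ → Cat`, with value the terminal category. -/
def one : ICat.{v, u} :=
  ofData Cat.chosenTerminal.{v, u} (fun _ => Cat.chosenTerminal.{v, u}) (fun _ => 𝟭 _)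
    (fun _ _ => Iso.refl _) (fun _ _ _ => Iso.refl _)
    (fun _ => Fib.chosenTerminal_ext _ _) (fun _ _ _ _ _ => Fib.chosenTerminal_ext _ _)
    (fun _ _ => Fib.chosenTerminal_ext _ _) (fun _ _ => Fib.chosenTerminal_ext _ _)
    (fun _ _ _ _ => Fib.chosenTerminal_ext _ _)

/-- The indexed 1-cell to the terminal indexed category. -/
def toOne (M : ICat.{v, u}) : M ⟶ one :=
  Hom.mk' ((Functor.const _).obj ⟨⟨⟨⟩⟩⟩) (fun _ => (Functor.const _).obj ⟨⟨⟨⟩⟩⟩)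
    (fun _ _ => Iso.refl _)
    (fun _ _ _ _ => Fib.chosenTerminal_ext _ _) (fun _ _ => Fib.chosenTerminal_ext _ _)
    (fun _ _ _ => Fib.chosenTerminal_ext _ _)

theorem pullCongr_prod_fst {p q : (prod M N).base} {k l : p ⟶ q} (h : k = l)
    (a : (prod M N).fibre q) :
    (((prod M N).pullCongr h a).hom : _ ⟶ _).1 = (M.pullCongr (congrArg Prod.fst h) a.1).hom := by
  subst h; rfl

theorem pullCongr_prod_snd {p q : (prod M N).base} {k l : p ⟶ q} (h : k = l)
    (a : (prod M N).fibre q) :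
    (((prod M N).pullCongr h a).hom : _ ⟶ _).2 = (N.pullCongr (congrArg Prod.snd h) a.2).hom := by
  subst h; rfl

/-- The first projection. -/
def prodFst (M N : ICat.{v, u}) : prod M N ⟶ M :=
  Hom.mk' (CategoryTheory.Prod.fst _ _) (fun _ => CategoryTheory.Prod.fst _ _)
    (fun _ a => Iso.refl _)
    (fun _ _ _ _ => (Category.comp_id _).trans (Category.id_comp _).symm)
    (fun _ _ => (Category.id_comp _).trans (Category.id_comp _))
    (fun {x y z} k l a => by
      refine ((Category.id_comp _).trans (Category.id_comp _)).trans ?_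
      refine Eq.trans ?_ (congrArg (_ ≫ ·) ((Category.id_comp _).trans ((M.pull k.1).map_id _))).symm
      exact (Category.comp_id _).symm)

/-- The second projection. -/
def prodSnd (M N : ICat.{v, u}) : prod M N ⟶ N :=
  Hom.mk' (CategoryTheory.Prod.snd _ _) (fun _ => CategoryTheory.Prod.snd _ _)
    (fun _ a => Iso.refl _)
    (fun _ _ _ _ => (Category.comp_id _).trans (Category.id_comp _).symm)
    (fun _ _ => (Category.id_comp _).trans (Category.id_comp _))
    (fun {x y z} k l a => by
      refine ((Category.id_comp _).trans (Category.id_comp _)).trans ?_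
      refine Eq.trans ?_ (congrArg (_ ≫ ·) ((Category.id_comp _).trans ((N.pull k.2).map_id _))).symm
      exact (Category.comp_id _).symm)

/-- The pairing of two indexed 1-cells. -/
def prodLift (f : L ⟶ M) (g : L ⟶ N) : L ⟶ prod M N :=
  Hom.mk' (Functor.prod' f.base g.base) (fun x => Functor.prod' (f.app x) (g.app x))
    (fun k a => Iso.prod (f.nat k a) (g.nat k a))
    (fun k _ _ m => Prod.ext (f.nat_natural k m) (g.nat_natural k m))
    (fun x a => Prod.ext ((congrArg (fun t => _ ≫ t ≫ _) (pullCongr_prod_fst _ _)).trans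
        (f.nat_id x a))
      ((congrArg (fun t => _ ≫ t ≫ _) (pullCongr_prod_snd _ _)).trans (g.nat_id x a)))
    (fun k l a => Prod.ext ((congrArg (fun t => _ ≫ t ≫ _) (pullCongr_prod_fst _ _)).trans
        (f.nat_comp k l a))
      ((congrArg (fun t => _ ≫ t ≫ _) (pullCongr_prod_snd _ _)).trans (g.nat_comp k l a)))

theorem prodLift_fst (f : L ⟶ M) (g : L ⟶ N) : prodLift f g ≫ prodFst M N = f :=
  Hom.ext' rfl HEq.rfl fun _ _ => heq_of_eq (Category.comp_id _)

theorem prodLift_snd (f : L ⟶ M) (g : L ⟶ N) : prodLift f g ≫ prodSnd M N = g :=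
  Hom.ext' rfl HEq.rfl fun _ _ => heq_of_eq (Category.comp_id _)

theorem prodLift_eta (m : L ⟶ prod M N) :
    prodLift (m ≫ prodFst M N) (m ≫ prodSnd M N) = m :=
  Hom.ext' rfl HEq.rfl fun _ _ => heq_of_eq
    (Prod.ext (Category.comp_id _) (Category.comp_id _))

/-- The cartesian monoidal structure of the category of indexed categories. -/
noncomputable instance : CartesianMonoidalCategory ICat.{v, u} :=
  .ofChosenFiniteProducts
    ⟨_, Limits.IsTerminal.ofUniqueHom toOne fun _ _ =>
      Hom.ext' rfl HEq.rfl fun _ _ => heq_of_eq (Fib.chosenTerminal_ext _ _)⟩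
    fun M N =>
    { cone := Limits.BinaryFan.mk (prodFst M N) (prodSnd M N)
      isLimit := Limits.BinaryFan.isLimitMk (fun s => prodLift s.fst s.snd)
        (fun s => prodLift_fst s.fst s.snd) (fun s => prodLift_snd s.fst s.snd)
        (fun s m h₁ h₂ => by rw [← h₁, ← h₂]; exact (prodLift_eta m).symm) }

noncomputable instance : BraidedCategory ICat.{v, u} := .ofCartesianMonoidalCategory

end

end ICat

namespace Fib

theorem hom_ext {P Q : Fib.{v, u}} {f g : P ⟶ Q} (hb : f.base = g.base) (ht : f.total = g.total) :
    f = g := by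
  obtain ⟨b, t, _, _⟩ := f
  obtain ⟨b', t', _, _⟩ := g
  obtain rfl : b = b' := hb
  obtain rfl : t = t' := ht
  rfl

theorem hom₂_heq {P Q : Fib.{v, u}} {f f' g g' : P ⟶ Q} (hf : f = f') (hg : g = g') {η : f ⟶ g}
    {θ : f' ⟶ g'} (hb : ∀ x, η.base.app x ≍ θ.base.app x)
    (ht : ∀ a, η.total.app a ≍ θ.total.app a) : η ≍ θ := by
  subst hf hg
  exact heq_of_eq (hom₂_ext' (fun x => eq_of_heq (hb x)) (fun a => eq_of_heq (ht a)))

end Fib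

namespace ICat

open Pseudofunctor (CoGrothendieck)

section
variable {M N L : ICat.{v, u}}

theorem prod_total_ext {p q : (prod M N).Total} {φ ψ : p ⟶ q}
    (h₁ : (Hom.total (prodFst M N)).map φ = (Hom.total (prodFst M N)).map ψ)
    (h₂ : (Hom.total (prodSnd M N)).map φ = (Hom.total (prodSnd M N)).map ψ) : φ = ψ := by
  obtain ⟨x, a⟩ := p
  obtain ⟨y, b⟩ := q
  obtain ⟨k, (m : a ⟶ ((prod M N).pull k).obj b)⟩ := φ
  obtain ⟨l, (n : a ⟶ ((prod M N).pull l).obj b)⟩ := ψ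
  have e₁ : k.1 = l.1 := congrArg CoGrothendieck.Hom.base h₁
  have e₂ : k.2 = l.2 := congrArg CoGrothendieck.Hom.base h₂
  obtain rfl : k = l := Prod.ext e₁ e₂
  refine (homMk_eq_iff rfl).2 ((Category.comp_id _).trans ?_)
  refine Prod.ext ?_ ?_
  · have := (homMk_eq_iff rfl).1 h₁
    exact (Category.comp_id _).symm.trans ((Category.comp_id _).symm.trans
      (this.trans (Category.comp_id _)))
  · have := (homMk_eq_iff rfl).1 h₂
    exact (Category.comp_id _).symm.trans ((Category.comp_id _).symm.trans
      (this.trans (Category.comp_id _)))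

theorem prodFst_total_homMk {x y : M.base × N.base} {a : (prod M N).fibre x}
    {b : (prod M N).fibre y} (k : x ⟶ y) (m : a ⟶ ((prod M N).pull k).obj b) :
    (Hom.total (prodFst M N)).map (homMk (M := prod M N) k m) = homMk k.1 m.1 :=
  congrArg (homMk k.1) (Category.comp_id _)

theorem prodSnd_total_homMk {x y : M.base × N.base} {a : (prod M N).fibre x}
    {b : (prod M N).fibre y} (k : x ⟶ y) (m : a ⟶ ((prod M N).pull k).obj b) :
    (Hom.total (prodSnd M N)).map (homMk (M := prod M N) k m) = homMk k.2 m.2 :=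
  congrArg (homMk k.2) (Category.comp_id _)

/-- The 2-cell into a product with given projections. -/
def lift₂ {f g : L ⟶ prod M N} (η : f ≫ prodFst M N ⟶ g ≫ prodFst M N)
    (θ : f ≫ prodSnd M N ⟶ g ≫ prodSnd M N) : f ⟶ g :=
  Hom₂.mk' (NatTrans.prod' η.base θ.base)
    (fun x a => ((η.app x).app a, (θ.app x).app a))
    (fun {p q} φ => by
      refine prod_total_ext ?_ ?_
      · refine ((Hom.total (prodFst M N)).map_comp _ _).trans
          (Eq.trans ?_ ((Hom.total (prodFst M N)).map_comp _ _).symm)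
        have := η.total_natural φ
        rw [comp_total_map, comp_total_map] at this
        refine (congrArg (_ ≫ ·) (prodFst_total_homMk _ _)).trans (this.trans ?_)
        exact congrArg (· ≫ (Hom.total (prodFst M N)).map (g.total.map φ)) (prodFst_total_homMk (N := N)
          (b := (g.app p.base).obj p.fiber) (η.base.app p.base, θ.base.app p.base)
          ((η.app p.base).app p.fiber, (θ.app p.base).app p.fiber)).symm
      · refine ((Hom.total (prodSnd M N)).map_comp _ _).trans
          (Eq.trans ?_ ((Hom.total (prodSnd M N)).map_comp _ _).symm)
        have := θ.total_natural φ
        rw [comp_total_map, comp_total_map] at this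
        refine (congrArg (_ ≫ ·) (prodSnd_total_homMk _ _)).trans (this.trans ?_)
        exact congrArg (· ≫ (Hom.total (prodSnd M N)).map (g.total.map φ)) (prodSnd_total_homMk (M := M)
          (b := (g.app p.base).obj p.fiber) (η.base.app p.base, θ.base.app p.base)
          ((η.app p.base).app p.fiber, (θ.app p.base).app p.fiber)).symm)

theorem lift₂_fst {f g : L ⟶ prod M N} (η : f ≫ prodFst M N ⟶ g ≫ prodFst M N)
    (θ : f ≫ prodSnd M N ⟶ g ≫ prodSnd M N) : wR (lift₂ η θ) (prodFst M N) = η :=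
  hom₂_ext (fun _ => rfl) (fun p => by
    rw [totalApp_wR]
    exact prodFst_total_homMk _ _)

theorem lift₂_snd {f g : L ⟶ prod M N} (η : f ≫ prodFst M N ⟶ g ≫ prodFst M N)
    (θ : f ≫ prodSnd M N ⟶ g ≫ prodSnd M N) : wR (lift₂ η θ) (prodSnd M N) = θ :=
  hom₂_ext (fun _ => rfl) (fun p => by
    rw [totalApp_wR]
    exact prodSnd_total_homMk _ _)

theorem hom_ext₂ {f g : L ⟶ prod M N} (η θ : f ⟶ g)
    (h₁ : wR η (prodFst M N) = wR θ (prodFst M N))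
    (h₂ : wR η (prodSnd M N) = wR θ (prodSnd M N)) : η = θ :=
  hom₂_ext
    (fun x => Prod.ext (congrArg (fun t => t.base.app x) h₁) (congrArg (fun t => t.base.app x) h₂))
    (fun p => prod_total_ext (congrArg (fun t => t.totalApp p) h₁)
      (congrArg (fun t => t.totalApp p) h₂))

theorem one_total_ext {p q : (one.{v, u}).Total} (φ ψ : p ⟶ q) : φ = ψ := by
  obtain ⟨k, m⟩ := φ
  obtain ⟨l, n⟩ := ψ
  obtain rfl : k = l := Fib.chosenTerminal_ext _ _
  obtain rfl : m = n := Fib.chosenTerminal_ext _ _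
  rfl

noncomputable instance : CartesianTwoCategory ICat.{v, u} where
  lift₂ η θ := lift₂ η θ
  lift₂_fst η θ := lift₂_fst η θ
  lift₂_snd η θ := lift₂_snd η θ
  hom_ext₂ η θ h₁ h₂ := hom_ext₂ η θ h₁ h₂
  unit_ext₂ _ _ := hom₂_ext (fun _ => Fib.chosenTerminal_ext _ _) (fun _ => one_total_ext _ _)

/-! ### The Grothendieck construction as a 2-functor -/

theorem isStronglyCartesian_homMk {x y : M.base} {a : M.fibre x} {b : M.fibre y} (k : x ⟶ y)
    (m : a ⟶ (M.pull k).obj b) [IsIso m] :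
    (CoGrothendieck.forget M.fam).IsStronglyCartesian
      ((CoGrothendieck.forget M.fam).map (homMk k m)) (homMk k m) := by
  refine (Fib.isStronglyCartesian_iff (CoGrothendieck.forget M.fam) (homMk k m)).2 ?_
  rintro ⟨z, c⟩ (g : z ⟶ x) ⟨l, (n : c ⟶ (M.pull l).obj b)⟩ w
  obtain rfl : l = g ≫ k := w
  refine ⟨homMk g (n ≫ (M.pullComp g k b).hom ≫ (M.pull g).map (inv m)), ⟨rfl, ?_⟩, ?_⟩
  · refine (homMk_eq_iff rfl).2 ((Category.comp_id _).trans ?_)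
    change (n ≫ (M.pullComp g k b).hom ≫ (M.pull g).map (inv m)) ≫ (M.pull g).map m ≫
      (M.pullComp g k b).inv = n
    rw [Category.assoc, Category.assoc, ← (M.pull g).map_comp_assoc]
    simp
  · rintro ⟨g', (s : c ⟶ (M.pull g').obj a)⟩ ⟨h₁, h₂⟩
    obtain rfl : g' = g := h₁
    have h := (homMk_eq_iff rfl).1 h₂
    have h' : s ≫ (M.pull g').map m ≫ (M.pullComp g' k b).inv = n :=
      (Category.comp_id _).symm.trans h
    refine (homMk_eq_iff rfl).2 ((Category.comp_id _).trans ?_)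
    rw [← h']
    simp only [Category.assoc, Iso.inv_hom_id_assoc, ← Functor.map_comp, IsIso.hom_inv_id,
      CategoryTheory.Functor.map_id, Category.comp_id]

/-- The canonical cartesian lift of `k` at `a`. -/
def cartLift {x y : M.base} (k : x ⟶ y) (a : M.fibre y) :
    (⟨x, (M.pull k).obj a⟩ : M.Total) ⟶ ⟨y, a⟩ :=
  homMk k (𝟙 _)

theorem vert_injective {x : M.base} {a b : M.fibre x} {k l : a ⟶ b} (h : vert k = vert l) :
    k = l := by
  have := (Category.comp_id _).symm.trans ((homMk_eq_iff rfl).1 h)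
  exact (cancel_mono (M.pullId x b).inv).1 this

theorem vert_comp {x : M.base} {a b c : M.fibre x} (k : a ⟶ b) (l : b ⟶ c) :
    vert k ≫ vert l = vert (k ≫ l) :=
  (vert_comp_homMk k (𝟙 x) _).trans (congrArg (homMk (𝟙 x)) (Category.assoc _ _ _).symm)

theorem vert_id {x : M.base} (a : M.fibre x) : vert (𝟙 a) = 𝟙 (⟨x, a⟩ : M.Total) :=
  congrArg (homMk (𝟙 x)) (Category.id_comp _)

theorem isIso_of_isStronglyCartesian_homMk {x y : M.base} {a : M.fibre x} {b : M.fibre y}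
    (k : x ⟶ y) (m : a ⟶ (M.pull k).obj b) (h : (CoGrothendieck.forget M.fam).IsStronglyCartesian
      ((CoGrothendieck.forget M.fam).map (homMk k m)) (homMk k m)) : IsIso m := by
  have e : vert m ≫ cartLift k b = homMk k m :=
    (vert_comp_homMk m k _).trans (congrArg (homMk k) (Category.comp_id _))
  have hφ := (Fib.isStronglyCartesian_iff (CoGrothendieck.forget M.fam) (homMk k m)).1 h
  have hl := (Fib.isStronglyCartesian_iff (CoGrothendieck.forget M.fam) (cartLift k b)).1
    (isStronglyCartesian_homMk k (𝟙 _))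
  obtain ⟨χ, ⟨h₁, h₂⟩, -⟩ := hφ ⟨x, (M.pull k).obj b⟩ (𝟙 x) (cartLift k b)
    (Category.id_comp k).symm
  obtain ⟨g, (s : (M.pull k).obj b ⟶ (M.pull g).obj a)⟩ := χ
  obtain rfl : g = 𝟙 x := h₁
  have hs : homMk (𝟙 x) s = vert (s ≫ (M.pullId x a).hom) := by
    refine congrArg (homMk (𝟙 x)) ?_
    rw [Category.assoc, Iso.hom_inv_id, Category.comp_id]
  have h₃ : vert (s ≫ (M.pullId x a).hom) ≫ homMk k m = cartLift k b := by rw [← hs]; exact h₂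
  refine ⟨s ≫ (M.pullId x a).hom, vert_injective ?_, vert_injective ?_⟩
  · rw [← vert_comp, vert_id]
    refine (hφ ⟨x, a⟩ (𝟙 x) (homMk k m) (Category.id_comp k).symm).unique ⟨Category.id_comp (𝟙 x), ?_⟩
      ⟨rfl, Category.id_comp _⟩
    rw [Category.assoc, h₃, e]
  · rw [← vert_comp, vert_id]
    refine (hl ⟨x, (M.pull k).obj b⟩ (𝟙 x) (cartLift k b) (Category.id_comp k).symm).unique ⟨Category.id_comp (𝟙 x), ?_⟩
      ⟨rfl, Category.id_comp _⟩
    rw [Category.assoc, e, h₃]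

/-- The fibration associated to an indexed category: its Grothendieck construction. -/
abbrev fibration (M : ICat.{v, u}) : Fib.{v, u} where
  base := M.base
  total := M.Total
  proj := CoGrothendieck.forget M.fam

/-- The fibred 1-cell `(x, a) ↦ (F x, τ_x a)` over `F` associated to an indexed 1-cell
`(F, τ)`. -/
def fibrationMap (f : M ⟶ N) : fibration M ⟶ fibration N where
  base := f.base
  total := f.total
  w := rfl
  cart {a b} φ h := by
    obtain ⟨x, a⟩ := a
    obtain ⟨y, b⟩ := b
    obtain ⟨k, (m : a ⟶ (M.pull k).obj b)⟩ := φ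
    have : IsIso m := isIso_of_isStronglyCartesian_homMk k m h
    exact isStronglyCartesian_homMk (f.base.map k) ((f.app x).map m ≫ (f.nat k b).hom)

/-- The fibred 2-cell with components `(α_x, m_x a)` over `α` associated to an indexed 2-cell
`(α, m)`. -/
def fibrationMap₂ {f g : M ⟶ N} (η : f ⟶ g) : fibrationMap f ⟶ fibrationMap g where
  base := η.base
  total := η.total
  w p := (Fib.isHomLift_iff (CoGrothendieck.forget N.fam) (a := f.total.obj p)
    (b := g.total.obj p) _ (η.totalApp p)).2 rfl

theorem fibrationMap_id (M : ICat.{v, u}) : fibrationMap (𝟙 M) = 𝟙 (fibration M) :=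
  Fib.hom_ext rfl (Functor.hext (fun _ => rfl) fun _ _ φ => heq_of_eq (id_total_map φ))

theorem fibrationMap_comp (f : M ⟶ N) (g : N ⟶ L) :
    fibrationMap (f ≫ g) = fibrationMap f ≫ fibrationMap g :=
  Fib.hom_ext rfl (Functor.hext (fun _ => rfl) fun _ _ φ => heq_of_eq (comp_total_map f g φ))

/-- The Grothendieck construction, as a strict 2-functor from indexed categories to fibrations. -/
def grothendieck : StrictPseudofunctor ICat.{v, u} Fib.{v, u} :=
  StrictPseudofunctor.mk''
    { obj := fibration
      map := fibrationMap
      map₂ := fibrationMap₂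
      map₂_id := fun _ => rfl
      map₂_comp := fun _ _ => rfl
      map_id := fibrationMap_id
      map_comp := fibrationMap_comp
      map₂_whisker_left := fun f g g' _ => CartesianTwoCategory.eq_conj _ _
        (Fib.hom₂_heq (fibrationMap_comp f g) (fibrationMap_comp f g') (fun _ => HEq.rfl)
          (fun _ => HEq.rfl))
      map₂_whisker_right := fun {_ _ _ f f'} _ g => CartesianTwoCategory.eq_conj _ _
        (Fib.hom₂_heq (fibrationMap_comp f g) (fibrationMap_comp f' g) (fun _ => HEq.rfl)
          (fun _ => HEq.rfl)) }

end

end ICat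

namespace Fib

/-- The inclusion of the fibre over `x`, consisting of the objects above `x` and the morphisms
above the identity of `x`. -/
abbrev incl (P : Fib.{v, u}) {x : P.base} : P.proj.Fiber x ⥤ P.total :=
  Functor.Fiber.fiberInclusion

/-- A (not necessarily split or normal) cleavage of a fibration: a choice, for every morphism
`f : x ⟶ y` of the base and every object `b` above `y`, of a cartesian lifting
`map f b : obj f b ⟶ b` of `f`. -/
structure Cleavage (P : Fib.{v, u}) where
  obj {x y : P.base} (f : x ⟶ y) (b : P.proj.Fiber y) : P.proj.Fiber x
  map {x y : P.base} (f : x ⟶ y) (b : P.proj.Fiber y) : P.incl.obj (obj f b) ⟶ P.incl.obj b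
  cart {x y : P.base} (f : x ⟶ y) (b : P.proj.Fiber y) : P.proj.IsStronglyCartesian f (map f b)

/-- Every fibration has a cleavage, by the axiom of choice. -/
theorem nonempty_cleavage (P : Fib.{v, u}) : Nonempty (Cleavage P) :=
  ⟨{  obj := fun f b => ⟨_, Functor.IsPreFibered.pullbackObj_proj b.2 f⟩
      map := fun f b => Functor.IsPreFibered.pullbackMap b.2 f
      cart := fun f b => inferInstanceAs (P.proj.IsStronglyCartesian f
        (Functor.IsPreFibered.pullbackMap b.2 f)) }⟩

theorem cart_ext {C D : Type*} [Category C] [Category D] (p : C ⥤ D) {x y z : D} {g : x ⟶ y}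
    {f : y ⟶ z} {a b c : C} (φ : b ⟶ c) (h : p.IsStronglyCartesian f φ) {ψ ψ' : a ⟶ b}
    (h₁ : p.IsHomLift g ψ) (h₂ : p.IsHomLift g ψ') (e : ψ ≫ φ = ψ' ≫ φ) : ψ = ψ' :=
  Functor.IsStronglyCartesian.ext p f φ g e

theorem cart_exists {C D : Type*} [Category C] [Category D] (p : C ⥤ D) {x y z : D} {k : x ⟶ z}
    {g : x ⟶ y} {f : y ⟶ z} {a b c : C} (φ : b ⟶ c) (h : p.IsStronglyCartesian f φ)
    (ψ : a ⟶ c) (e : k = g ≫ f) (h₁ : p.IsHomLift k ψ) :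
    ∃ χ : a ⟶ b, p.IsHomLift g χ ∧ χ ≫ φ = ψ :=
  ⟨Functor.IsStronglyCartesian.map p f φ e ψ, inferInstance,
    Functor.IsStronglyCartesian.fac p f φ e ψ⟩

theorem lift_comp {C D : Type*} [Category C] [Category D] (p : C ⥤ D) {x y z : D} {f : x ⟶ y}
    {g : y ⟶ z} {a b c : C} {φ : a ⟶ b} {ψ : b ⟶ c} {k : x ⟶ z} (h : p.IsHomLift f φ)
    (h' : p.IsHomLift g ψ) (e : f ≫ g = k) : p.IsHomLift k (φ ≫ ψ) := by
  subst e; infer_instance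

/-- A morphism of the fibre over `x` from a morphism above the identity. -/
def fibreHom (P : Fib.{v, u}) {x : P.base} {a b : P.proj.Fiber x} (φ : P.incl.obj a ⟶ P.incl.obj b)
    (h : P.proj.IsHomLift (𝟙 x) φ) : a ⟶ b :=
  ⟨φ, h⟩

theorem incl_fibreHom (P : Fib.{v, u}) {x : P.base} {a b : P.proj.Fiber x}
    (φ : P.incl.obj a ⟶ P.incl.obj b) (h : P.proj.IsHomLift (𝟙 x) φ) :
    P.incl.map (P.fibreHom φ h) = φ := rfl

theorem incl_injective (P : Fib.{v, u}) {x : P.base} {a b : P.proj.Fiber x} {m n : a ⟶ b}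
    (h : P.incl.map m = P.incl.map n) : m = n :=
  Subtype.ext h

theorem incl_lift (P : Fib.{v, u}) {x : P.base} {a b : P.proj.Fiber x} (m : a ⟶ b) :
    P.proj.IsHomLift (𝟙 x) (P.incl.map m) := m.2

namespace Cleavage

variable {P Q : Fib.{v, u}} (κ : Cleavage P)

theorem map_lift {x y : P.base} (f : x ⟶ y) (b : P.proj.Fiber y) :
    P.proj.IsHomLift f (κ.map f b) :=
  (κ.cart f b).toIsHomLift

theorem exists_desc {x y : P.base} (f : x ⟶ y) {c : P.proj.Fiber x} {b : P.proj.Fiber y}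
    (φ : P.incl.obj c ⟶ P.incl.obj b) (h : P.proj.IsHomLift f φ) :
    ∃ m : c ⟶ κ.obj f b, P.incl.map m ≫ κ.map f b = φ :=
  let ⟨χ, h₁, h₂⟩ := cart_exists P.proj (κ.map f b) (κ.cart f b) φ (Category.id_comp f).symm h
  ⟨P.fibreHom χ h₁, h₂⟩

/-- The factorization of a lift of `f` through the chosen lift. -/
noncomputable def desc {x y : P.base} (f : x ⟶ y) {c : P.proj.Fiber x} {b : P.proj.Fiber y}
    (φ : P.incl.obj c ⟶ P.incl.obj b) (h : P.proj.IsHomLift f φ) : c ⟶ κ.obj f b :=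
  (κ.exists_desc f φ h).choose

theorem desc_fac {x y : P.base} (f : x ⟶ y) {c : P.proj.Fiber x} {b : P.proj.Fiber y}
    (φ : P.incl.obj c ⟶ P.incl.obj b) (h : P.proj.IsHomLift f φ) :
    P.incl.map (κ.desc f φ h) ≫ κ.map f b = φ :=
  (κ.exists_desc f φ h).choose_spec

theorem hom_ext {x y : P.base} (f : x ⟶ y) {c : P.proj.Fiber x} {b : P.proj.Fiber y}
    {m n : c ⟶ κ.obj f b} (h : P.incl.map m ≫ κ.map f b = P.incl.map n ≫ κ.map f b) : m = n :=
  P.incl_injective (cart_ext P.proj (κ.map f b) (κ.cart f b) (P.incl_lift m) (P.incl_lift n) h)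

/-- The reindexing functor between fibres. -/
noncomputable def pull {x y : P.base} (f : x ⟶ y) : P.proj.Fiber y ⥤ P.proj.Fiber x where
  obj := κ.obj f
  map {a b} m := κ.desc f (κ.map f a ≫ P.incl.map m)
    (lift_comp P.proj (κ.map_lift f a) (P.incl_lift m) (Category.comp_id f))
  map_id a := κ.hom_ext f (by
    rw [desc_fac, CategoryTheory.Functor.map_id, CategoryTheory.Functor.map_id, Category.comp_id,
      Category.id_comp])
  map_comp {a b c} m n := κ.hom_ext f (by
    rw [desc_fac, Functor.map_comp, Functor.map_comp, Category.assoc, desc_fac,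
      ← Category.assoc (P.incl.map _), desc_fac, Category.assoc])

/-- The chosen lift of `f` at `b`. -/
def lift {x y : P.base} (f : x ⟶ y) (b : P.proj.Fiber y) :
    P.incl.obj ((κ.pull f).obj b) ⟶ P.incl.obj b :=
  κ.map f b

theorem lift_lift {x y : P.base} (f : x ⟶ y) (b : P.proj.Fiber y) :
    P.proj.IsHomLift f (κ.lift f b) :=
  κ.map_lift f b

theorem lift_cart {x y : P.base} (f : x ⟶ y) (b : P.proj.Fiber y) :
    P.proj.IsStronglyCartesian f (κ.lift f b) :=
  κ.cart f b

/-- The factorization of a lift of `f` through the chosen lift. -/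
noncomputable def ind {x y : P.base} (f : x ⟶ y) {c : P.proj.Fiber x} {b : P.proj.Fiber y}
    (φ : P.incl.obj c ⟶ P.incl.obj b) (h : P.proj.IsHomLift f φ) : c ⟶ (κ.pull f).obj b :=
  κ.desc f φ h

theorem ind_fac {x y : P.base} (f : x ⟶ y) {c : P.proj.Fiber x} {b : P.proj.Fiber y}
    (φ : P.incl.obj c ⟶ P.incl.obj b) (h : P.proj.IsHomLift f φ) :
    P.incl.map (κ.ind f φ h) ≫ κ.lift f b = φ :=
  κ.desc_fac f φ h

theorem ind_fac_assoc {x y : P.base} (f : x ⟶ y) {c : P.proj.Fiber x} {b : P.proj.Fiber y}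
    (φ : P.incl.obj c ⟶ P.incl.obj b) (h : P.proj.IsHomLift f φ) {d : P.total}
    (ψ : P.incl.obj b ⟶ d) : P.incl.map (κ.ind f φ h) ≫ κ.lift f b ≫ ψ = φ ≫ ψ := by
  rw [← Category.assoc, ind_fac]

theorem ext₁ {x y : P.base} (f : x ⟶ y) {c : P.proj.Fiber x} {b : P.proj.Fiber y}
    {m n : c ⟶ (κ.pull f).obj b} (h : P.incl.map m ≫ κ.lift f b = P.incl.map n ≫ κ.lift f b) :
    m = n :=
  κ.hom_ext f h

theorem pull_fac {x y : P.base} (f : x ⟶ y) {a b : P.proj.Fiber y} (m : a ⟶ b) :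
    P.incl.map ((κ.pull f).map m) ≫ κ.lift f b = κ.lift f a ≫ P.incl.map m :=
  κ.desc_fac f _ (lift_comp P.proj (κ.map_lift f a) (P.incl_lift m) (Category.comp_id f))

theorem pull_fac_assoc {x y : P.base} (f : x ⟶ y) {a b : P.proj.Fiber y} (m : a ⟶ b)
    {d : P.total} (ψ : P.incl.obj b ⟶ d) :
    P.incl.map ((κ.pull f).map m) ≫ κ.lift f b ≫ ψ = κ.lift f a ≫ P.incl.map m ≫ ψ := by
  rw [← Category.assoc, pull_fac, Category.assoc]

/-- Morphisms into a twofold chosen lift are determined by their composite with it. -/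
theorem ext₂ {x y z : P.base} (f : x ⟶ y) (g : y ⟶ z) {c : P.proj.Fiber x} {a : P.proj.Fiber z}
    {m n : c ⟶ (κ.pull f).obj ((κ.pull g).obj a)}
    (h : P.incl.map m ≫ κ.lift f _ ≫ κ.lift g a = P.incl.map n ≫ κ.lift f _ ≫ κ.lift g a) :
    m = n :=
  κ.ext₁ f (cart_ext P.proj (κ.lift g a) (κ.lift_cart g a)
    (lift_comp P.proj (P.incl_lift m) (κ.lift_lift f _) (Category.id_comp f))
    (lift_comp P.proj (P.incl_lift n) (κ.lift_lift f _) (Category.id_comp f))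
    (by simpa only [Category.assoc] using h))

/-- Morphisms into a threefold chosen lift are determined by their composite with it. -/
theorem ext₃ {x y z w : P.base} (f : x ⟶ y) (g : y ⟶ z) (k : z ⟶ w) {c : P.proj.Fiber x}
    {a : P.proj.Fiber w} {m n : c ⟶ (κ.pull f).obj ((κ.pull g).obj ((κ.pull k).obj a))}
    (h : P.incl.map m ≫ κ.lift f _ ≫ κ.lift g _ ≫ κ.lift k a =
      P.incl.map n ≫ κ.lift f _ ≫ κ.lift g _ ≫ κ.lift k a) : m = n :=
  κ.ext₂ f g (cart_ext P.proj (κ.lift k a) (κ.lift_cart k a)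
    (lift_comp P.proj (P.incl_lift m)
      (lift_comp P.proj (κ.lift_lift f _) (κ.lift_lift g _) rfl) (Category.id_comp (f ≫ g)))
    (lift_comp P.proj (P.incl_lift n)
      (lift_comp P.proj (κ.lift_lift f _) (κ.lift_lift g _) rfl) (Category.id_comp (f ≫ g)))
    (by simpa only [Category.assoc] using h))

/-- The isomorphism between the reindexing along an identity and the identity. -/
noncomputable def pullId (x : P.base) (a : P.proj.Fiber x) : (κ.pull (𝟙 x)).obj a ≅ a where
  hom := P.fibreHom (κ.lift (𝟙 x) a) (κ.lift_lift (𝟙 x) a)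
  inv := κ.ind (𝟙 x) (P.incl.map (𝟙 a)) (P.incl_lift (𝟙 a))
  hom_inv_id := κ.ext₁ (𝟙 x) (by simp [ind_fac, incl_fibreHom])
  inv_hom_id := P.incl_injective (by simp [ind_fac, incl_fibreHom])

theorem pullId_hom (x : P.base) (a : P.proj.Fiber x) :
    P.incl.map (κ.pullId x a).hom = κ.lift (𝟙 x) a := rfl

theorem pullId_inv_fac (x : P.base) (a : P.proj.Fiber x) :
    P.incl.map (κ.pullId x a).inv ≫ κ.lift (𝟙 x) a = 𝟙 _ :=
  (κ.ind_fac _ _ (P.incl_lift (𝟙 a))).trans (P.incl.map_id a)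

/-- The isomorphism between the reindexing along a composite and the composite reindexing. -/
noncomputable def pullComp {x y z : P.base} (f : x ⟶ y) (g : y ⟶ z) (a : P.proj.Fiber z) :
    (κ.pull (f ≫ g)).obj a ≅ (κ.pull f).obj ((κ.pull g).obj a) :=
  have h := cart_exists P.proj (κ.lift g a) (κ.lift_cart g a) (κ.lift (f ≫ g) a) rfl
    (κ.lift_lift (f ≫ g) a)
  { hom := κ.ind f h.choose h.choose_spec.1
    inv := κ.ind (f ≫ g) (κ.lift f _ ≫ κ.lift g a)
      (lift_comp P.proj (κ.lift_lift f _) (κ.lift_lift g a) rfl)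
    hom_inv_id := κ.ext₁ (f ≫ g) (by simp [ind_fac, ind_fac_assoc, h.choose_spec.2])
    inv_hom_id := κ.ext₂ f g (by simp [ind_fac, ind_fac_assoc, h.choose_spec.2]) }

theorem pullComp_inv_fac {x y z : P.base} (f : x ⟶ y) (g : y ⟶ z) (a : P.proj.Fiber z) :
    P.incl.map (κ.pullComp f g a).inv ≫ κ.lift (f ≫ g) a = κ.lift f _ ≫ κ.lift g a :=
  κ.ind_fac _ _ (lift_comp P.proj (κ.lift_lift f _) (κ.lift_lift g a) rfl)

theorem pullComp_hom_fac {x y z : P.base} (f : x ⟶ y) (g : y ⟶ z) (a : P.proj.Fiber z) :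
    P.incl.map (κ.pullComp f g a).hom ≫ κ.lift f _ ≫ κ.lift g a = κ.lift (f ≫ g) a := by
  rw [← pullComp_inv_fac, ← Functor.map_comp_assoc, Iso.hom_inv_id,
    CategoryTheory.Functor.map_id, Category.id_comp]

theorem pullComp_hom_fac_assoc {x y z : P.base} (f : x ⟶ y) (g : y ⟶ z) (a : P.proj.Fiber z)
    {d : P.total} (ψ : P.incl.obj a ⟶ d) :
    P.incl.map (κ.pullComp f g a).hom ≫ κ.lift f _ ≫ κ.lift g a ≫ ψ = κ.lift (f ≫ g) a ≫ ψ := by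
  rw [← pullComp_hom_fac, Category.assoc, Category.assoc]

theorem eqToHom_fac {x y : P.base} {f g : x ⟶ y} (h : f = g) (a : P.proj.Fiber y)
    (h' : (κ.pull f).obj a = (κ.pull g).obj a) :
    P.incl.map (eqToHom h') ≫ κ.lift g a = κ.lift f a := by
  subst h
  rw [eqToHom_refl, CategoryTheory.Functor.map_id, Category.id_comp]

theorem pullId_natural {x : P.base} {a b : P.proj.Fiber x} (m : a ⟶ b) :
    (κ.pull (𝟙 x)).map m ≫ (κ.pullId x b).hom = (κ.pullId x a).hom ≫ m :=
  P.incl_injective (by simp only [Functor.map_comp, pullId_hom, pull_fac])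

theorem pullComp_natural {x y z : P.base} (f : x ⟶ y) (g : y ⟶ z) {a b : P.proj.Fiber z}
    (m : a ⟶ b) : (κ.pull (f ≫ g)).map m ≫ (κ.pullComp f g b).hom =
      (κ.pullComp f g a).hom ≫ (κ.pull f).map ((κ.pull g).map m) :=
  κ.ext₂ f g (by simp only [Functor.map_comp, Category.assoc, pullComp_hom_fac, pull_fac,
    pull_fac_assoc, pullComp_hom_fac_assoc])

theorem id_left {x y : P.base} (k : x ⟶ y) (a : P.proj.Fiber y)
    (h : (κ.pull (𝟙 x ≫ k)).obj a = (κ.pull k).obj a) :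
    (κ.pullComp (𝟙 x) k a).hom ≫ (κ.pullId x ((κ.pull k).obj a)).hom = eqToHom h :=
  κ.ext₁ k (by simp only [Functor.map_comp, Category.assoc, pullId_hom, pullComp_hom_fac,
    κ.eqToHom_fac (Category.id_comp k)])

theorem id_right {x y : P.base} (k : x ⟶ y) (a : P.proj.Fiber y)
    (h : (κ.pull (k ≫ 𝟙 y)).obj a = (κ.pull k).obj a) :
    (κ.pullComp k (𝟙 y) a).hom ≫ (κ.pull k).map (κ.pullId y a).hom = eqToHom h :=
  κ.ext₁ k (by simp only [Functor.map_comp, Category.assoc, pull_fac, pullId_hom,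
    pullComp_hom_fac, κ.eqToHom_fac (Category.comp_id k)])

theorem assoc {x y z w : P.base} (k : x ⟶ y) (l : y ⟶ z) (m : z ⟶ w) (a : P.proj.Fiber w)
    (h : (κ.pull (k ≫ l ≫ m)).obj a = (κ.pull ((k ≫ l) ≫ m)).obj a) :
    (κ.pullComp k (l ≫ m) a).hom ≫ (κ.pull k).map (κ.pullComp l m a).hom =
      eqToHom h ≫ (κ.pullComp (k ≫ l) m a).hom ≫ (κ.pullComp k l ((κ.pull m).obj a)).hom :=
  κ.ext₃ k l m (by simp only [Functor.map_comp, Category.assoc, pull_fac_assoc, pullComp_hom_fac,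
    pullComp_hom_fac_assoc, κ.eqToHom_fac (Category.assoc k l m).symm])

/-- The indexed category `x ↦ P_x` of a fibration `P` with a cleavage: its values are the fibres,
and reindexing is along the chosen cartesian liftings. -/
noncomputable def indexed : ICat.{v, u} :=
  ICat.ofData P.base (fun x => Cat.of (P.proj.Fiber x)) κ.pull κ.pullId κ.pullComp
    κ.pullId_natural κ.pullComp_natural (fun k a => κ.id_left k a _) (fun k a => κ.id_right k a _)
    (fun k l m a => κ.assoc k l m a _)

end Cleavage
end Fib

namespace Fib

theorem cart_of_lift {C D : Type*} [Category C] [Category D] (p : C ⥤ D) {a b : C} {x y x' y' : D}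
    {φ : a ⟶ b} {f : x ⟶ y} {g : x' ⟶ y'} (h : p.IsStronglyCartesian f φ)
    (h' : p.IsHomLift g φ) : p.IsStronglyCartesian g φ := by
  have := h.toIsHomLift
  obtain ⟨⟩ := this
  obtain ⟨⟩ := h'
  exact h

theorem map_cart {P Q : Fib.{v, u}} (f : P ⟶ Q) {x y : P.base} {k : x ⟶ y} {a b : P.total}
    {φ : a ⟶ b} (h : P.proj.IsStronglyCartesian k φ) :
    Q.proj.IsStronglyCartesian (f.base.map k) (f.total.map φ) :=
  cart_of_lift Q.proj (f.cart φ (cart_of_lift P.proj h (IsHomLift.map P.proj φ)))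
    (lift_map f k φ h.toIsHomLift)

/-- The restriction of a fibred 1-cell to the fibres. -/
def restr {P Q : Fib.{v, u}} (f : P ⟶ Q) (x : P.base) :
    P.proj.Fiber x ⥤ Q.proj.Fiber (f.base.obj x) where
  obj a := ⟨f.total.obj (P.incl.obj a),
    (Functor.congr_obj f.w a.1).trans (congrArg f.base.obj a.2)⟩
  map {a b} m := Q.fibreHom (f.total.map (P.incl.map m)) (by
    rw [← f.base.map_id x]
    exact lift_map f _ _ (P.incl_lift m))
  map_id a := Q.incl_injective ((congrArg f.total.map (P.incl.map_id a)).trans (f.total.map_id _))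
  map_comp m n := Q.incl_injective
    ((congrArg f.total.map (P.incl.map_comp m n)).trans (f.total.map_comp _ _))

theorem incl_restr {P Q : Fib.{v, u}} (f : P ⟶ Q) {x : P.base} {a b : P.proj.Fiber x} (m : a ⟶ b) :
    Q.incl.map ((restr f x).map m) = f.total.map (P.incl.map m) := rfl

namespace Cleavage

variable {P Q R : Fib.{v, u}} (κ : Cleavage P) (μ : Cleavage Q) (ν : Cleavage R) (f : P ⟶ Q)

/-- The image of a chosen lift. -/
noncomputable def mapLift {x y : P.base} (k : x ⟶ y) (a : P.proj.Fiber y) :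
    Q.incl.obj ((restr f x).obj ((κ.pull k).obj a)) ⟶ Q.incl.obj ((restr f y).obj a) :=
  f.total.map (κ.lift k a)

theorem mapLift_lift {x y : P.base} (k : x ⟶ y) (a : P.proj.Fiber y) :
    Q.proj.IsHomLift (f.base.map k) (κ.mapLift f k a) :=
  lift_map f _ _ (κ.lift_lift k a)

theorem mapLift_cart {x y : P.base} (k : x ⟶ y) (a : P.proj.Fiber y) :
    Q.proj.IsStronglyCartesian (f.base.map k) (κ.mapLift f k a) :=
  map_cart f (κ.lift_cart k a)

/-- The comparison isomorphism between the image of a chosen lift and the chosen lift of the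
image. -/
noncomputable def restrNat {x y : P.base} (k : x ⟶ y) (a : P.proj.Fiber y) :
    (restr f x).obj ((κ.pull k).obj a) ≅ (μ.pull (f.base.map k)).obj ((restr f y).obj a) :=
  have h := cart_exists Q.proj (κ.mapLift f k a) (κ.mapLift_cart f k a)
    (μ.lift (f.base.map k) ((restr f y).obj a)) (Category.id_comp _).symm (μ.lift_lift _ _)
  { hom := μ.ind (f.base.map k) (κ.mapLift f k a) (κ.mapLift_lift f k a)
    inv := Q.fibreHom h.choose h.choose_spec.1
    hom_inv_id := Q.incl_injective (cart_ext Q.proj (κ.mapLift f k a) (κ.mapLift_cart f k a)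
      (Q.incl_lift _) (Q.incl_lift _)
      (by simp [incl_fibreHom, h.choose_spec.2, ind_fac]))
    inv_hom_id := μ.ext₁ _ (by simp [incl_fibreHom, h.choose_spec.2, ind_fac]) }

theorem restrNat_fac {x y : P.base} (k : x ⟶ y) (a : P.proj.Fiber y) :
    Q.incl.map (κ.restrNat μ f k a).hom ≫ μ.lift (f.base.map k) ((restr f y).obj a) =
      κ.mapLift f k a :=
  μ.ind_fac _ _ (κ.mapLift_lift f k a)

theorem restrNat_fac_assoc {x y : P.base} (k : x ⟶ y) (a : P.proj.Fiber y) {d : Q.total}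
    (ψ : Q.incl.obj ((restr f y).obj a) ⟶ d) :
    Q.incl.map (κ.restrNat μ f k a).hom ≫ μ.lift (f.base.map k) ((restr f y).obj a) ≫ ψ =
      κ.mapLift f k a ≫ ψ := by
  rw [← Category.assoc, restrNat_fac]

theorem restr_mapLift {x y : P.base} (k : x ⟶ y) {a b : P.proj.Fiber y} (m : a ⟶ b) :
    Q.incl.map ((restr f x).map ((κ.pull k).map m)) ≫ κ.mapLift f k b =
      κ.mapLift f k a ≫ Q.incl.map ((restr f y).map m) :=
  (f.total.map_comp _ _).symm.trans ((congrArg f.total.map (κ.pull_fac k m)).trans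
    (f.total.map_comp _ _))

theorem restrNat_natural {x y : P.base} (k : x ⟶ y) {a b : P.proj.Fiber y} (m : a ⟶ b) :
    (restr f x).map ((κ.pull k).map m) ≫ (κ.restrNat μ f k b).hom =
      (κ.restrNat μ f k a).hom ≫ (μ.pull (f.base.map k)).map ((restr f y).map m) :=
  μ.ext₁ _ (by simp only [Functor.map_comp, Category.assoc, restrNat_fac, pull_fac,
    restrNat_fac_assoc, restr_mapLift])

theorem restrNat_id (x : P.base) (a : P.proj.Fiber x) :
    (κ.restrNat μ f (𝟙 x) a).hom ≫ eqToHom (by rw [f.base.map_id]) ≫ (μ.pullId _ _).hom =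
      (restr f x).map (κ.pullId x a).hom :=
  Q.incl_injective (by
    simp only [Functor.map_comp, pullId_hom, μ.eqToHom_fac (f.base.map_id x),
      restrNat_fac]
    rfl)

theorem restrNat_comp {x y z : P.base} (k : x ⟶ y) (l : y ⟶ z) (a : P.proj.Fiber z) :
    (κ.restrNat μ f (k ≫ l) a).hom ≫ eqToHom (by rw [f.base.map_comp]) ≫ (μ.pullComp _ _ _).hom =
      (restr f x).map (κ.pullComp k l a).hom ≫ (κ.restrNat μ f k ((κ.pull l).obj a)).hom ≫
        (μ.pull (f.base.map k)).map (κ.restrNat μ f l a).hom :=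
  μ.ext₂ _ _ (by
    simp only [Functor.map_comp, Category.assoc, pullComp_hom_fac, pull_fac_assoc,
      μ.eqToHom_fac (f.base.map_comp k l), restrNat_fac, restrNat_fac_assoc]
    refine Eq.symm ((congrArg (_ ≫ ·) (f.total.map_comp _ _).symm).trans ?_)
    exact (f.total.map_comp _ _).symm.trans (congrArg f.total.map (κ.pullComp_hom_fac k l a)))

/-- The indexed 1-cell associated to a fibred 1-cell, given by its restrictions to the fibres. -/
noncomputable def indexedMap : κ.indexed ⟶ μ.indexed :=
  ICat.Hom.mk' f.base (restr f) (κ.restrNat μ f) (κ.restrNat_natural μ f)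
    (κ.restrNat_id μ f) (κ.restrNat_comp μ f)

/-- The object of the Grothendieck construction of the indexed category of fibres. -/
noncomputable def toTotal (p : κ.indexed.Total) : P.total := P.incl.obj p.fiber

/-- The morphism of the total category corresponding to a morphism of the Grothendieck
construction of the indexed category of fibres. -/
noncomputable def toHom {p q : κ.indexed.Total} (φ : p ⟶ q) : κ.toTotal p ⟶ κ.toTotal q :=
  P.incl.map (ICat.fib φ) ≫ κ.lift φ.base q.fiber

theorem toHom_homMk {x y : P.base} {a : P.proj.Fiber x} {b : P.proj.Fiber y} (k : x ⟶ y)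
    (m : a ⟶ (κ.pull k).obj b) :
    κ.toHom (ICat.homMk (M := κ.indexed) k m) = P.incl.map m ≫ κ.lift k b := rfl

theorem toHom_id (p : κ.indexed.Total) : κ.toHom (𝟙 p) = 𝟙 (κ.toTotal p) :=
  κ.pullId_inv_fac p.base p.fiber

theorem toHom_comp {p q r : κ.indexed.Total} (φ : p ⟶ q) (ψ : q ⟶ r) :
    κ.toHom (φ ≫ ψ) = κ.toHom φ ≫ κ.toHom ψ := by
  obtain ⟨(x : P.base), (a : P.proj.Fiber x)⟩ := p
  obtain ⟨(y : P.base), (b : P.proj.Fiber y)⟩ := q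
  obtain ⟨(z : P.base), (c : P.proj.Fiber z)⟩ := r
  obtain ⟨(k : x ⟶ y), (m : a ⟶ (κ.pull k).obj b)⟩ := φ
  obtain ⟨(l : y ⟶ z), (n : b ⟶ (κ.pull l).obj c)⟩ := ψ
  change P.incl.map (m ≫ (κ.pull k).map n ≫ (κ.pullComp k l c).inv) ≫ κ.lift (k ≫ l) c =
    (P.incl.map m ≫ κ.lift k b) ≫ P.incl.map n ≫ κ.lift l c
  simp only [Functor.map_comp, Category.assoc, pullComp_inv_fac, pull_fac_assoc]

theorem toHom_injective {p q : κ.indexed.Total} {φ ψ : p ⟶ q} (hb : φ.base = ψ.base)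
    (h : κ.toHom φ = κ.toHom ψ) : φ = ψ := by
  obtain ⟨(x : P.base), (a : P.proj.Fiber x)⟩ := p
  obtain ⟨(y : P.base), (b : P.proj.Fiber y)⟩ := q
  obtain ⟨(k : x ⟶ y), (m : a ⟶ (κ.pull k).obj b)⟩ := φ
  obtain ⟨(l : x ⟶ y), (n : a ⟶ (κ.pull l).obj b)⟩ := ψ
  obtain rfl : k = l := hb
  obtain rfl : m = n := κ.ext₁ k h
  rfl

theorem toHom_heq {p q p' q' : κ.indexed.Total} {φ : p ⟶ q} {ψ : p' ⟶ q'} (hp : p = p')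
    (hq : q = q') (hb : φ.base ≍ ψ.base) (h : κ.toHom φ ≍ κ.toHom ψ) : φ ≍ ψ := by
  subst hp hq
  exact heq_of_eq (κ.toHom_injective (eq_of_heq hb) (eq_of_heq h))

theorem toHom_total_map {p q : κ.indexed.Total} (φ : p ⟶ q) :
    μ.toHom ((ICat.Hom.total (κ.indexedMap μ f)).map φ) = f.total.map (κ.toHom φ) := by
  obtain ⟨(x : P.base), (a : P.proj.Fiber x)⟩ := p
  obtain ⟨(y : P.base), (b : P.proj.Fiber y)⟩ := q
  obtain ⟨(k : x ⟶ y), (m : a ⟶ (κ.pull k).obj b)⟩ := φ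
  change Q.incl.map ((restr f x).map m ≫ (κ.restrNat μ f k b).hom) ≫
    μ.lift (f.base.map k) ((restr f y).obj b) = f.total.map (P.incl.map m ≫ κ.lift k b)
  simp only [Functor.map_comp, Category.assoc, restrNat_fac]
  rfl

variable {f} {g : P ⟶ Q}

theorem app_lift (η : f ⟶ g) (x : P.base) (a : P.proj.Fiber x) :
    Q.proj.IsHomLift (η.base.app x) (η.total.app (P.incl.obj a)) := by
  obtain ⟨a, rfl⟩ := a
  exact η.w a

/-- The component at `(x, a)` of the indexed 2-cell associated to a fibred 2-cell. -/
noncomputable def appInd (η : f ⟶ g) (x : P.base) (a : P.proj.Fiber x) :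
    (restr f x).obj a ⟶ (μ.pull (η.base.app x)).obj ((restr g x).obj a) :=
  μ.ind (η.base.app x) (η.total.app (P.incl.obj a)) (app_lift η x a)

theorem appInd_fac (η : f ⟶ g) (x : P.base) (a : P.proj.Fiber x) :
    Q.incl.map (appInd μ η x a) ≫ μ.lift (η.base.app x) ((restr g x).obj a) =
      η.total.app (P.incl.obj a) :=
  μ.ind_fac _ _ (app_lift η x a)

/-- The indexed 2-cell associated to a fibred 2-cell. -/
noncomputable def indexedMap₂ (η : f ⟶ g) : κ.indexedMap μ f ⟶ κ.indexedMap μ g :=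
  ICat.Hom₂.mk' η.base (appInd μ η) (fun {p q} φ => by
    refine μ.toHom_injective (η.base.naturality φ.base) ?_
    refine (μ.toHom_comp _ _).trans (Eq.trans ?_ (μ.toHom_comp _ _).symm)
    refine (congrArg (· ≫ _) (κ.toHom_total_map μ f φ)).trans ?_
    refine Eq.trans ?_ (congrArg (_ ≫ ·) (κ.toHom_total_map μ g φ)).symm
    refine (congrArg (f.total.map (κ.toHom φ) ≫ ·) (μ.appInd_fac η q.base q.fiber)).trans ?_
    refine Eq.trans ?_ (congrArg (· ≫ g.total.map (κ.toHom φ))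
      (μ.appInd_fac η p.base p.fiber)).symm
    exact η.total.naturality (κ.toHom φ))

theorem toHom_totalApp (η : f ⟶ g) (p : κ.indexed.Total) :
    μ.toHom ((κ.indexedMap₂ μ η).totalApp p) = η.total.app (κ.toTotal p) :=
  μ.appInd_fac η p.base p.fiber

theorem indexedMap₂_id : κ.indexedMap₂ μ (𝟙 f) = 𝟙 (κ.indexedMap μ f) :=
  ICat.hom₂_ext (fun _ => rfl) (fun p => μ.toHom_injective rfl ((κ.toHom_totalApp μ (𝟙 f) p).trans
    (μ.toHom_id ((ICat.Hom.total (κ.indexedMap μ f)).obj p)).symm))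

theorem indexedMap₂_comp {h : P ⟶ Q} (η : f ⟶ g) (θ : g ⟶ h) :
    κ.indexedMap₂ μ (η ≫ θ) = κ.indexedMap₂ μ η ≫ κ.indexedMap₂ μ θ :=
  ICat.hom₂_ext (fun _ => rfl) (fun p => μ.toHom_injective rfl (by
    rw [ICat.totalApp_comp, toHom_comp, toHom_totalApp, toHom_totalApp, toHom_totalApp]
    rfl))

theorem indexedMap_id : κ.indexedMap κ (𝟙 P) = 𝟙 κ.indexed :=
  ICat.Hom.ext' rfl HEq.rfl fun {x y : P.base} k (a : P.proj.Fiber y) => heq_of_eq (κ.ext₁ (b := a) k (c := (κ.pull k).obj a)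
    (m := (κ.restrNat κ (𝟙 P) k a).hom) (n := 𝟙 _) (by
      rw [CategoryTheory.Functor.map_id, Category.id_comp]
      exact κ.restrNat_fac κ (𝟙 P) k a))

theorem indexedMap_comp (f : P ⟶ Q) (g : Q ⟶ R) :
    κ.indexedMap ν (f ≫ g) = κ.indexedMap μ f ≫ μ.indexedMap ν g :=
  ICat.Hom.ext' rfl HEq.rfl fun {x y : P.base} k (a : P.proj.Fiber y) => heq_of_eq (ν.ext₁ (g.base.map (f.base.map k))
    (c := (restr g _).obj ((restr f x).obj ((κ.pull k).obj a)))
    (b := (restr g _).obj ((restr f y).obj a))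
    (m := (κ.restrNat ν (f ≫ g) k a).hom)
    (n := (restr g _).map (κ.restrNat μ f k a).hom ≫
      (μ.restrNat ν g (f.base.map k) ((restr f y).obj a)).hom) (by
      rw [Functor.map_comp, Category.assoc, restrNat_fac]
      refine (κ.restrNat_fac ν (f ≫ g) k a).trans ?_
      refine (congrArg g.total.map (κ.restrNat_fac μ f k a).symm).trans ?_
      exact g.total.map_comp _ _))

end Cleavage

end Fib

namespace ICat

theorem hom₂_heq {M N : ICat.{v, u}} {f f' g g' : M ⟶ N} (hf : f = f') (hg : g = g') {η : f ⟶ g}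
    {θ : f' ⟶ g'} (hb : ∀ x, η.base.app x ≍ θ.base.app x)
    (ht : ∀ p, η.totalApp p ≍ θ.totalApp p) : η ≍ θ := by
  subst hf hg
  exact heq_of_eq (hom₂_ext (fun x => eq_of_heq (hb x)) (fun a => eq_of_heq (ht a)))

end ICat

namespace Fib

namespace Cleavage

variable {P Q R : Fib.{v, u}} (κ : Cleavage P) (μ : Cleavage Q) (ν : Cleavage R)

theorem totalApp_wL (f : P ⟶ Q) {g g' : Q ⟶ R} (η : g ⟶ g') (p : κ.indexed.Total) :
    (κ.indexedMap₂ ν (Bicategory.whiskerLeft f η)).totalApp p ≍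
      (μ.indexedMap₂ ν η).totalApp ((ICat.Hom.total (κ.indexedMap μ f)).obj p) :=
  HEq.rfl

theorem indexedMap₂_wL (f : P ⟶ Q) {g g' : Q ⟶ R} (η : g ⟶ g') :
    κ.indexedMap₂ ν (Bicategory.whiskerLeft f η) ≍
      ICat.wL (κ.indexedMap μ f) (μ.indexedMap₂ ν η) :=
  ICat.hom₂_heq (κ.indexedMap_comp μ ν f g) (κ.indexedMap_comp μ ν f g') (fun _ => HEq.rfl)
    (fun p => (κ.totalApp_wL μ ν f η p).trans (heq_of_eq (ICat.totalApp_wL _ _ p).symm))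

theorem totalApp_wR {f f' : P ⟶ Q} (η : f ⟶ f') (g : Q ⟶ R) (p : κ.indexed.Total) :
    (κ.indexedMap₂ ν (Bicategory.whiskerRight η g)).totalApp p ≍
      (ICat.Hom.total (μ.indexedMap ν g)).map ((κ.indexedMap₂ μ η).totalApp p) :=
  ν.toHom_heq rfl rfl HEq.rfl (heq_of_eq ((κ.toHom_totalApp ν _ p).trans
    ((μ.toHom_total_map ν g _).trans (congrArg g.total.map (κ.toHom_totalApp μ η p))).symm))

theorem indexedMap₂_wR {f f' : P ⟶ Q} (η : f ⟶ f') (g : Q ⟶ R) :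
    κ.indexedMap₂ ν (Bicategory.whiskerRight η g) ≍
      ICat.wR (κ.indexedMap₂ μ η) (μ.indexedMap ν g) :=
  ICat.hom₂_heq (κ.indexedMap_comp μ ν f g) (κ.indexedMap_comp μ ν f' g) (fun _ => HEq.rfl)
    (fun p => (κ.totalApp_wR μ ν η g p).trans (heq_of_eq (ICat.totalApp_wR _ _ p).symm))

end Cleavage

/-- The 2-functor from fibrations to indexed categories given by taking fibres, where reindexing
is with respect to given cleavages. -/
noncomputable def fibres (κ : ∀ P : Fib.{v, u}, Cleavage P) :
    StrictPseudofunctor Fib.{v, u} ICat.{v, u} :=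
  StrictPseudofunctor.mk''
    { obj := fun P => (κ P).indexed
      map := fun {P Q} f => (κ P).indexedMap (κ Q) f
      map₂ := fun {P Q _ _} η => (κ P).indexedMap₂ (κ Q) η
      map₂_id := fun {P Q} _ => (κ P).indexedMap₂_id (κ Q)
      map₂_comp := fun {P Q} _ _ _ η θ => (κ P).indexedMap₂_comp (κ Q) η θ
      map_id := fun P => (κ P).indexedMap_id
      map_comp := fun {P Q R} f g => (κ P).indexedMap_comp (κ Q) (κ R) f g
      map₂_whisker_left := fun {P Q R} f _ _ η => CartesianTwoCategory.eq_conj _ _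
        ((κ P).indexedMap₂_wL (κ Q) (κ R) f η)
      map₂_whisker_right := fun {P Q R _ _} η g => CartesianTwoCategory.eq_conj _ _
        ((κ P).indexedMap₂_wR (κ Q) (κ R) η g) }

end Fib

namespace Fib

namespace Cleavage

theorem ind_isIso {P : Fib.{v, u}} (κ : Cleavage P) {x y : P.base} (f : x ⟶ y)
    {c : P.proj.Fiber x} {b : P.proj.Fiber y} (φ : P.incl.obj c ⟶ P.incl.obj b)
    (hφ : P.proj.IsStronglyCartesian f φ) (h : P.proj.IsHomLift f φ) : IsIso (κ.ind f φ h) := by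
  obtain ⟨χ, h₁, h₂⟩ := cart_exists P.proj φ hφ (κ.lift f b) (Category.id_comp f).symm
    (κ.lift_lift f b)
  refine ⟨P.fibreHom χ h₁, P.incl_injective (cart_ext P.proj φ hφ (P.incl_lift _) (P.incl_lift _)
    ?_), κ.ext₁ f ?_⟩
  · simp [incl_fibreHom, h₂, ind_fac]
  · simp [incl_fibreHom, h₂, ind_fac]

/-- The canonical functor from the total category of `P` to the Grothendieck construction of the
indexed category of fibres of `P`. -/
noncomputable def ofTotal {P : Fib.{v, u}} (κ : Cleavage P) : P.total ⥤ κ.indexed.Total where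
  obj a := ⟨P.proj.obj a, (⟨a, rfl⟩ : P.proj.Fiber (P.proj.obj a))⟩
  map {a b} φ := ICat.homMk (M := κ.indexed) (P.proj.map φ)
    (κ.ind (P.proj.map φ) (c := ⟨a, rfl⟩) (b := ⟨b, rfl⟩) φ (IsHomLift.map P.proj φ))
  map_id a := κ.toHom_injective (P.proj.map_id a)
    ((κ.ind_fac (P.proj.map (𝟙 a)) (c := ⟨a, rfl⟩) (b := ⟨a, rfl⟩) (𝟙 a)
      (IsHomLift.map P.proj (𝟙 a))).trans
        (κ.toHom_id ⟨P.proj.obj a, (⟨a, rfl⟩ : P.proj.Fiber (P.proj.obj a))⟩).symm)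
  map_comp φ ψ := κ.toHom_injective (P.proj.map_comp φ ψ)
    ((κ.ind_fac _ _ (IsHomLift.map P.proj (φ ≫ ψ))).trans
      (Eq.symm ((κ.toHom_comp _ _).trans (congrArg₂ (· ≫ ·)
        (κ.ind_fac _ _ (IsHomLift.map P.proj φ)) (κ.ind_fac _ _ (IsHomLift.map P.proj ψ))))))

/-- The canonical fibred 1-cell, over the identity, from a fibration `P` to the Grothendieck
construction of its indexed category of fibres: it sends `a` to `(P a, a)`. -/
noncomputable def unitHom {P : Fib.{v, u}} (κ : Cleavage P) : P ⟶ ICat.fibration κ.indexed where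
  base := 𝟭 P.base
  total := κ.ofTotal
  w := rfl
  cart {a b} φ h :=
    have := κ.ind_isIso (P.proj.map φ) (c := ⟨a, rfl⟩) (b := ⟨b, rfl⟩) φ h
      (IsHomLift.map P.proj φ)
    @ICat.isStronglyCartesian_homMk κ.indexed _ _ _ _ (P.proj.map φ) (κ.ind (P.proj.map φ)
      (c := ⟨a, rfl⟩) (b := ⟨b, rfl⟩) φ (IsHomLift.map P.proj φ)) this

end Cleavage

end Fib

namespace ICat

open Fib.Cleavage

section
variable (M : ICat.{v, u})

theorem vert_lift {x : M.base} {a b : M.fibre x} (m : a ⟶ b) :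
    (fibration M).proj.IsHomLift (𝟙 x) (vert m) :=
  (Fib.isHomLift_iff (fibration M).proj (a := (⟨x, a⟩ : M.Total)) (b := (⟨x, b⟩ : M.Total))
    (𝟙 x) (vert m)).2 rfl

theorem cartLift_lift {x y : M.base} (k : x ⟶ y) (a : M.fibre y) :
    (fibration M).proj.IsHomLift k (cartLift k a) :=
  (Fib.isHomLift_iff (fibration M).proj (a := (⟨x, (M.pull k).obj a⟩ : M.Total))
    (b := (⟨y, a⟩ : M.Total)) k (cartLift k a)).2 rfl

/-- The functor `a ↦ (x, a)` from the value at `x` of an indexed category to the fibre over `x` of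
its Grothendieck construction. -/
def toFibre (x : M.base) : M.fibre x ⥤ (fibration M).proj.Fiber x where
  obj a := ⟨⟨x, a⟩, rfl⟩
  map m := (fibration M).fibreHom (vert m) (vert_lift M m)
  map_id a := (fibration M).incl_injective (vert_id a)
  map_comp m n := (fibration M).incl_injective (vert_comp m n).symm

variable (κ : Fib.Cleavage (fibration M))

/-- The comparison between the canonical cartesian lift and the chosen one. -/
noncomputable def toFibreNat {x y : M.base} (k : x ⟶ y) (a : M.fibre y) :
    (toFibre M x).obj ((M.pull k).obj a) ≅ (κ.pull k).obj ((toFibre M y).obj a) :=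
  have := κ.ind_isIso (c := (toFibre M x).obj ((M.pull k).obj a)) (b := (toFibre M y).obj a) k
    (cartLift k a) (isStronglyCartesian_homMk k (𝟙 _)) (cartLift_lift M k a)
  asIso (κ.ind k (cartLift k a) (cartLift_lift M k a))

theorem toFibreNat_fac {x y : M.base} (k : x ⟶ y) (a : M.fibre y) :
    (fibration M).incl.map (toFibreNat M κ k a).hom ≫ κ.lift k ((toFibre M y).obj a) =
      cartLift k a :=
  κ.ind_fac _ _ (cartLift_lift M k a)

theorem toFibreNat_natural {x y : M.base} (k : x ⟶ y) {a b : M.fibre y} (m : a ⟶ b) :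
    (toFibre M x).map ((M.pull k).map m) ≫ (toFibreNat M κ k b).hom =
      (toFibreNat M κ k a).hom ≫ (κ.pull k).map ((toFibre M y).map m) :=
  κ.ext₁ k (by
    rw [Functor.map_comp, Category.assoc, toFibreNat_fac, Functor.map_comp, Category.assoc,
      pull_fac, ← Category.assoc ((fibration M).incl.map (toFibreNat M κ k a).hom), toFibreNat_fac]
    exact (vert_comp_homMk _ k (𝟙 _)).trans ((congrArg (homMk k)
      ((Category.comp_id _).trans (Category.id_comp _).symm)).trans
        (homMk_comp_vert k (𝟙 _) m).symm))

theorem toFibreNat_id (x : M.base) (a : M.fibre x) :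
    (toFibreNat M κ (𝟙 x) a).hom ≫ (κ.pullId x ((toFibre M x).obj a)).hom =
      (toFibre M x).map (M.pullId x a).hom :=
  (fibration M).incl_injective (by
    rw [Functor.map_comp, pullId_hom, toFibreNat_fac]
    exact congrArg (homMk (𝟙 x)) (Iso.hom_inv_id _).symm)

theorem assoc₄ {C : Type*} [Category C] {a b c d e : C} (f : a ⟶ b) (g : b ⟶ c) (h : c ⟶ d)
    (i : d ⟶ e) : (f ≫ g ≫ h) ≫ i = f ≫ g ≫ h ≫ i := by
  simp

theorem toFibreNat_comp {x y z : M.base} (k : x ⟶ y) (l : y ⟶ z) (a : M.fibre z) :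
    (toFibreNat M κ (k ≫ l) a).hom ≫ (κ.pullComp k l ((toFibre M z).obj a)).hom =
      (toFibre M x).map (M.pullComp k l a).hom ≫ (toFibreNat M κ k ((M.pull l).obj a)).hom ≫
        (κ.pull k).map (toFibreNat M κ l a).hom :=
  κ.ext₂ k l (by
    refine (congrArg (· ≫ _) ((fibration M).incl.map_comp _ _)).trans ((Category.assoc _ _ _).trans
      ((congrArg (_ ≫ ·) (κ.pullComp_hom_fac k l _)).trans
        ((toFibreNat_fac M κ (k ≫ l) a).trans (Eq.symm ?_))))
    refine (congrArg (· ≫ _) (((fibration M).incl.map_comp _ _).trans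
      (congrArg (_ ≫ ·) ((fibration M).incl.map_comp _ _)))).trans ((assoc₄ _ _ _ _).trans ?_)
    refine (congrArg (fun t => _ ≫ _ ≫ t) ((κ.pull_fac_assoc k (toFibreNat M κ l a).hom _).trans
      (congrArg (_ ≫ ·) (toFibreNat_fac M κ l a)))).trans ?_
    refine (congrArg (_ ≫ ·) ((Category.assoc _ _ _).symm.trans (congrArg (· ≫ cartLift l a)
      (toFibreNat_fac M κ k ((M.pull l).obj a))))).trans ?_
    refine (congrArg (_ ≫ ·) (homMk_comp k (𝟙 _) l (𝟙 _))).trans ?_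
    refine (vert_comp_homMk _ (k ≫ l) _).trans (congrArg (homMk (k ≫ l)) ?_)
    simp)

/-- The canonical indexed 1-cell, over the identity, from an indexed category `M` to the indexed
category of fibres of its Grothendieck construction: it sends `a` in `M x` to `(x, a)`. -/
noncomputable def counitInv : M ⟶ κ.indexed :=
  Hom.mk' (𝟭 M.base) (toFibre M) (toFibreNat M κ) (toFibreNat_natural M κ)
    (fun x a => (congrArg (_ ≫ ·) (Category.id_comp _)).trans (toFibreNat_id M κ x a))
    (fun k l a => (congrArg (_ ≫ ·) (Category.id_comp _)).trans (toFibreNat_comp M κ k l a))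

end

end ICat

/-! The theorem separates into a strict 2-equivalence, which uses fibrations, and its monoidality,
which is formal.

Monoidality. Both monoidal structures are cartesian. The two 2-natural isomorphisms make the
underlying 1-functors an equivalence of categories, so both functors preserve finite products. A
product-preserving functor between cartesian monoidal categories is canonically braided, and every
natural transformation between such functors is monoidal. Only the 2-naturality of the laxator
remains. It holds because a 2-cell into a product is determined by its two projections, and the
inverse of the laxator turns these projections into images under the functor of projections
(`CartesianTwoCategory.μ_naturality₂`, `SymmetricMonoidalTwoEquivalence.ofCartesian`).

The unit. An object of the fibre over `x` is an object `a` with `P a = x` on the nose, so the pairs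
`(x, a)` are just the objects of the total category. A morphism `(k, m)` corresponds to the vertical
`m` followed by the chosen lift of `k`, and conversely every morphism factors uniquely in this way
through the chosen lift of its image. Hence `unitHom` has a strict inverse `unitInv`, with no
normality or splitting of the cleavage. Naturality is checked for `unitInv`, where it says that
restricting a fibred cell to fibres and reassembling it gives the cell back (`toHom_total_map`,
`toHom_totalApp`).

The counit. Each functor `toFibre M x` is fully faithful and bijective on objects, hence a strict
isomorphism of categories. A pseudonatural transformation whose components are isomorphisms is
itself invertible: the structure isomorphisms of the inverse are the mates of the given ones
(`isIso_of_pointwise`). Naturality of `counitInv` holds since both sides of each equation have the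
same composite with a chosen cartesian lift, and such a composite determines a morphism into the
chosen pullback.

Many equal 1-cells here are not definitionally equal. Equations between the 2-cells on them are
therefore handled as heterogeneous equalities and turned into `eqToHom` conjugations only at the
end, by `eq_conj`. -/

section StrictTwoCategories
universe w₁ v₁ u₁ w₂ v₂ u₂

/-! ### Whiskering with identities and isomorphisms in a strict 2-category -/

namespace CartesianTwoCategory

section
variable {K : Type u₁} [Bicategory.{w₁, v₁} K] [Bicategory.Strict K]

/-- In a strict 2-category the unitors are `eqToIso`s, so the conjugation in `whiskerRight_id` is
invisible to heterogeneous equality. The 1-cell `k` is only propositionally an identity so that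
composites such as `e.hom ≫ e.inv` are covered. -/
theorem whiskerRight_id_heq {a b : K} {f g : a ⟶ b} (η : f ⟶ g) {k : b ⟶ b} (h : k = 𝟙 b) :
    Bicategory.whiskerRight η k ≍ η := by
  subst h
  rw [Bicategory.whiskerRight_id, Bicategory.Strict.rightUnitor_eqToIso,
    Bicategory.Strict.rightUnitor_eqToIso]
  exact conj_heq (Category.comp_id _) (Category.comp_id _).symm _

theorem whiskerLeft_id_heq {a b : K} {f g : a ⟶ b} (η : f ⟶ g) {k : a ⟶ a} (h : k = 𝟙 a) :
    Bicategory.whiskerLeft k η ≍ η := by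
  subst h
  rw [Bicategory.id_whiskerLeft, Bicategory.Strict.leftUnitor_eqToIso,
    Bicategory.Strict.leftUnitor_eqToIso]
  exact conj_heq (Category.id_comp _) (Category.id_comp _).symm _

/-- Whiskering with `e.inv` undoes whiskering with `e.hom`. This is what allows isomorphisms to be
cancelled in equations between 2-cells. -/
theorem whiskerRight_iso_heq {a b : K} {f g : a ⟶ b} (η : f ⟶ g) {c : K} (e : b ≅ c) :
    Bicategory.whiskerRight (Bicategory.whiskerRight η e.hom) e.inv ≍ η :=
  (whiskerRight_comp_heq η e.hom e.inv).symm.trans (whiskerRight_id_heq η e.hom_inv_id)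

/-- Whiskering with an isomorphism of 1-cells is injective. -/
theorem heq_of_whiskerRight_iso {a b c : K} (e : b ≅ c) {f g f' g' : a ⟶ b} (hf : f = f')
    (hg : g = g') {η : f ⟶ g} {θ : f' ⟶ g'}
    (h : Bicategory.whiskerRight η e.hom ≍ Bicategory.whiskerRight θ e.hom) : η ≍ θ :=
  (whiskerRight_iso_heq η e).symm.trans ((whiskerRight_heq (congrArg (· ≫ e.hom) hf)
    (congrArg (· ≫ e.hom) hg) h e.inv).trans (whiskerRight_iso_heq θ e))

end

end CartesianTwoCategory

/-! ### Strict 2-functors and whiskering -/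

namespace CategoryTheory.StrictPseudofunctor

open CartesianTwoCategory

variable {K : Type u₁} [Bicategory.{w₁, v₁} K] [Bicategory.Strict K]
  {L : Type u₂} [Bicategory.{w₂, v₂} L]

theorem map₂_heq (F : StrictPseudofunctor K L) {a b : K} {f f' g g' : a ⟶ b} (hf : f = f')
    (hg : g = g') {η : f ⟶ g} {θ : f' ⟶ g'} (h : η ≍ θ) : F.map₂ η ≍ F.map₂ θ := by
  subst hf hg; cases h; rfl

/-- The compositor of a strict 2-functor is an `eqToIso`, so the conjugation by it in the
pseudofunctor axiom disappears. -/
theorem map₂_whiskerLeft_heq (F : StrictPseudofunctor K L) {a b c : K} (f : a ⟶ b)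
    {g g' : b ⟶ c} (η : g ⟶ g') :
    F.map₂ (Bicategory.whiskerLeft f η) ≍ Bicategory.whiskerLeft (F.map f) (F.map₂ η) := by
  rw [F.map₂_whisker_left, F.mapComp_eq_eqToIso, F.mapComp_eq_eqToIso]
  exact conj_heq (F.map_comp _ _) (F.map_comp _ _).symm _

theorem map₂_whiskerRight_heq (F : StrictPseudofunctor K L) {a b c : K} {f f' : a ⟶ b}
    (η : f ⟶ f') (g : b ⟶ c) :
    F.map₂ (Bicategory.whiskerRight η g) ≍ Bicategory.whiskerRight (F.map₂ η) (F.map g) := by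
  rw [F.map₂_whisker_right, F.mapComp_eq_eqToIso, F.mapComp_eq_eqToIso]
  exact conj_heq (F.map_comp _ _) (F.map_comp _ _).symm _

theorem map_naturality (F : StrictPseudofunctor K L) {a b c d : K} {f : a ⟶ b} {p : b ⟶ c}
    {q : a ⟶ d} {k : d ⟶ c} (h : f ≫ p = q ≫ k) :
    F.map f ≫ F.map p = F.map q ≫ F.map k := by
  rw [← F.map_comp, h, F.map_comp]

/-- A strict 2-functor preserves 2-naturality squares. -/
theorem map₂_naturality_heq (F : StrictPseudofunctor K L) {a b c d : K} {f f' : a ⟶ b}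
    {p : b ⟶ c} {q : a ⟶ d} {k k' : d ⟶ c} (h : f ≫ p = q ≫ k) (h' : f' ≫ p = q ≫ k')
    {η : f ⟶ f'} {θ : k ⟶ k'}
    (w : Bicategory.whiskerRight η p ≍ Bicategory.whiskerLeft q θ) :
    Bicategory.whiskerRight (F.map₂ η) (F.map p) ≍
      Bicategory.whiskerLeft (F.map q) (F.map₂ θ) :=
  (F.map₂_whiskerRight_heq η p).symm.trans
    ((F.map₂_heq h h' w).trans (F.map₂_whiskerLeft_heq q θ))

end CategoryTheory.StrictPseudofunctor

/-! ### 2-natural isomorphisms from the naturality of their inverses -/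

namespace TwoNatIso

open CartesianTwoCategory

variable {K : Type u₁} [Bicategory.{w₁, v₁} K] [Bicategory.Strict K]
  {L : Type u₂} [Bicategory.{w₂, v₂} L] [Bicategory.Strict L]
  {F G : StrictPseudofunctor K L}

/-- The square for `e.hom` is obtained from the square for `e.inv` by composing with the components
of `e` on both sides. It is stated this way round because the convenient data here are inverse
components: those of the unit are definitionally natural on objects, and those of the counit are the
canonical 1-cells `M → M_{∫M}`. -/
theorem naturality₂_of_inv (e : F.toFunctor ≅ G.toFunctor)
    (h : ∀ {A B : K} {f g : A ⟶ B} (η : f ⟶ g),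
      Bicategory.whiskerRight (G.map₂ η) (e.inv.app B) ≍
        Bicategory.whiskerLeft (e.inv.app A) (F.map₂ η))
    {A B : K} {f g : A ⟶ B} (η : f ⟶ g) :
    Bicategory.whiskerRight (F.map₂ η) (e.hom.app B) ≍
      Bicategory.whiskerLeft (e.hom.app A) (G.map₂ η) := by
  -- It suffices to compare after whiskering with `e.inv.app B`. The left-hand side then collapses
  -- to `F.map₂ η`.
  refine heq_of_whiskerRight_iso (e.app B).symm (e.hom.naturality f) (e.hom.naturality g) ?_
  refine (whiskerRight_iso_heq (F.map₂ η) (e.app B)).trans ?_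
  refine HEq.trans ?_ (whisker_assoc_heq _ _ _).symm
  -- Under `e.hom.app A`, the hypothesis moves `e.inv` from the right of `G.map₂ η` to the left of
  -- `F.map₂ η`. There it meets `e.hom.app A` and cancels.
  refine HEq.trans ?_ (whiskerLeft_heq (e.inv.naturality f).symm (e.inv.naturality g).symm
    (h η).symm (e.hom.app A))
  refine HEq.trans ?_ (comp_whiskerLeft_heq _ _ _)
  exact (whiskerLeft_id_heq _ (e.hom_inv_id_app A)).symm

/-- A 2-natural isomorphism `F ≅ G` from a family of isomorphisms whose inverses are natural with
respect to 1-cells and 2-cells. -/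
def ofInv (e : ∀ A, F.obj A ≅ G.obj A)
    (nat : ∀ {A B : K} (f : A ⟶ B), G.map f ≫ (e B).inv = (e A).inv ≫ F.map f)
    (nat₂ : ∀ {A B : K} {f g : A ⟶ B} (η : f ⟶ g),
      Bicategory.whiskerRight (G.map₂ η) (e B).inv ≍
        Bicategory.whiskerLeft (e A).inv (F.map₂ η)) : TwoNatIso F G where
  -- Two inversions: the components are reversed and the resulting natural isomorphism is reversed
  -- again. The components of the final `iso.hom` and `iso.inv` thus reduce definitionally to those
  -- of `e`.
  iso := (NatIso.ofComponents (F := G.toFunctor) (G := F.toFunctor) (fun A => (e A).symm)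
    (fun f => nat f)).symm
  naturality₂ η := eq_conj _ _ (naturality₂_of_inv _ nat₂ η)

end TwoNatIso

/-! ### Monoidality from finite 2-products -/

section Cartesian

open CartesianTwoCategory

variable {K : Type u₁} [Bicategory.{w₁, v₁} K] [Bicategory.Strict K]
    [CartesianMonoidalCategory K] [CartesianTwoCategory K]
  {L : Type u₂} [Bicategory.{w₂, v₂} L] [Bicategory.Strict L]
    [CartesianMonoidalCategory L] [CartesianTwoCategory L]

/-- A strong monoidal structure between cartesian monoidal categories satisfies `μ ≫ F fst = fst`
and `μ ≫ F snd = snd`. After cancelling `μ` at the target and projecting, both sides become the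
whiskering of `F.map₂ η` (respectively `F.map₂ θ`) with a projection. No 2-dimensional property of
`F` is needed beyond being a 2-functor. -/
theorem CartesianTwoCategory.μ_naturality₂ (F : StrictPseudofunctor K L) [F.toFunctor.Monoidal]
    {A A' B B' : K} {f f' : A ⟶ A'} {g g' : B ⟶ B'} (η : f ⟶ f') (θ : g ⟶ g') :
    Bicategory.whiskerRight (tensorHom₂ (F.map₂ η) (F.map₂ θ))
        (Functor.LaxMonoidal.μ F.toFunctor A' B') ≍
      Bicategory.whiskerLeft (Functor.LaxMonoidal.μ F.toFunctor A B)
        (F.map₂ (tensorHom₂ η θ)) := by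
  have hf := Functor.LaxMonoidal.μ_natural F.toFunctor f g
  have hf' := Functor.LaxMonoidal.μ_natural F.toFunctor f' g'
  -- `e.hom` is the oplaxator `δ`. Whiskering with it moves the equation from `F (A' ⊗ B')`, where
  -- 2-cells are not known to be determined by projections, to the product `F A' ⊗ F B'`, where they
  -- are.
  let e : F.obj (A' ⊗ B') ≅ F.obj A' ⊗ F.obj B' := (Functor.Monoidal.μIso F.toFunctor A' B').symm
  have e₁ : e.hom ≫ fst _ _ = F.map (fst A' B') := Functor.OplaxMonoidal.δ_fst F.toFunctor A' B'
  have e₂ : e.hom ≫ snd _ _ = F.map (snd A' B') := Functor.OplaxMonoidal.δ_snd F.toFunctor A' B'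
  refine heq_of_whiskerRight_iso e hf hf' (hext₂ (congrArg (· ≫ e.hom) hf)
    (congrArg (· ≫ e.hom) hf') ?_ ?_)
  · refine (whiskerRight_comp_heq _ _ _).symm.trans (HEq.trans ?_ (whiskerRight_comp_heq _ _ _))
    refine (whiskerRight_heq' _ e₁).trans (HEq.trans ?_ (whiskerRight_heq' _ e₁.symm))
    refine (whiskerRight_comp_heq _ _ _).symm.trans (HEq.trans ?_ (whisker_assoc_heq _ _ _).symm)
    -- On the left, `μ ≫ F fst` is the projection `fst`, so `tensorHom₂_fst` computes the side
    -- completely.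
    refine (whiskerRight_heq' _ (Functor.Monoidal.μ_fst F.toFunctor A' B')).trans ?_
    refine (tensorHom₂_fst _ _).trans ?_
    -- On the right, `F` is applied to the defining square of `tensorHom₂ η θ`. This leaves `F.map₂
    -- η` whiskered by `μ ≫ F fst`, which is again `fst`.
    refine HEq.trans ?_ (whiskerLeft_heq (F.map_naturality (tensorHom_fst f g)).symm
      (F.map_naturality (tensorHom_fst f' g')).symm
      (F.map₂_naturality_heq (tensorHom_fst f g) (tensorHom_fst f' g')
        (tensorHom₂_fst η θ)).symm _)
    refine HEq.trans ?_ (comp_whiskerLeft_heq _ _ _)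
    exact whiskerLeft_heq' _ (Functor.Monoidal.μ_fst F.toFunctor A B).symm
  · refine (whiskerRight_comp_heq _ _ _).symm.trans (HEq.trans ?_ (whiskerRight_comp_heq _ _ _))
    refine (whiskerRight_heq' _ e₂).trans (HEq.trans ?_ (whiskerRight_heq' _ e₂.symm))
    refine (whiskerRight_comp_heq _ _ _).symm.trans (HEq.trans ?_ (whisker_assoc_heq _ _ _).symm)
    refine (whiskerRight_heq' _ (Functor.Monoidal.μ_snd F.toFunctor A' B')).trans ?_
    refine (tensorHom₂_snd _ _).trans ?_
    refine HEq.trans ?_ (whiskerLeft_heq (F.map_naturality (tensorHom_snd f g)).symm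
      (F.map_naturality (tensorHom_snd f' g')).symm
      (F.map₂_naturality_heq (tensorHom_snd f g) (tensorHom_snd f' g')
        (tensorHom₂_snd η θ)).symm _)
    refine HEq.trans ?_ (comp_whiskerLeft_heq _ _ _)
    exact whiskerLeft_heq' _ (Functor.Monoidal.μ_snd F.toFunctor A B).symm

variable [BraidedCategory K] [BraidedCategory L]

/-- A strict 2-functor between 2-categories with finite 2-products whose underlying functor
preserves finite products is symmetric monoidal. -/
@[reducible]
noncomputable def LaxSymmetricMonoidalTwoFunctor.ofPreservesFiniteProducts
    (F : StrictPseudofunctor K L) [Limits.PreservesFiniteProducts F.toFunctor] :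
    LaxSymmetricMonoidalTwoFunctor F :=
  letI : F.toFunctor.Braided := .ofChosenFiniteProducts _
  { toLaxBraided := inferInstance
    μ_naturality₂ := fun η θ => eq_conj _ _ (CartesianTwoCategory.μ_naturality₂ F η θ) }

/-- An equivalence of 2-categories with finite 2-products is a symmetric monoidal
2-equivalence. -/
noncomputable def SymmetricMonoidalTwoEquivalence.ofCartesian (F : StrictPseudofunctor K L)
    (G : StrictPseudofunctor L K) (unit : TwoNatIso (StrictPseudofunctor.id K) (F.comp G))
    (counit : TwoNatIso (G.comp F) (StrictPseudofunctor.id L)) :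
    SymmetricMonoidalTwoEquivalence F G :=
  -- Only the equivalence of underlying categories is used: it makes both functors preserve finite
  -- limits, in particular finite products. `Equivalence.mk` may replace one of the given
  -- isomorphisms to obtain the triangle identities. This is harmless, since `e` serves only to
  -- prove that the functors are equivalences and the fields below use the original `unit` and
  -- `counit`.
  let e : K ≌ L := CategoryTheory.Equivalence.mk F.toFunctor G.toFunctor unit.iso counit.iso
  haveI : F.toFunctor.IsEquivalence := e.isEquivalence_functor
  haveI : G.toFunctor.IsEquivalence := e.isEquivalence_inverse
  -- This is the same structure as in `LaxSymmetricMonoidalTwoFunctor.ofPreservesFiniteProducts`, so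
  -- the monoidality fields refer to the laxators of `laxF` and `laxG`.
  letI : F.toFunctor.Braided := .ofChosenFiniteProducts _
  letI : G.toFunctor.Braided := .ofChosenFiniteProducts _
  { laxF := .ofPreservesFiniteProducts F
    laxG := .ofPreservesFiniteProducts G
    unit := unit
    counit := counit
    -- Compatibility with unit and tensor comes for free: maps into the terminal object and into
    -- products are determined by projections, and a natural transformation commutes with those.
    unit_isMonoidal := NatTrans.IsMonoidal.of_cartesianMonoidalCategory (𝟭 K)
      (F.toFunctor ⋙ G.toFunctor) unit.iso.hom
    counit_isMonoidal := NatTrans.IsMonoidal.of_cartesianMonoidalCategory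
      (G.toFunctor ⋙ F.toFunctor) (𝟭 L) counit.iso.hom }

end Cartesian

end StrictTwoCategories

/-! ### The unit: a fibration is recovered from its fibres -/

namespace Fib

theorem map_heq_of_isHomLift {C D : Type*} [Category C] [Category D] {p : C ⥤ D} {x y : D}
    {a b : C} {f : x ⟶ y} {φ : a ⟶ b} (h : p.IsHomLift f φ) : p.map φ ≍ f := by
  obtain ⟨⟩ := h
  rfl

namespace Cleavage

variable {P Q : Fib.{v, u}} (κ : Cleavage P) (μ : Cleavage Q)

theorem toHom_lift {p q : κ.indexed.Total} (φ : p ⟶ q) :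
    P.proj.IsHomLift (φ.base : (p.base : P.base) ⟶ q.base) (κ.toHom φ) :=
  lift_comp P.proj (P.incl_lift _) (κ.lift_lift φ.base q.fiber) (Category.id_comp _)

/-- `ofTotal` factors `φ` through the chosen lift of its image and `toHom` composes the factor with
that lift again. This is one half of the correspondence between morphisms of `P.total` and of the
Grothendieck construction. -/
theorem toHom_unit_map {a b : P.total} (φ : a ⟶ b) :
    κ.toHom (κ.ofTotal.map φ) = φ :=
  κ.ind_fac (P.proj.map φ) (c := ⟨a, rfl⟩) (b := ⟨b, rfl⟩) φ (IsHomLift.map P.proj φ)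

/-- The functor from the Grothendieck construction of the indexed category of fibres of `P` to the
total category of `P`. -/
noncomputable def toTotalFunctor : κ.indexed.Total ⥤ P.total where
  obj p := κ.toTotal p
  map φ := κ.toHom φ
  map_id p := κ.toHom_id p
  map_comp φ ψ := κ.toHom_comp φ ψ

/-- Cartesian morphisms of a Grothendieck construction are those with invertible fibre component.
Such a morphism is sent to a vertical isomorphism followed by a chosen lift, a composite of
cartesian morphisms. -/
theorem toHom_cart {p q : κ.indexed.Total} (φ : p ⟶ q)
    (h : (ICat.fibration κ.indexed).IsCart φ) : P.IsCart (κ.toHom φ) := by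
  obtain ⟨(x : P.base), (a : P.proj.Fiber x)⟩ := p
  obtain ⟨(y : P.base), (b : P.proj.Fiber y)⟩ := q
  obtain ⟨(k : x ⟶ y), (m : a ⟶ (κ.pull k).obj b)⟩ := φ
  have hm : IsIso m := ICat.isIso_of_isStronglyCartesian_homMk (M := κ.indexed) k m h
  have h₁ : P.proj.IsStronglyCartesian (𝟙 x) (P.incl.map m) :=
    have := P.incl_lift m
    Functor.IsStronglyCartesian.of_isIso P.proj (𝟙 x) (P.incl.map m)
  have h₂ := κ.lift_cart k b
  have h₃ : P.proj.IsStronglyCartesian (𝟙 x ≫ k) (P.incl.map m ≫ κ.lift k b) := inferInstance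
  -- `h₃` holds over `𝟙 x ≫ k`, whereas `IsCart` refers to the literal image under `P.proj`. A
  -- morphism is cartesian over any base morphism that it lifts once it is so over one.
  exact cart_of_lift P.proj h₃ (IsHomLift.map P.proj _)

/-- The inverse of `unitHom`. -/
noncomputable def unitInv : ICat.fibration κ.indexed ⟶ P where
  base := 𝟭 P.base
  total := κ.toTotalFunctor
  -- On objects the equation `P a = x` is the proof stored in an object of the fibre. It is only
  -- propositional, hence the heterogeneous comparison on morphisms.
  w := Functor.hext (fun p => p.fiber.2) fun _ _ φ =>
    map_heq_of_isHomLift (p := P.proj) (κ.toHom_lift φ)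
  cart φ h := κ.toHom_cart φ h

theorem unitHom_unitInv : κ.unitHom ≫ κ.unitInv = 𝟙 P :=
  Fib.hom_ext rfl (Functor.hext (fun _ => rfl) fun _ _ φ => heq_of_eq (κ.toHom_unit_map φ))

/-- Here the strictness of fibres is essential: eliminating the equation `P a = x` makes `(x, a)`
literally `(P a, a)`. This is why the unit is an isomorphism and not merely an equivalence. -/
theorem ofTotal_toTotal (p : κ.indexed.Total) : κ.ofTotal.obj (κ.toTotal p) = p := by
  obtain ⟨(x : P.base), (a : P.proj.Fiber x)⟩ := p
  obtain ⟨a, rfl⟩ := a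
  rfl

/-- A morphism of the Grothendieck construction is determined by its base component and its image
under `toHom`. Both are preserved by the round trip, the second by `toHom_unit_map`. -/
theorem unitInv_unitHom : κ.unitInv ≫ κ.unitHom = 𝟙 (ICat.fibration κ.indexed) :=
  Fib.hom_ext rfl (Functor.hext κ.ofTotal_toTotal fun p q φ =>
    κ.toHom_heq (κ.ofTotal_toTotal p) (κ.ofTotal_toTotal q)
      (map_heq_of_isHomLift (p := P.proj) (κ.toHom_lift φ)) (heq_of_eq (κ.toHom_unit_map (κ.toHom φ))))

/-- The fibred 1-cell `unitHom` as an isomorphism. -/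
noncomputable def unitIso : P ≅ ICat.fibration κ.indexed where
  hom := κ.unitHom
  inv := κ.unitInv
  hom_inv_id := κ.unitHom_unitInv
  inv_hom_id := κ.unitInv_unitHom

/-- Working with `unitInv` makes the object part definitional. On morphisms, `f` sends the chosen
lift of `P` to a lift that need not be the chosen one of `Q`, and the comparison `restrNat` built
into `indexedMap` compensates exactly for that. -/
theorem unitInv_naturality (f : P ⟶ Q) :
    ICat.fibrationMap (κ.indexedMap μ f) ≫ μ.unitInv = κ.unitInv ≫ f :=
  Fib.hom_ext rfl (Functor.hext (fun _ => rfl) fun _ _ φ => heq_of_eq (κ.toHom_total_map μ f φ))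

/-- The indexed 2-cell consists of the factorizations of the components of `η` through chosen lifts.
`unitInv` composes each factor with its lift and so returns the component. -/
theorem unitInv_naturality₂ {f g : P ⟶ Q} (η : f ⟶ g) :
    Bicategory.whiskerRight (ICat.fibrationMap₂ (κ.indexedMap₂ μ η)) μ.unitInv ≍
      Bicategory.whiskerLeft κ.unitInv η :=
  hom₂_heq (κ.unitInv_naturality μ f) (κ.unitInv_naturality μ g) (fun _ => HEq.rfl)
    fun p => heq_of_eq (κ.toHom_totalApp μ η p)

end Cleavage

/-- The 2-natural isomorphism `1 ≅ ∫ ∘ M₍₋₎`. -/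
noncomputable def unit (κ : ∀ P : Fib.{v, u}, Cleavage P) :
    TwoNatIso (StrictPseudofunctor.id Fib.{v, u}) ((fibres κ).comp ICat.grothendieck) :=
  .ofInv (fun P => (κ P).unitIso) (fun {P Q} f => (κ P).unitInv_naturality (κ Q) f)
    (fun {P Q _ _} η => (κ P).unitInv_naturality₂ (κ Q) η)

end Fib

/-! ### Strict inverses of functors -/

namespace ICat

/-- An equivalence would not suffice: invertibility of `counitInv` in the 1-category of indexed
categories requires equalities of functors, which bijectivity on objects provides. -/
theorem exists_strict_inverse {C D : Type*} [Category C] [Category D] (F : C ⥤ D) [F.Full]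
    [F.Faithful] (h : Function.Bijective F.obj) :
    ∃ G : D ⥤ C, F ⋙ G = 𝟭 C ∧ G ⋙ F = 𝟭 D := by
  obtain ⟨g, hl, hr⟩ := Function.bijective_iff_has_inverse.1 h
  let G : D ⥤ C :=
    { obj := g
      -- `F (g a) = a` holds only propositionally, so `m` is transported along `hr` before fullness
      -- applies. Faithfulness of `F` then yields functoriality and the inverse laws.
      map := fun {a b} m => F.preimage (eqToHom (hr a) ≫ m ≫ eqToHom (hr b).symm)
      map_id := fun a => F.map_injective (by simp)
      map_comp := fun m n => F.map_injective (by simp) }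
  refine ⟨G, CategoryTheory.Functor.ext hl fun a b m => F.map_injective ?_,
    CategoryTheory.Functor.ext hr fun a b m => ?_⟩
  · simp [G, eqToHom_map]
  · simp [G]

section StrictInverse
variable {C D : Type*} [Category C] [Category D] {F : C ⥤ D} {G : D ⥤ C}

theorem map_injective_of_comp_eq_id (h : F ⋙ G = 𝟭 C) {a b : C} {u w : a ⟶ b}
    (e : F.map u = F.map w) : u = w := by
  have hu := Functor.congr_hom h u
  have hw := Functor.congr_hom h w
  -- By `h`, `(F ⋙ G).map` is conjugation by `eqToHom`s, which can be cancelled. So `F` is faithful.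
  have : (F ⋙ G).map u = (F ⋙ G).map w := congrArg G.map e
  rw [hu, hw] at this
  rwa [cancel_epi, cancel_mono] at this

/-- The component at `a` of an equality `F ⋙ G = 𝟭`. -/
def idIso (h : F ⋙ G = 𝟭 C) (a : C) : G.obj (F.obj a) ≅ a :=
  eqToIso (Functor.congr_obj h a)

theorem idIso_natural (h : F ⋙ G = 𝟭 C) {a b : C} (m : a ⟶ b) :
    G.map (F.map m) ≫ (idIso h b).hom = (idIso h a).hom ≫ m := by
  have := Functor.congr_hom h m
  simp only [Functor.comp_map] at this
  rw [this]
  simp [idIso]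

/-- These are the triangle identities of a strict inverse, seen as an adjoint equivalence with unit
and counit `idIso`. They hold automatically, since both sides are `eqToHom`s with the same
endpoints. -/
theorem map_idIso (h₁ : F ⋙ G = 𝟭 C) (h₂ : G ⋙ F = 𝟭 D) (a : C) :
    F.map (idIso h₁ a).hom = (idIso h₂ (F.obj a)).hom := by
  simp [idIso, eqToHom_map]

theorem map_idIso_inv (h₁ : F ⋙ G = 𝟭 C) (h₂ : G ⋙ F = 𝟭 D) (a : C) :
    F.map (idIso h₁ a).inv = (idIso h₂ (F.obj a)).inv := by
  simp [idIso, eqToHom_map]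

theorem idIso_inv_natural (h : F ⋙ G = 𝟭 C) {a b : C} (m : a ⟶ b) :
    (idIso h a).inv ≫ G.map (F.map m) = m ≫ (idIso h b).inv := by
  rw [Iso.inv_comp_eq, ← Category.assoc, Iso.eq_comp_inv, idIso_natural]

/-- This is the shape taken by the structure isomorphism of the composite of an indexed 1-cell with
its inverse; `k` plays the role of a reindexing functor. Being an `eqToHom`, it is heterogeneously
an identity, as the identity 1-cell demands. -/
theorem idIso_comp_map_heq_id {E : Type*} [Category E] (h : F ⋙ G = 𝟭 C) {E' : Type*}
    [Category E'] {F' : E ⥤ E'} {G' : E' ⥤ E} (h' : F' ⋙ G' = 𝟭 E) (k : E ⥤ C) (a : E) :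
    (idIso h (k.obj a)).hom ≫ k.map (idIso h' a).inv ≍ 𝟙 (k.obj a) := by
  have e : (idIso h (k.obj a)).hom ≫ k.map (idIso h' a).inv =
      eqToHom ((Functor.congr_obj h (k.obj a)).trans
        (congrArg k.obj (Functor.congr_obj h' a)).symm) := by
    simp [idIso, eqToHom_map]
  rw [e]
  refine (eqToHom_heq_id_cod _ _ _).trans ?_
  -- The comparison so far is with the identity of the codomain, which contains `G' (F' a)` in place
  -- of `a`.
  have e' : (F' ⋙ G').obj a = a := Functor.congr_obj h' a
  rw [e']

end StrictInverse

/-! ### Pointwise invertible indexed 1-cells -/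

section Pointwise
variable {X : Type u} [Category.{v} X] {A B : Pseudofunctor (LocallyDiscrete Xᵒᵖ) Cat.{v, u}}

/-- An indexed 1-cell over an identity functor. -/
abbrev overId (t : Pseudofunctor.StrongTrans A (reindex (𝟭 X) B)) : ICat.mk X A ⟶ ICat.mk X B :=
  ⟨𝟭 X, t⟩

variable (t : Pseudofunctor.StrongTrans A (reindex (𝟭 X) B))

/-- The component at `x` of an indexed 1-cell over an identity functor. -/
abbrev overApp (x : X) : (ICat.mk X A).fibre x ⥤ (ICat.mk X B).fibre x :=
  (t.app ⟨op x⟩).toFunctor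

/-- The structure isomorphism of an indexed 1-cell over an identity functor. -/
def overNat {x y : X} (k : x ⟶ y) (a : (ICat.mk X A).fibre y) :
    (overApp t x).obj (((ICat.mk X A).pull k).obj a) ≅
      ((ICat.mk X B).pull k).obj ((overApp t y).obj a) :=
  Hom.nat (overId t) k a

theorem overNat_natural {x y : X} (k : x ⟶ y) {a b : (ICat.mk X A).fibre y} (m : a ⟶ b) :
    (overApp t x).map (((ICat.mk X A).pull k).map m) ≫ (overNat t k b).hom =
      (overNat t k a).hom ≫ ((ICat.mk X B).pull k).map ((overApp t y).map m) :=
  Hom.nat_natural (overId t) k m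

theorem overNat_inv_natural {x y : X} (k : x ⟶ y) {a b : (ICat.mk X A).fibre y} (m : a ⟶ b) :
    (overNat t k a).inv ≫ (overApp t x).map (((ICat.mk X A).pull k).map m) =
      ((ICat.mk X B).pull k).map ((overApp t y).map m) ≫ (overNat t k b).inv := by
  rw [Iso.inv_comp_eq, ← Category.assoc, Iso.eq_comp_inv, overNat_natural]

/-- Over `𝟭 X` the correction `pullCongr` in `Hom.nat_id` compares definitionally equal morphisms,
so it is an identity and drops out. -/
theorem overNat_id (x : X) (a : (ICat.mk X A).fibre x) :
    (overNat t (𝟙 x) a).hom ≫ ((ICat.mk X B).pullId x _).hom =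
      (overApp t x).map ((ICat.mk X A).pullId x a).hom :=
  (congrArg (_ ≫ ·) (Category.id_comp _).symm).trans (Hom.nat_id (overId t) x a)

theorem overNat_comp {x y z : X} (k : x ⟶ y) (l : y ⟶ z) (a : (ICat.mk X A).fibre z) :
    (overNat t (k ≫ l) a).hom ≫ ((ICat.mk X B).pullComp k l _).hom =
      (overApp t x).map ((ICat.mk X A).pullComp k l a).hom ≫
        (overNat t k (((ICat.mk X A).pull l).obj a)).hom ≫
          ((ICat.mk X B).pull k).map (overNat t l a).hom :=
  (congrArg (_ ≫ ·) (Category.id_comp _).symm).trans (Hom.nat_comp (overId t) k l a)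

variable {t} {G : ∀ x : X, (ICat.mk X B).fibre x ⥤ (ICat.mk X A).fibre x}
  (h₁ : ∀ x, overApp t x ⋙ G x = 𝟭 _) (h₂ : ∀ x, G x ⋙ overApp t x = 𝟭 _)

/-- The structure isomorphism of the inverse of a pointwise invertible indexed 1-cell. -/
def invNat {x y : X} (k : x ⟶ y) (b : (ICat.mk X B).fibre y) :
    (G x).obj (((ICat.mk X B).pull k).obj b) ≅ ((ICat.mk X A).pull k).obj ((G y).obj b) :=
  -- This is the mate of `overNat`, with `τ` the given components: `G k^* b ≅ G k^* τ G b ≅ G τ k^*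
  -- G b ≅ k^* G b`. The outer steps come from the inverse laws and the middle one is the inverse of
  -- the structure isomorphism of `t`.
  (G x).mapIso (((ICat.mk X B).pull k).mapIso (idIso (h₂ y) b).symm ≪≫
    (overNat t k ((G y).obj b)).symm) ≪≫ idIso (h₁ x) _

/-- Applying the component of `t` removes the outer `G`. As that component is faithful, each axiom
for `invNat` reduces through this formula to the corresponding axiom for `overNat`. -/
theorem map_invNat {x y : X} (k : x ⟶ y) (b : (ICat.mk X B).fibre y) :
    (overApp t x).map (invNat h₁ h₂ k b).hom = (idIso (h₂ x) _).hom ≫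
      ((ICat.mk X B).pull k).map (idIso (h₂ y) b).inv ≫ (overNat t k ((G y).obj b)).inv := by
  simp only [invNat, Iso.trans_hom, Functor.map_comp, map_idIso (h₁ x) (h₂ x), Functor.mapIso_hom,
    Iso.symm_hom, Category.assoc, idIso_natural]
  simp only [← Category.assoc, idIso_natural]

theorem invNat_natural {x y : X} (k : x ⟶ y) {a b : (ICat.mk X B).fibre y} (m : a ⟶ b) :
    (G x).map (((ICat.mk X B).pull k).map m) ≫ (invNat h₁ h₂ k b).hom =
      (invNat h₁ h₂ k a).hom ≫ ((ICat.mk X A).pull k).map ((G y).map m) :=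
  map_injective_of_comp_eq_id (h₁ x) (by
    simp only [Functor.map_comp, map_invNat, Category.assoc, overNat_inv_natural]
    rw [← Category.assoc, idIso_natural, Category.assoc, ← Functor.map_comp_assoc,
      ← Functor.map_comp_assoc, idIso_inv_natural])

theorem invNat_id (x : X) (a : (ICat.mk X B).fibre x) :
    (invNat h₁ h₂ (𝟙 x) a).hom ≫ ((ICat.mk X A).pullId x _).hom =
      (G x).map ((ICat.mk X B).pullId x a).hom :=
  map_injective_of_comp_eq_id (h₁ x) (by
    rw [Functor.map_comp, map_invNat, Category.assoc, Category.assoc, ← overNat_id,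
      Iso.inv_hom_id_assoc, pullId_natural, ← Category.assoc, ← idIso_natural, Category.assoc,
      Iso.hom_inv_id, Category.comp_id])

theorem invNat_comp {x y z : X} (k : x ⟶ y) (l : y ⟶ z) (a : (ICat.mk X B).fibre z) :
    (invNat h₁ h₂ (k ≫ l) a).hom ≫ ((ICat.mk X A).pullComp k l _).hom =
      (G x).map ((ICat.mk X B).pullComp k l a).hom ≫
        (invNat h₁ h₂ k (((ICat.mk X B).pull l).obj a)).hom ≫
          ((ICat.mk X A).pull k).map (invNat h₁ h₂ l a).hom :=
  map_injective_of_comp_eq_id (h₁ x) (by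
    -- This is `overNat_comp` solved for the inverses, the form in which the structure isomorphisms
    -- enter `map_invNat`.
    have e : (overNat t (k ≫ l) ((G z).obj a)).inv ≫
        (overApp t x).map ((ICat.mk X A).pullComp k l ((G z).obj a)).hom =
        ((ICat.mk X B).pullComp k l _).hom ≫
          ((ICat.mk X B).pull k).map (overNat t l ((G z).obj a)).inv ≫
            (overNat t k _).inv := by
      rw [Iso.inv_comp_eq, ← Category.assoc, overNat_comp]
      simp only [Category.assoc, ← Functor.map_comp_assoc, Iso.hom_inv_id,
        CategoryTheory.Functor.map_id, Category.id_comp, Category.comp_id]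
    simp only [Functor.map_comp, map_invNat, Category.assoc, overNat_inv_natural, e]
    rw [← Category.assoc ((overApp t x).map _), idIso_natural, Category.assoc,
      ← Category.assoc _ ((ICat.mk X B).pullComp k l _).hom, pullComp_natural, Category.assoc]
    -- Under `k^*`, the `idIso` closing the inner `invNat` meets its inverse from the outer one and
    -- cancels.
    simp only [← Functor.map_comp_assoc, Iso.inv_hom_id_assoc])

/-- The inverse of a pointwise invertible indexed 1-cell. -/
def pointwiseInv : ICat.mk X B ⟶ ICat.mk X A :=
  Hom.mk' (𝟭 X) G (invNat h₁ h₂) (invNat_natural h₁ h₂)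
    (fun x a => (congrArg (_ ≫ ·) (Category.id_comp _)).trans (invNat_id h₁ h₂ x a))
    (fun k l a => (congrArg (_ ≫ ·) (Category.id_comp _)).trans (invNat_comp h₁ h₂ k l a))

/-- On components this is the family of equalities `h₁`. For the structure isomorphisms, the
contribution of `t` cancels against its inverse inside the mate, leaving only `eqToHom`s. -/
theorem overId_pointwiseInv : overId t ≫ pointwiseInv h₁ h₂ = 𝟙 (ICat.mk X A) := by
  refine Hom.ext' rfl (heq_of_eq (funext fun p =>
    congrArg Functor.toCatHom (h₁ p.as.unop))) fun {x y} k a => ?_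
  have e : (G x).map (overNat t k a).hom ≫ (invNat h₁ h₂ k ((overApp t y).obj a)).hom =
      (idIso (h₁ x) _).hom ≫ ((ICat.mk X A).pull k).map (idIso (h₁ y) a).inv :=
    map_injective_of_comp_eq_id (h₁ x) (by
      rw [Functor.map_comp, map_invNat, ← Category.assoc, idIso_natural, Category.assoc,
        ← map_idIso_inv (h₁ y), ← overNat_inv_natural, Iso.hom_inv_id_assoc, Functor.map_comp,
        map_idIso (h₁ x) (h₂ x)])
  exact (heq_of_eq e).trans (idIso_comp_map_heq_id (h₁ x) (h₁ y) _ a)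

end Pointwise

/-- An indexed 1-cell over an identity functor is invertible if its components are. -/
theorem isIso_of_pointwise {X : Type u} [Category.{v} X]
    {A B : Pseudofunctor (LocallyDiscrete Xᵒᵖ) Cat.{v, u}}
    (t : Pseudofunctor.StrongTrans A (reindex (𝟭 X) B))
    (h : ∀ x : X, ∃ G : (ICat.mk X B).fibre x ⥤ (ICat.mk X A).fibre x,
      overApp t x ⋙ G = 𝟭 _ ∧ G ⋙ overApp t x = 𝟭 _) : IsIso (overId t) := by
  choose G h₁ h₂ using h
  have e₁ := overId_pointwiseInv h₁ h₂
  -- The same lemma is applied with the roles exchanged: the inverse just built is itself pointwise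
  -- invertible, with the components of `t` as inverses. Thus it has a left inverse by `e₁` and a
  -- right inverse by `e₂`.
  have e₂ := overId_pointwiseInv (t := (pointwiseInv h₁ h₂).trans) (G := fun x => overApp t x)
    h₂ h₁
  -- Left and right inverses agree, so the second composite never has to be computed.
  have e₃ : overId t = pointwiseInv h₂ h₁ :=
    (Category.comp_id _).symm.trans ((congrArg (overId t ≫ ·) e₂).symm.trans
      ((Category.assoc _ _ _).symm.trans
        ((congrArg (· ≫ pointwiseInv h₂ h₁) e₁).trans (Category.id_comp _))))
  exact ⟨pointwiseInv h₁ h₂, e₁, (congrArg (pointwiseInv h₁ h₂ ≫ ·) e₃).trans e₂⟩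


/-! ### The counit: an indexed category is recovered from its Grothendieck construction -/

section
variable (M : ICat.{v, u}) (κ : Fib.Cleavage M.fibration)

/-- This is a triangle identity between `counitInv` and `unitInv`, on morphisms. It holds because
`(k, m)` is `vert m` followed by the canonical lift of `k`, and `toFibreNat` is the factorization of
the canonical lift through the chosen one. -/
theorem toHom_counitInv_map {p q : M.Total} (φ : p ⟶ q) :
    κ.toHom ((Hom.total (counitInv M κ)).map φ) = φ := by
  obtain ⟨x, a⟩ := p
  obtain ⟨y, b⟩ := q
  obtain ⟨k, (m : a ⟶ (M.pull k).obj b)⟩ := φ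
  change M.fibration.incl.map ((toFibre M x).map m ≫ (toFibreNat M κ k b).hom) ≫ κ.lift k _ = _
  rw [Functor.map_comp, Category.assoc, toFibreNat_fac]
  exact (vert_comp_homMk m k _).trans (congrArg (homMk k) (Category.comp_id _))

end

variable {M N : ICat.{v, u}} (κ : Fib.Cleavage M.fibration) (μ : Fib.Cleavage N.fibration)

theorem toFibre_restr (f : M ⟶ N) (x : M.base) :
    toFibre M x ⋙ Fib.restr (fibrationMap f) x = f.app x ⋙ toFibre N (f.base.obj x) :=
  Functor.hext (fun _ => rfl) fun _ _ m =>
    heq_of_eq (N.fibration.incl_injective (total_map_vert f m))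

/-- The components agree strictly by `toFibre_restr`. The structure isomorphisms land in a chosen
pullback and may be compared after composition with the chosen lift, where both give the image under
`f.total` of the canonical lift of `k`. -/
theorem counitInv_naturality (f : M ⟶ N) :
    f ≫ counitInv N μ = counitInv M κ ≫ κ.indexedMap μ (fibrationMap f) := by
  refine Hom.ext' rfl (heq_of_eq (funext fun p =>
    congrArg Functor.toCatHom (toFibre_restr f p.as.unop).symm)) fun {x y} k a => heq_of_eq ?_
  refine μ.ext₁ (f.base.map k) (b := (toFibre N _).obj ((f.app y).obj a))
    (c := (toFibre N _).obj ((f.app x).obj ((M.pull k).obj a))) ?_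
  change N.fibration.incl.map ((toFibre N _).map (f.nat k a).hom ≫
      (toFibreNat N μ (f.base.map k) ((f.app y).obj a)).hom) ≫ _ =
    N.fibration.incl.map ((Fib.restr (fibrationMap f) x).map (toFibreNat M κ k a).hom ≫
      (κ.restrNat μ (fibrationMap f) k ((toFibre M y).obj a)).hom) ≫ _
  refine (congrArg (· ≫ _) (Functor.map_comp _ _ _)).trans ((Category.assoc _ _ _).trans
    ((congrArg (_ ≫ ·) (toFibreNat_fac N μ _ _)).trans (Eq.trans ?_ (Eq.symm
      ((congrArg (· ≫ _) (Functor.map_comp _ _ _)).trans (Category.assoc _ _ _))))))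
  -- The left side is now `vert (f.nat k a).hom ≫ cartLift`. On the right, `restrNat_fac` and
  -- `toFibreNat_fac` produce `f.total.map (cartLift k a)`, whose fibre component is `f.nat k a`
  -- preceded by the image of an identity.
  refine ((vert_comp_homMk _ _ _).trans (congrArg (homMk (f.base.map k)) ?_)).trans
    ((congrArg (_ ≫ ·) (κ.restrNat_fac μ (fibrationMap f) k _)).trans
      ((f.total.map_comp _ _).symm.trans
        (congrArg f.total.map (toFibreNat_fac M κ k a)))).symm
  exact (Category.comp_id _).trans
    ((congrArg (· ≫ _) ((f.app x).map_id _)).trans (Category.id_comp _)).symm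

theorem counitInv_naturality₂ {f g : M ⟶ N} (η : f ⟶ g) :
    Bicategory.whiskerRight η (counitInv N μ) ≍
      Bicategory.whiskerLeft (counitInv M κ) (κ.indexedMap₂ μ (fibrationMap₂ η)) :=
  hom₂_heq (counitInv_naturality κ μ f) (counitInv_naturality κ μ g) (fun _ => HEq.rfl)
    -- Read in the total category of `N.fibration`, both components are `η.totalApp p`: the left by
    -- the triangle identity, the right because the factorizations of `fibrationMap₂ η` are
    -- recomposed with their lifts.
    fun p => μ.toHom_heq rfl rfl HEq.rfl (heq_of_eq
      ((toHom_counitInv_map N μ (η.totalApp p)).trans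
        (κ.toHom_totalApp μ (fibrationMap₂ η) ((Hom.total (counitInv M κ)).obj p)).symm))

instance toFibre_faithful (x : M.base) : (toFibre M x).Faithful where
  map_injective h := vert_injective (congrArg M.fibration.incl.map h)

instance toFibre_full (x : M.base) : (toFibre M x).Full where
  map_surjective {a b} n := by
    obtain ⟨⟨k, (m : a ⟶ (M.pull k).obj b)⟩, hn⟩ := n
    -- Lying above `𝟙 x` fixes the base component. The fibre component still ends in `(𝟙 x)^* b`,
    -- and composing with `pullId` gives the preimage in `M x`.
    obtain rfl : k = 𝟙 x := (Fib.isHomLift_iff M.fibration.proj (a := (⟨x, a⟩ : M.Total))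
      (b := (⟨x, b⟩ : M.Total)) (𝟙 x) (homMk k m)).1 hn
    refine ⟨m ≫ (M.pullId x b).hom, M.fibration.incl_injective (congrArg (homMk (𝟙 x)) ?_)⟩
    exact (Category.assoc _ _ _).trans
      ((congrArg (m ≫ ·) (M.pullId x b).hom_inv_id).trans (Category.comp_id m))

theorem toFibre_obj_bijective (x : M.base) : Function.Bijective (toFibre M x).obj := by
  constructor
  · intro a b h
    have h' : (⟨x, a⟩ : M.Total) = ⟨x, b⟩ := congrArg Subtype.val h
    injection h'
  · rintro ⟨⟨x, a⟩, rfl⟩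
    exact ⟨a, rfl⟩

/-- Whatever the cleavage, each component is a strict isomorphism onto the fibre. The cleavage
affects only the structure isomorphisms, which the pointwise criterion handles. -/
theorem isIso_counitInv : IsIso (counitInv M κ) :=
  isIso_of_pointwise (A := M.fam) (B := κ.indexed.fam) (counitInv M κ).trans fun x =>
    exists_strict_inverse (toFibre M x) (toFibre_obj_bijective x)

/-- The 2-natural isomorphism `M₍₋₎ ∘ ∫ ≅ 1`. -/
noncomputable def counit (κ : ∀ P : Fib.{v, u}, Fib.Cleavage P) :
    TwoNatIso (grothendieck.comp (Fib.fibres κ)) (StrictPseudofunctor.id ICat.{v, u}) :=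
  -- The isomorphism is reversed, so `counitInv` becomes the inverse component. This matches
  -- `TwoNatIso.ofInv`, which takes naturality of inverses.
  .ofInv (fun M => have := isIso_counitInv (κ M.fibration)
      (asIso (counitInv M (κ M.fibration))).symm)
    (fun f => counitInv_naturality (κ _) (κ _) f)
    (fun η => counitInv_naturality₂ (κ _) (κ _) η)

end ICat

/-! ### The symmetric monoidal 2-equivalence -/

theorem mainTheorem7 (κ : ∀ P : Fib.{v, u}, Fib.Cleavage P) :
    ∃ e : SymmetricMonoidalTwoEquivalence (Fib.fibres κ) ICat.grothendieck,
      (∀ P : Fib.{v, u}, e.unit.iso.hom.app P = (κ P).unitHom) ∧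
      (∀ M : ICat.{v, u}, e.counit.iso.inv.app M = M.counitInv (κ M.fibration)) :=
  ⟨.ofCartesian (Fib.fibres κ) ICat.grothendieck (Fib.unit κ) (ICat.counit κ),
    -- `TwoNatIso.ofInv` and `SymmetricMonoidalTwoEquivalence.ofCartesian` keep the given components
    -- unchanged, so both identifications are definitional.
    fun _ => rfl, fun _ => rfl⟩
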